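/- Let $d\ge 2$, $\mathbb T^d=\mathbb R^d/2\pi\mathbb Z^d$, $T^*\mathbb T^d=\mathbb T^d\times\mathbb R^d$. For a symbol $a$ on $T^*\mathbb T^d$ put $\widehat a(k,\xi)=(2\pi)^{-d/2}\int_{\mathbb T^d}a(x,\xi)e^{-ik\cdot x}\,dx$ ($k\in\mathbb Z^d$) and let $\operatorname{Op}_\hbar(a)$ be its semiclassical Weyl quantization on $L^2(\mathbb T^d)$, i.e. the operator with matrix entries $\langle e_j,\operatorname{Op}_\hbar(a)e_k\rangle=(2\pi)^{-d/2}\,\widehat a\big(j-k,\tfrac{\hbar(j+k)}2\big)$ in the basis $e_k(x)=(2\pi)^{-d/2}e^{ik\cdot x}$. Let $\Gamma\subset\mathbb R^d$ be a lattice generated by a basis of $\mathbb R^d$, and let $\chi_0\in\mathscr S(\mathbb R^d)$ satisfy $\sum_{j\in\Gamma}\chi_j=1$, where $\chi_j=\chi_0(\cdot-j)$. Let $S_W(\mathbb R^d)$ be the space of bounded continuous $f$ with $\|f\|_W:=\big\|\sup_{j\in\Gamma}|\widehat{\chi_jf}|\,\big\|_{L^1(\mathbb R^d)}<\infty$ (up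 to a fixed normalizing constant depending only on $d$). For $\rho>0$ let $\mathcal A_{W,\rho}(T^*\mathbb T^d)$ be the set of real-valued $g\in C^\infty(T^*\mathbb T^d)$ with $\widehat g(k,\cdot)\in S_W(\mathbb R^d)$ for all $k\in\mathbb Z^d$ and $\|g\|_{W,\rho}:=(2\pi)^{-d/2}\sum_{k\in\mathbb Z^d}\|\widehat g(k,\cdot)\|_W\,e^{|k|\rho}<\infty$. For a family $(\widehat A_\hbar)_{\hbar\in(0,1]}$ of operators on $L^2(\mathbb T^d)$, consider sequences $\hbar_n\to0$ in $(0,1]$ and $\psi_n\in L^2(\mathbb T^d)$ with $\|\psi_n\|_{L^2}=1$ and $\widehat A_{\hbar_n}\psi_n=\lambda_n\psi_n$, $\lambda_n\to1$. Let $\mathcal M(\widehat A_\hbar)$ be the set of all Radon measures $\mu$ on $T^*\mathbb T^d$ such that, for some such sequence, $\langle\psi_n,\operatorname{Op}_{\hbar_n}(a)\psi_n\rangle\to\int a\,d\mu$ for every $a\in C_c^\infty(T^*\mathbb T^d)$, and let $\mathcal N(\widehat A_\hbar)$ be the set of all weak-$\star$ limits on $\mathbb T^d$ of the densities $|\psi_n(x)|^2dx$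 of such sequences. Let $\operatorname{Sp}^p$ denote the set of eigenvalues. **Theorem.** There is a constant $C$, depending only on $d$, $\Gamma$ and $\chi_0$, with the following property. Let $\omega\in\mathbb R^d$ be Diophantine: $|k\cdot\omega|\ge\varsigma|k|^{-(\gamma-1)}$ for all $k\in\mathbb Z^d\setminus\{0\}$, for some $\varsigma>0$ and $\gamma>d$. Let $\rho>0$, let $V\in\mathcal A_{W,\rho}(T^*\mathbb T^d)$ (no smallness is assumed), and let $\varepsilon_\hbar>0$, $\hbar\in(0,1]$, satisfy $\varepsilon_\hbar/\hbar\to0$ as $\hbar\to0^+$. Then there are real-valued functions $R_\hbar=R_\hbar(\xi)\in S_W(\mathbb R^d)$, $\hbar\in(0,1]$, with $\|R_\hbar\|_W\le C\|V\|_{W,\rho}$ for all $\hbar\in(0,1]$, such that, with $\widehat L_{\omega,\hbar}=\operatorname{Op}_\hbar(\omega\cdot\xi)=\omega\cdot\hbar D_x$ and $\widehat Q_\hbar=\widehat L_{\omega,\hbar}+\varepsilon_\hbar\operatorname{Op}_\hbar(V-R_\hbar)$: 1. for all sufficiently small $\hbar$, $\operatorname{Sp}^p(\widehat Q_\hbar)=\operatorname{Sp}^p(\widehat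 L_{\omega,\hbar})$; moreover $\operatorname{Sp}^p(\widehat L_{\omega,\hbar})=\{\hbar\,\omega\cdot k:k\in\mathbb Z^d\}$ for every $\hbar\in(0,1]$; 2. $\mathcal M(\widehat Q_\hbar)=\mathcal M(\widehat L_{\omega,\hbar})=\{\mathfrak h_{\mathbb T^d\times\{\xi\}}:\xi\in\mathbb R^d,\ \omega\cdot\xi=1\}\cup\{0\}$, where $\mathfrak h_{\mathbb T^d\times\{\xi\}}$ is the normalized Haar measure on $\mathbb T^d\times\{\xi\}$; 3. $\mathcal N(\widehat Q_\hbar)=\{(2\pi)^{-d}dx\}$. -/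

import Mathlib

open MeasureTheory Filter Topology
open scoped Real ENNReal NNReal FourierTransform ComplexConjugate

noncomputable section

namespace TorusKAM

instance factTwoPiPos : Fact (0 < 2 * π) := ⟨Real.two_pi_pos⟩

/-- The torus `ℝ^d / 2πℤ^d`. Its measure `volume` is Lebesgue measure, of total mass `(2π)^d`. -/
abbrev Torus (d : ℕ) : Type := Fin d → AddCircle (2 * π)

/-- Euclidean space `ℝ^d`. -/
abbrev E (d : ℕ) : Type := EuclideanSpace ℝ (Fin d)

/-- The phase space `T^*𝕋^d = 𝕋^d × ℝ^d`, with points `(x, ξ)`. -/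
abbrev Phase (d : ℕ) : Type := Torus d × E d

/-- The lattice `ℤ^d`. -/
abbrev Freq (d : ℕ) : Type := Fin d → ℤ

/-- The Hilbert space `L²(𝕋^d)` with respect to Lebesgue measure. -/
abbrev L2T (d : ℕ) : Type := Lp ℂ 2 (volume : Measure (Torus d))

/-- An integer vector, as a vector of Euclidean space. -/
def intVec {d : ℕ} (k : Freq d) : E d := WithLp.toLp 2 (fun i => (k i : ℝ))

/-- The character `x ↦ exp (i k · x)` of the torus. -/
def char {d : ℕ} (k : Freq d) : C(Torus d, ℂ) where
  toFun x := ∏ i, fourier (k i) (x i)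
  continuous_toFun := by fun_prop

theorem char_coe {d : ℕ} (k : Freq d) (x : E d) :
    char k (fun i => (x i : AddCircle (2 * π)))
      = Complex.exp (Complex.I * ((inner ℝ (intVec k) x : ℝ) : ℂ)) := by
  have h : ∀ i, fourier (k i) (x i : AddCircle (2 * π))
      = Complex.exp (Complex.I * ((k i : ℂ) * (x i : ℂ))) := by
    intro i
    rw [fourier_coe_apply]
    congr 1
    have : (π : ℂ) ≠ 0 := by exact_mod_cast Real.pi_ne_zero
    push_cast
    field_simp
  have h2 : (inner ℝ (intVec k) x : ℝ) = ∑ i, (k i : ℝ) * x i := by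
    simp [intVec, PiLp.inner_apply, mul_comm]
  rw [h2]
  simp only [char, ContinuousMap.coe_mk, h]
  rw [← Complex.exp_sum, ← Finset.mul_sum]
  push_cast
  rfl

theorem char_neg {d : ℕ} (k : Freq d) (x : Torus d) : char (-k) x = conj (char k x) := by
  simp only [char, Pi.neg_apply, fourier_neg, ContinuousMap.coe_mk, map_prod]

theorem char_add {d : ℕ} (k l : Freq d) (x : Torus d) :
    char (k + l) x = char k x * char l x := by
  simp only [char, Pi.add_apply, fourier_add, ContinuousMap.coe_mk, ← Finset.prod_mul_distrib]

theorem char_zero {d : ℕ} (x : Torus d) : char (0 : Freq d) x = 1 := by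
  simp only [char, Pi.zero_apply, fourier_zero, Finset.prod_const_one, ContinuousMap.coe_mk]

theorem integral_char {d : ℕ} (k : Freq d) :
    ∫ x : Torus d, char k x = if k = 0 then (((2 * π) ^ d : ℝ) : ℂ) else 0 := by
  split_ifs with h
  · subst h
    simp only [char_zero, integral_const, Measure.real, volume_pi, Measure.pi_univ,
      AddCircle.measure_univ, Finset.prod_const, Finset.card_univ, Fintype.card_fin,
      ENNReal.toReal_pow, ENNReal.toReal_ofReal Real.two_pi_pos.le]
    simp
  · simp only [char, ContinuousMap.coe_mk]
    rw [MeasureTheory.integral_fintype_prod_volume_eq_prod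
      (fun (i : Fin d) (y : AddCircle (2 * π)) => fourier (k i) y)]
    obtain ⟨i, hi⟩ := Function.ne_iff.mp h
    apply Finset.prod_eq_zero (Finset.mem_univ i)
    exact integral_eq_zero_of_add_right_eq_neg (μ := volume)
      (fourier_add_half_inv_index hi Real.two_pi_pos)

/-- The normalized character `e_k(x) = (2π)^(-d/2) exp (i k · x)`, as an element of `L²(𝕋^d)`. -/
def expL2 {d : ℕ} (k : Freq d) : L2T d :=
  (((√(2 * π)) ^ d)⁻¹ : ℂ) • ContinuousMap.toLp (E := ℂ) 2 volume ℂ (char k)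

theorem orthonormal_expL2 (d : ℕ) : Orthonormal ℂ (expL2 (d := d)) := by
  rw [orthonormal_iff_ite]
  intro m n
  have h : ∫ x : Torus d, char n x * conj (char m x)
      = if m = n then (((2 * π) ^ d : ℝ) : ℂ) else 0 := by
    simp only [← char_neg, ← char_add, integral_char]
    congr 1
    rw [← sub_eq_add_neg, sub_eq_zero]
    exact propext eq_comm
  rw [expL2, expL2, inner_smul_left, inner_smul_right, ContinuousMap.inner_toLp, h]
  split_ifs
  · have h3 : ((2 * π) ^ d : ℝ) = (√(2 * π)) ^ d * (√(2 * π)) ^ d := by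
      rw [← mul_pow, Real.mul_self_sqrt Real.two_pi_pos.le]
    have h4 : ((√(2 * π) : ℝ) : ℂ) ^ d ≠ 0 := by
      apply pow_ne_zero
      exact_mod_cast (Real.sqrt_pos.mpr Real.two_pi_pos).ne'
    rw [h3]
    push_cast
    rw [map_inv₀, map_pow, Complex.conj_ofReal]
    field_simp
  · simp

/-- The linear span of the characters, as a star subalgebra of `C(𝕋^d, ℂ)`. -/
def charSubalgebra (d : ℕ) : StarSubalgebra ℂ C(Torus d, ℂ) where
  toSubalgebra := Algebra.adjoin ℂ (Set.range char)
  star_mem' := by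
    change Algebra.adjoin ℂ (Set.range char) ≤ star (Algebra.adjoin ℂ (Set.range char))
    refine Algebra.adjoin_le ?_
    rintro _ ⟨n, rfl⟩
    refine Algebra.subset_adjoin ⟨-n, ?_⟩
    ext1 x
    simp only [char_neg, starRingEnd_apply, ContinuousMap.star_apply]

theorem charSubalgebra_coe (d : ℕ) :
    (charSubalgebra d).toSubalgebra.toSubmodule = Submodule.span ℂ (Set.range char) := by
  apply Algebra.adjoin_eq_span_of_subset
  refine .trans (fun x => Submonoid.closure_induction (fun _ => id) ⟨0, ?_⟩ ?_)
    Submodule.subset_span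
  · ext z
    simp only [char_zero, ContinuousMap.one_apply]
  · rintro _ _ _ _ ⟨m, rfl⟩ ⟨n, rfl⟩
    refine ⟨m + n, ?_⟩
    ext z
    simp only [char_add, ContinuousMap.mul_apply]

theorem char_single {d : ℕ} (i : Fin d) (z : Torus d) :
    char (Pi.single i 1) z = AddCircle.toCircle (z i) := by
  simp only [char, ContinuousMap.coe_mk]
  rw [Finset.prod_eq_single i]
  · simp
  · intro j _ hj
    simp [Pi.single_eq_of_ne hj]
  · simp

theorem charSubalgebra_separatesPoints (d : ℕ) : (charSubalgebra d).SeparatesPoints := by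
  intro x y hxy
  obtain ⟨i, hi⟩ := Function.ne_iff.mp hxy
  refine ⟨_, ⟨char (Pi.single i 1), Algebra.subset_adjoin ⟨Pi.single i 1, rfl⟩, rfl⟩, ?_⟩
  change char (Pi.single i 1) x ≠ char (Pi.single i 1) y
  rw [char_single, char_single, Ne, ← Circle.ext_iff]
  contrapose hi
  exact AddCircle.injective_toCircle Real.two_pi_pos.ne' hi

theorem span_char_closure (d : ℕ) :
    (Submodule.span ℂ (Set.range (char (d := d)))).topologicalClosure = ⊤ := by
  rw [← charSubalgebra_coe]
  exact congr_arg (Subalgebra.toSubmodule <| StarSubalgebra.toSubalgebra ·)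
    (ContinuousMap.starSubalgebra_topologicalClosure_eq_top_of_separatesPoints _
      (charSubalgebra_separatesPoints d))

theorem span_expL2_closure (d : ℕ) :
    (Submodule.span ℂ (Set.range (expL2 (d := d)))).topologicalClosure = ⊤ := by
  have h1 : (Submodule.span ℂ (Set.range fun k : Freq d =>
      (ContinuousMap.toLp (E := ℂ) 2 volume ℂ (char k) : L2T d))).topologicalClosure = ⊤ := by
    simpa only [Submodule.map_span, ContinuousLinearMap.coe_coe, ← Set.range_comp,
      Function.comp_def] using
      (ContinuousMap.toLp_denseRange ℂ (volume : Measure (Torus d)) ℂ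
        (p := 2) (ENNReal.ofNat_ne_top)).topologicalClosure_map_submodule (span_char_closure d)
  rw [eq_top_iff, ← h1]
  apply Submodule.topologicalClosure_mono
  rw [Submodule.span_le]
  rintro _ ⟨k, rfl⟩
  have h4 : ((√(2 * π) : ℝ) : ℂ) ^ d ≠ 0 := by
    apply pow_ne_zero
    exact_mod_cast (Real.sqrt_pos.mpr Real.two_pi_pos).ne'
  have h5 : (ContinuousMap.toLp (E := ℂ) 2 volume ℂ (char k) : L2T d)
      = (((√(2 * π) : ℝ) : ℂ) ^ d) • expL2 k := by
    rw [expL2, smul_smul, mul_inv_cancel₀ h4, one_smul]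
  simp only [SetLike.mem_coe]
  rw [h5]
  exact Submodule.smul_mem _ _ (Submodule.subset_span ⟨k, rfl⟩)

/-- The Fourier basis `(e_k)` of `L²(𝕋^d)`; thus `(torusBasis d).repr ψ k = ⟪e_k, ψ⟫` is the
`k`-th Fourier coefficient of `ψ`. -/
def torusBasis (d : ℕ) : HilbertBasis (Freq d) ℂ (L2T d) :=
  HilbertBasis.mk (orthonormal_expL2 d) (span_expL2_closure d).ge

theorem coe_torusBasis (d : ℕ) : ⇑(torusBasis d) = expL2 := HilbertBasis.coe_mk _ _

/-! ### Weyl quantization -/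

/-- The Fourier coefficient `â(k, ξ) = (2π)^(-d/2) ∫ a(x, ξ) exp (-i k · x) dx`. -/
def symbolCoeff {d : ℕ} (a : Phase d → ℂ) (k : Freq d) (ξ : E d) : ℂ :=
  ((√(2 * π)) ^ d : ℂ)⁻¹ * ∫ x : Torus d, a (x, ξ) * conj (char k x)

/-- The matrix entry `⟪e_j, Op_ħ(a) e_k⟫ = (2π)^(-d) ∫ a(x, ħ(j+k)/2) exp (-i (j-k) · x) dx` of the
semiclassical Weyl quantization of the symbol `a`. -/
def weylMatrix {d : ℕ} (ħ : ℝ) (a : Phase d → ℂ) (j k : Freq d) : ℂ :=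
  ((√(2 * π)) ^ d : ℂ)⁻¹ * symbolCoeff a (j - k) ((ħ / 2) • intVec (j + k))

/-- The function `j ↦ ∑_k m j k ψ̂(k)` on `ℤ^d`, where `ψ̂(k) = ⟪e_k, ψ⟫`. -/
def matApply {d : ℕ} (m : Freq d → Freq d → ℂ) (ψ : L2T d) (j : Freq d) : ℂ :=
  ∑' k, m j k * (torusBasis d).repr ψ k

theorem matApply_add {d : ℕ} (m : Freq d → Freq d → ℂ) (φ ψ : L2T d)
    (h1 : ∀ j, Summable fun k => m j k * (torusBasis d).repr φ k)
    (h2 : ∀ j, Summable fun k => m j k * (torusBasis d).repr ψ k) :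
    matApply m (φ + ψ) = matApply m φ + matApply m ψ := by
  funext j
  simp only [matApply, Pi.add_apply, ← (h1 j).tsum_add (h2 j), map_add, lp.coeFn_add, mul_add]

theorem matApply_smul {d : ℕ} (m : Freq d → Freq d → ℂ) (c : ℂ) (ψ : L2T d) :
    matApply m (c • ψ) = c • matApply m ψ := by
  funext j
  simp only [matApply, Pi.smul_apply, map_smul, lp.coeFn_smul, smul_eq_mul, mul_left_comm,
    tsum_mul_left]

/-- The `ψ ∈ L²(𝕋^d)` for which the sums `∑_k m j k ψ̂(k)` converge absolutely and form a
square-summable family. -/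
def matDomain {d : ℕ} (m : Freq d → Freq d → ℂ) : Submodule ℂ (L2T d) where
  carrier := {ψ | (∀ j, Summable fun k => m j k * (torusBasis d).repr ψ k) ∧
    Memℓp (matApply m ψ) 2}
  zero_mem' := by
    have h : matApply m (0 : L2T d) = 0 := by
      simpa using matApply_smul m 0 (0 : L2T d)
    refine ⟨fun j => ?_, ?_⟩
    · simp only [map_zero, lp.coeFn_zero, Pi.zero_apply, mul_zero]
      exact summable_zero
    · rw [h]
      exact zero_memℓp
  add_mem' := by
    rintro φ ψ ⟨h1, h2⟩ ⟨h3, h4⟩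
    refine ⟨fun j => ?_, ?_⟩
    · simp only [map_add, lp.coeFn_add, Pi.add_apply, mul_add]
      exact (h1 j).add (h3 j)
    · rw [matApply_add m φ ψ h1 h3]
      exact h2.add h4
  smul_mem' := by
    rintro c ψ ⟨h1, h2⟩
    refine ⟨fun j => ?_, ?_⟩
    · simp only [map_smul, lp.coeFn_smul, Pi.smul_apply, smul_eq_mul, mul_left_comm]
      exact (h1 j).mul_left c
    · rw [matApply_smul]
      exact h2.const_smul c

/-- The operator on `L²(𝕋^d)` with matrix `m` in the Fourier basis, on its maximal domain. -/
def matOp {d : ℕ} (m : Freq d → Freq d → ℂ) : L2T d →ₗ.[ℂ] L2T d where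
  domain := matDomain m
  toFun :=
    { toFun := fun ψ => (torusBasis d).repr.symm ⟨matApply m (ψ : L2T d), ψ.2.2⟩
      map_add' := by
        intro φ ψ
        rw [← map_add]
        congr 1
        apply Subtype.ext
        exact matApply_add m φ ψ φ.2.1 ψ.2.1
      map_smul' := by
        intro c ψ
        rw [RingHom.id_apply, ← map_smul]
        congr 1
        apply Subtype.ext
        exact matApply_smul m c ψ }

/-- The semiclassical Weyl quantization `Op_ħ(a)`, with its maximal domain in `L²(𝕋^d)`: the
`j`-th Fourier coefficient of `Op_ħ(a) ψ` is `∑_k ⟪e_j, Op_ħ(a) e_k⟫ ⟪e_k, ψ⟫`. -/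
def weylOp {d : ℕ} (ħ : ℝ) (a : Phase d → ℂ) : L2T d →ₗ.[ℂ] L2T d := matOp (weylMatrix ħ a)

/-- The linear symbol `ℒ_ω(x, ξ) = ω · ξ`. -/
def linSymbol {d : ℕ} (ω : E d) (p : Phase d) : ℂ := ((inner ℝ ω p.2 : ℝ) : ℂ)

/-- The operator `L̂_{ω,ħ} = Op_ħ(ℒ_ω) = ω · ħ D_x`, with domain
`{ψ ∈ L² : ω · D_x ψ ∈ L²}`. -/
def opL {d : ℕ} (ω : E d) (ħ : ℝ) : L2T d →ₗ.[ℂ] L2T d := weylOp ħ (linSymbol ω)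

/-- The operator `Q̂_ħ = L̂_{ω,ħ} + ε_ħ Op_ħ(V - R_ħ)`. -/
def opQ {d : ℕ} (ω : E d) (ε : ℝ → ℝ) (V : Phase d → ℝ) (R : ℝ → E d → ℝ) (ħ : ℝ) :
    L2T d →ₗ.[ℂ] L2T d :=
  opL ω ħ + ((ε ħ : ℝ) : ℂ) • weylOp ħ (fun p => ((V p - R ħ p.2 : ℝ) : ℂ))

/-! ### Spectra, semiclassical measures and quantum limits -/

/-- `ψ` belongs to the domain of `A` and `A ψ = z ψ`. -/
def EigenEq {d : ℕ} (A : L2T d →ₗ.[ℂ] L2T d) (z : ℂ) (ψ : L2T d) : Prop :=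
  ∃ h : ψ ∈ A.domain, A ⟨ψ, h⟩ = z • ψ

/-- The point spectrum: the set of all eigenvalues. -/
def pointSpectrum {d : ℕ} (A : L2T d →ₗ.[ℂ] L2T d) : Set ℂ :=
  {z | ∃ ψ : L2T d, ψ ≠ 0 ∧ EigenEq A z ψ}

open Classical in
/-- The Wigner distribution `W^ħ_ψ(a) = ⟪ψ, Op_ħ(a) ψ⟫`. (For a test function `a` the operator
`Op_ħ(a)` is bounded and everywhere defined, so that the second case does not occur.) -/
def wigner {d : ℕ} (ħ : ℝ) (ψ : L2T d) (a : Phase d → ℂ) : ℂ :=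
  if h : ψ ∈ (weylOp ħ a).domain then inner ℂ ψ (weylOp ħ a ⟨ψ, h⟩) else 0

/-- The function `a` on `T^*𝕋^d` is smooth, that is, its lift to `ℝ^d × ℝ^d` is. -/
def SmoothSymbol {d : ℕ} {F : Type*} [NormedAddCommGroup F] [NormedSpace ℝ F]
    (a : Phase d → F) : Prop :=
  ContDiff ℝ ((⊤ : ℕ∞) : WithTop ℕ∞)
    (fun p : E d × E d => a (fun i => (p.1 i : AddCircle (2 * π)), p.2))

/-- `ψ_n` is a sequence of normalized eigenfunctions of `A_{ħ_n}` with real eigenvalues `lam_n`,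
where `ħ_n ∈ (0,1]`, `ħ_n → 0` and `lam_n → 1`. -/
structure EigenSequence {d : ℕ} (A : ℝ → L2T d →ₗ.[ℂ] L2T d)
    (ħ : ℕ → ℝ) (lam : ℕ → ℝ) (ψ : ℕ → L2T d) : Prop where
  mem : ∀ n, ħ n ∈ Set.Ioc (0 : ℝ) 1
  tendsto_zero : Tendsto ħ atTop (𝓝 0)
  norm_eq : ∀ n, ‖ψ n‖ = 1
  eigen : ∀ n, EigenEq (A (ħ n)) (lam n : ℂ) (ψ n)
  tendsto_one : Tendsto lam atTop (𝓝 1)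

/-- The set `ℳ(A_ħ)` of semiclassical measures: the Radon measures `μ` on `T^*𝕋^d` that are limits
of the Wigner distributions of such sequences of eigenfunctions, tested against `C_c^∞`. -/
def semiclassicalMeasures {d : ℕ} (A : ℝ → L2T d →ₗ.[ℂ] L2T d) : Set (Measure (Phase d)) :=
  {μ | IsLocallyFiniteMeasure μ ∧ ∃ (ħ : ℕ → ℝ) (lam : ℕ → ℝ) (ψ : ℕ → L2T d),
    EigenSequence A ħ lam ψ ∧
    ∀ a : Phase d → ℂ, SmoothSymbol a → HasCompactSupport a →
      Tendsto (fun n => wigner (ħ n) (ψ n) a) atTop (𝓝 (∫ p, a p ∂μ))}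

/-- The set `𝒩(A_ħ)` of quantum limits: the measures `ν` on `𝕋^d` that are weak-star limits of the
densities `|ψ_n(x)|² dx` of such sequences of eigenfunctions. -/
def quantumLimits {d : ℕ} (A : ℝ → L2T d →ₗ.[ℂ] L2T d) : Set (Measure (Torus d)) :=
  {ν | IsFiniteMeasure ν ∧ ∃ (ħ : ℕ → ℝ) (lam : ℕ → ℝ) (ψ : ℕ → L2T d),
    EigenSequence A ħ lam ψ ∧
    ∀ b : C(Torus d, ℝ),
      Tendsto (fun n => ∫ x, b x * ‖ψ n x‖ ^ 2) atTop (𝓝 (∫ x, b x ∂ν))}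

/-- The normalized Lebesgue measure `(2π)^(-d) dx` on the torus. -/
def normalizedLebesgue (d : ℕ) : Measure (Torus d) :=
  ((ENNReal.ofReal (2 * π)) ^ d)⁻¹ • volume

/-- The normalized Haar measure of the invariant torus `𝕋^d × {ξ}`. -/
def haarOn {d : ℕ} (ξ : E d) : Measure (Phase d) :=
  (normalizedLebesgue d).prod (Measure.dirac ξ)

/-! ### The symbol classes -/

/-- The point `∑ n_i e_i` of the lattice generated by the basis `e` of `ℝ^d`. -/
def latticePt {d : ℕ} (e : Module.Basis (Fin d) ℝ (E d)) (n : Freq d) : E d :=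
  ∑ i, (n i : ℝ) • e i

/-- The translates of the Schwartz function `χ` by the lattice form a partition of unity. -/
def IsPartition {d : ℕ} (e : Module.Basis (Fin d) ℝ (E d)) (χ : SchwartzMap (E d) ℂ) : Prop :=
  ∀ ξ, HasSum (fun n : Freq d => χ (ξ - latticePt e n)) 1

/-- The norm `‖f‖_W = ‖ sup_j |(χ_j f)^| ‖_{L¹}`, `χ_j = χ(· - j)`, with values in `[0,∞]`. The
Fourier transform is `η ↦ ∫ exp (-2πi η · ξ) f(ξ) dξ`; other conventions only multiply the norm by
a constant depending on `d`, just as a fixed normalizing factor `C_d` does. -/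
def normW {d : ℕ} (e : Module.Basis (Fin d) ℝ (E d)) (χ : SchwartzMap (E d) ℂ)
    (f : E d → ℂ) : ℝ≥0∞ :=
  ∫⁻ η, ⨆ n : Freq d, ‖𝓕 (fun ξ => χ (ξ - latticePt e n) * f ξ) η‖ₑ

/-- The class `S_W(ℝ^d)`. Its elements are bounded continuous functions. -/
structure MemSW {d : ℕ} (e : Module.Basis (Fin d) ℝ (E d)) (χ : SchwartzMap (E d) ℂ)
    (f : E d → ℂ) : Prop where
  continuous : Continuous f
  bounded : ∃ M : ℝ, ∀ ξ, ‖f ξ‖ ≤ M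
  finite : normW e χ f < ∞

/-- The norm `‖g‖_{W,ρ} = (2π)^(-d/2) ∑_k ‖ĝ(k, ·)‖_W exp (ρ |k|)`, with values in `[0,∞]`. -/
def normWρ {d : ℕ} (e : Module.Basis (Fin d) ℝ (E d)) (χ : SchwartzMap (E d) ℂ) (ρ : ℝ)
    (g : Phase d → ℝ) : ℝ≥0∞ :=
  ENNReal.ofReal ((√(2 * π)) ^ d)⁻¹ *
    ∑' k : Freq d, normW e χ (symbolCoeff (fun p => (g p : ℂ)) k) *
      ENNReal.ofReal (Real.exp (ρ * ‖intVec k‖))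

/-- The class `𝒜_{W,ρ}(T^*𝕋^d)` of real symbols. -/
structure MemAW {d : ℕ} (e : Module.Basis (Fin d) ℝ (E d)) (χ : SchwartzMap (E d) ℂ) (ρ : ℝ)
    (g : Phase d → ℝ) : Prop where
  smooth : SmoothSymbol g
  coeff : ∀ k, MemSW e χ (symbolCoeff (fun p => (g p : ℂ)) k)
  finite : normWρ e χ ρ g < ∞

/-- The Diophantine condition `|k · ω| ≥ ς / |k|^(γ-1)` for all `k ∈ ℤ^d \ {0}`. -/
def Diophantine {d : ℕ} (ω : E d) (γ ς : ℝ) : Prop :=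
  ∀ k : Freq d, k ≠ 0 → ς / ‖intVec k‖ ^ (γ - 1) ≤ |inner ℝ (intVec k) ω|

end TorusKAM

end

noncomputable section

namespace TorusKAM

variable {d : ℕ}

/-! ### Windows and the Fourier transform -/

/-- A continuous integrable function with integrable Fourier transform. -/
structure FourierPair (θ : E d → ℂ) : Prop where
  continuous : Continuous θ
  integrable : Integrable θ
  integrable_fourier : Integrable (𝓕 θ)

theorem continuous_fourier {u : E d → ℂ} (hu : Integrable u) : Continuous (𝓕 u) :=
  VectorFourier.fourierIntegral_continuous Real.continuous_fourierChar
    (by exact continuous_inner) hu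

theorem SchwartzMap.fourierPair (θ : SchwartzMap (E d) ℂ) : FourierPair (⇑θ) where
  continuous := θ.continuous
  integrable := θ.integrable
  integrable_fourier := by
    rw [← SchwartzMap.fourier_coe]
    exact (𝓕 θ).integrable

theorem fourierPair_of_hasCompactSupport {θ : E d → ℂ} (h : HasCompactSupport θ)
    (hs : ContDiff ℝ ((⊤ : ℕ∞) : WithTop ℕ∞) θ) : FourierPair θ :=
  SchwartzMap.fourierPair (h.toSchwartzMap hs)

/-- Translation of the argument multiplies the Fourier transform by a phase. -/
theorem fourier_translate (u : E d → ℂ) (y η : E d) :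
    𝓕 (fun ξ => u (ξ - y)) η = 𝐞 (-inner ℝ y η) • 𝓕 u η := by
  have h := congrFun (VectorFourier.fourierIntegral_comp_add_right Real.fourierChar
    (volume : Measure (E d)) (innerₗ (E d)) u (-y)) η
  simp only [innerₗ_apply_apply, inner_neg_left] at h
  exact h

theorem norm_fourier_translate (u : E d → ℂ) (y η : E d) :
    ‖𝓕 (fun ξ => u (ξ - y)) η‖ₑ = ‖𝓕 u η‖ₑ := by
  rw [fourier_translate, enorm_eq_iff_norm_eq, Circle.norm_smul]

theorem FourierPair.translate {θ : E d → ℂ} (h : FourierPair θ) (y : E d) :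
    FourierPair (fun ξ => θ (ξ - y)) where
  continuous := h.continuous.comp (continuous_id.sub continuous_const)
  integrable := h.integrable.comp_sub_right y
  integrable_fourier := by
    refine ⟨(continuous_fourier (h.integrable.comp_sub_right y)).aestronglyMeasurable, ?_⟩
    rw [hasFiniteIntegral_iff_enorm]
    simp only [norm_fourier_translate]
    exact h.integrable_fourier.2

/-- The Fourier transform of a product is the convolution of the Fourier transforms. -/
theorem fourier_mul {θ u : E d → ℂ} (hθ : FourierPair θ) (hu : Integrable u) (η : E d) :
    𝓕 (fun ξ => θ ξ * u ξ) η = ∫ ζ, 𝓕 θ ζ * 𝓕 u (η - ζ) := by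
  have hinv := hθ.continuous.fourierInv_fourier_eq hθ.integrable hθ.integrable_fourier
  set Θ := 𝓕 θ with hΘ
  set g : E d → ℂ := fun ξ => 𝐞 (-inner ℝ ξ η) • u ξ with hg
  have hgi : Integrable g := (Real.fourierIntegral_convergent_iff η).2 hu
  have h1 : ∀ ξ, 𝓕 (fun ζ => Θ (-ζ)) ξ = θ ξ := by
    intro ξ
    rw [← hinv, Real.fourierInv_eq_fourier_comp_neg]
  have h2 : ∀ ζ, 𝓕 g ζ = 𝓕 u (ζ + η) := by
    intro ζ
    simp only [Real.fourier_eq, hg, smul_smul]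
    congr 1
    ext v
    rw [inner_add_right, neg_add, AddChar.map_add_eq_mul]
  have h3 := VectorFourier.integral_fourierIntegral_smul_eq_flip (e := Real.fourierChar)
    (μ := (volume : Measure (E d))) (ν := (volume : Measure (E d))) (L := innerₗ (E d))
    (f := fun ζ => Θ (-ζ)) (g := g) Real.continuous_fourierChar (by exact continuous_inner)
    hθ.integrable_fourier.comp_neg hgi
  have h4 : ∫ ξ, 𝓕 (fun ζ => Θ (-ζ)) ξ * g ξ = ∫ ζ, Θ (-ζ) * 𝓕 g ζ := by
    rw [flip_innerₗ] at h3
    exact h3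
  simp only [h1, h2] at h4
  rw [← integral_neg_eq_self] at h4
  rw [Real.fourier_eq, ← integral_neg_eq_self]
  have h5 : ∀ ξ, 𝐞 (-inner ℝ ξ η) • (θ ξ * u ξ) = θ ξ * g ξ := by
    intro ξ
    simp only [hg, Circle.smul_def, smul_eq_mul]
    ring
  simp only [h5]
  rw [h4, ← integral_neg_eq_self]
  congr 1
  ext ζ
  rw [neg_neg, sub_eq_neg_add]

theorem enorm_fourier_mul_le {θ u : E d → ℂ} (hθ : FourierPair θ) (hu : Integrable u) (η : E d) :
    ‖𝓕 (fun ξ => θ ξ * u ξ) η‖ₑ ≤ ∫⁻ ζ, ‖𝓕 θ ζ‖ₑ * ‖𝓕 u (η - ζ)‖ₑ := by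
  rw [fourier_mul hθ hu]
  refine (enorm_integral_le_lintegral_enorm _).trans_eq ?_
  simp only [enorm_mul]

theorem enorm_le_lintegral_fourier {u : E d → ℂ} (hu : FourierPair u) (ξ : E d) :
    ‖u ξ‖ₑ ≤ ∫⁻ η, ‖𝓕 u η‖ₑ := by
  have hinv := hu.continuous.fourierInv_fourier_eq hu.integrable hu.integrable_fourier
  have h : u ξ = 𝓕⁻ (𝓕 u) ξ := by rw [hinv]
  rw [h, Real.fourierInv_eq]
  refine (enorm_integral_le_lintegral_enorm _).trans_eq ?_
  congr 1
  ext η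
  rw [enorm_eq_iff_norm_eq, Circle.norm_smul]

theorem lintegral_convolution (A U : E d → ℝ≥0∞) (hA : Measurable A) (hU : Measurable U) :
    ∫⁻ η, ∫⁻ ζ, A ζ * U (η - ζ) = (∫⁻ ζ, A ζ) * ∫⁻ η, U η := by
  rw [lintegral_lintegral_swap]
  · have : ∀ ζ, ∫⁻ η, A ζ * U (η - ζ) = A ζ * ∫⁻ η, U η := by
      intro ζ
      have hm : Measurable fun η => U (η - ζ) := hU.comp (measurable_id.sub measurable_const)
      rw [lintegral_const_mul _ hm, lintegral_sub_right_eq_self]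
    simp only [this]
    rw [lintegral_mul_const _ hA]
  · exact ((hA.comp measurable_snd).mul
      (hU.comp (measurable_fst.sub measurable_snd))).aemeasurable

theorem measurable_convolution (A U : E d → ℝ≥0∞) (hA : Measurable A) (hU : Measurable U) :
    Measurable fun η => ∫⁻ ζ, A ζ * U (η - ζ) :=
  Measurable.lintegral_prod_right' (f := fun p : E d × E d => A p.2 * U (p.1 - p.2))
    ((hA.comp measurable_snd).mul (hU.comp (measurable_fst.sub measurable_snd)))

/-! ### The amalgam norm with respect to a window -/

/-- The supremum over all translates of the window `g` of the modulus of the windowed Fourier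
transform of `f`. -/
def winSup (g f : E d → ℂ) (η : E d) : ℝ≥0∞ :=
  ⨆ y : E d, ‖𝓕 (fun ξ => g (ξ - y) * f ξ) η‖ₑ

/-- The norm `∫ sup_y |(g(· - y) f)^|` of `f`. -/
def winNorm (g f : E d → ℂ) : ℝ≥0∞ := ∫⁻ η, winSup g f η

theorem le_winSup (g f : E d → ℂ) (y η : E d) :
    ‖𝓕 (fun ξ => g (ξ - y) * f ξ) η‖ₑ ≤ winSup g f η :=
  le_iSup (fun y : E d => ‖𝓕 (fun ξ => g (ξ - y) * f ξ) η‖ₑ) y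

theorem integrable_mul_bounded {g f : E d → ℂ} (hg : Integrable g) (hf : Continuous f)
    (hb : ∃ M : ℝ, ∀ ξ, ‖f ξ‖ ≤ M) : Integrable fun ξ => g ξ * f ξ := by
  obtain ⟨M, hM⟩ := hb
  exact hg.mul_bdd (c := M) hf.aestronglyMeasurable (Eventually.of_forall hM)

theorem integrable_window {g f : E d → ℂ} (hg : Integrable g) (hf : Continuous f)
    (hb : ∃ M : ℝ, ∀ ξ, ‖f ξ‖ ≤ M) (y : E d) : Integrable fun ξ => g (ξ - y) * f ξ :=
  integrable_mul_bounded (hg.comp_sub_right y) hf hb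

theorem measurable_iSup_fourier {ι : Type*} {v : ι → E d → ℂ} (hv : ∀ i, Integrable (v i)) :
    Measurable fun η => ⨆ i, ‖𝓕 (v i) η‖ₑ :=
  LowerSemicontinuous.measurable (lowerSemicontinuous_iSup fun i =>
    (continuous_fourier (hv i)).enorm.lowerSemicontinuous)

theorem measurable_winSup {g f : E d → ℂ} (hg : Integrable g) (hf : Continuous f)
    (hb : ∃ M : ℝ, ∀ ξ, ‖f ξ‖ ≤ M) : Measurable (winSup g f) :=
  measurable_iSup_fourier fun y => integrable_window hg hf hb y

theorem fourierPair_window {g f : E d → ℂ} (hg : FourierPair g) (hf : Continuous f)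
    (hb : ∃ M : ℝ, ∀ ξ, ‖f ξ‖ ≤ M) (h : winNorm g f ≠ ∞) (y : E d) :
    FourierPair fun ξ => g (ξ - y) * f ξ where
  continuous := (hg.continuous.comp (continuous_id.sub continuous_const)).mul hf
  integrable := integrable_window hg.integrable hf hb y
  integrable_fourier := by
    refine ⟨(continuous_fourier
      (integrable_window hg.integrable hf hb y)).aestronglyMeasurable, ?_⟩
    rw [hasFiniteIntegral_iff_enorm]
    exact (lintegral_mono fun η => le_winSup g f y η).trans_lt h.lt_top

theorem winNorm_mul_le {g g' f f' : E d → ℂ} (hg : FourierPair g) (hg' : FourierPair g')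
    (hf : Continuous f) (hb : ∃ M : ℝ, ∀ ξ, ‖f ξ‖ ≤ M)
    (hf' : Continuous f') (hb' : ∃ M : ℝ, ∀ ξ, ‖f' ξ‖ ≤ M) (h : winNorm g f ≠ ∞) :
    winNorm (fun ξ => g ξ * g' ξ) (fun ξ => f ξ * f' ξ) ≤ winNorm g f * winNorm g' f' := by
  rw [winNorm, winNorm, winNorm, ← lintegral_convolution _ _ (measurable_winSup hg.integrable hf hb)
    (measurable_winSup hg'.integrable hf' hb')]
  refine lintegral_mono fun η => iSup_le fun y => ?_
  have h1 := enorm_fourier_mul_le (fourierPair_window hg hf hb h y)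
    (integrable_window hg'.integrable hf' hb' y) η
  have h2 : (fun ξ => g (ξ - y) * g' (ξ - y) * (f ξ * f' ξ))
      = fun ξ => (g (ξ - y) * f ξ) * (g' (ξ - y) * f' ξ) := by
    ext ξ
    ring
  rw [h2]
  refine h1.trans (lintegral_mono fun ζ => ?_)
  gcongr
  · exact le_winSup g f y ζ
  · exact le_winSup g' f' y (η - ζ)

theorem enorm_le_winNorm {g f : E d → ℂ} (hg : FourierPair g) (hf : Continuous f)
    (hb : ∃ M : ℝ, ∀ ξ, ‖f ξ‖ ≤ M) (h1 : g 0 = 1) (ξ : E d) : ‖f ξ‖ₑ ≤ winNorm g f := by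
  by_cases h : winNorm g f = ∞
  · rw [h]
    exact le_top
  have h2 := enorm_le_lintegral_fourier (fourierPair_window hg hf hb h ξ) ξ
  rw [sub_self, h1, one_mul] at h2
  exact h2.trans (lintegral_mono fun η => le_winSup g f ξ η)

theorem winNorm_add_le {g f f' : E d → ℂ} (hg : FourierPair g)
    (hf : Continuous f) (hb : ∃ M : ℝ, ∀ ξ, ‖f ξ‖ ≤ M)
    (hf' : Continuous f') (hb' : ∃ M : ℝ, ∀ ξ, ‖f' ξ‖ ≤ M) :
    winNorm g (fun ξ => f ξ + f' ξ) ≤ winNorm g f + winNorm g f' := by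
  rw [winNorm, winNorm, winNorm, ← lintegral_add_left (measurable_winSup hg.integrable hf hb)]
  refine lintegral_mono fun η => iSup_le fun y => ?_
  have h2 : (fun ξ => g (ξ - y) * (f ξ + f' ξ))
      = (fun ξ => g (ξ - y) * f ξ) + fun ξ => g (ξ - y) * f' ξ := by
    ext ξ
    simp only [Pi.add_apply]
    ring
  have h3 : 𝓕 ((fun ξ => g (ξ - y) * f ξ) + fun ξ => g (ξ - y) * f' ξ) η
      = 𝓕 (fun ξ => g (ξ - y) * f ξ) η + 𝓕 (fun ξ => g (ξ - y) * f' ξ) η :=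
    congrFun (VectorFourier.fourierIntegral_add Real.continuous_fourierChar
      (by exact continuous_inner) (integrable_window hg.integrable hf hb y)
      (integrable_window hg.integrable hf' hb' y)) η
  rw [h2, h3]
  exact (enorm_add_le _ _).trans (add_le_add (le_winSup g f y η) (le_winSup g f' y η))

theorem winNorm_smul (g f : E d → ℂ) (c : ℂ) :
    winNorm g (fun ξ => c * f ξ) = ‖c‖ₑ * winNorm g f := by
  have h : ∀ η, winSup g (fun ξ => c * f ξ) η = ‖c‖ₑ * winSup g f η := by
    intro η
    rw [winSup, winSup, ENNReal.mul_iSup]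
    congr 1
    ext y
    have h3 : 𝓕 (c • fun ξ => g (ξ - y) * f ξ) η = c • 𝓕 (fun ξ => g (ξ - y) * f ξ) η :=
      congrFun (VectorFourier.fourierIntegral_const_smul _ _ _ _ _) η
    have h4 : (fun ξ => g (ξ - y) * (c * f ξ)) = c • fun ξ => g (ξ - y) * f ξ := by
      ext ξ
      simp only [Pi.smul_apply, smul_eq_mul]
      ring
    rw [← enorm_smul, ← h3, h4]
  rw [winNorm, winNorm]
  simp only [h]
  rw [lintegral_const_mul' _ _ enorm_ne_top]

theorem winNorm_translate (g f : E d → ℂ) (c : E d) :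
    winNorm g (fun ξ => f (ξ + c)) = winNorm g f := by
  have h : ∀ η, winSup g (fun ξ => f (ξ + c)) η = winSup g f η := by
    intro η
    refine (Equiv.addRight c).surjective.iSup_congr _ fun y => ?_
    rw [← norm_fourier_translate (fun ξ => g (ξ - y) * f (ξ + c)) c]
    have h4 : (fun ξ => g (ξ - c - y) * f (ξ - c + c))
        = fun ξ => g (ξ - (Equiv.addRight c) y) * f ξ := by
      ext ξ
      rw [sub_add_cancel, Equiv.coe_addRight, sub_sub, add_comm c y]
    rw [h4]
  rw [winNorm, winNorm]
  simp only [h]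

theorem fourier_conj (u : E d → ℂ) (η : E d) :
    𝓕 (fun ξ => conj (u ξ)) η = conj (𝓕 u (-η)) := by
  rw [Real.fourier_eq', Real.fourier_eq', ← integral_conj]
  congr 1
  ext ξ
  simp only [smul_eq_mul, map_mul, ← Complex.exp_conj, Complex.conj_I, inner_neg_right,
    Complex.conj_ofReal]
  congr 2
  push_cast
  ring

theorem winNorm_conj {g : E d → ℂ} (hg : ∀ ξ, conj (g ξ) = g ξ) (f : E d → ℂ) :
    winNorm g (fun ξ => conj (f ξ)) = winNorm g f := by
  have h : ∀ η, winSup g (fun ξ => conj (f ξ)) η = winSup g f (-η) := by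
    intro η
    rw [winSup, winSup]
    congr 1
    ext y
    have := fourier_conj (fun ξ => g (ξ - y) * f ξ) η
    simp only [map_mul, hg] at this
    rw [this, enorm_eq_iff_norm_eq, RCLike.norm_conj]
  rw [winNorm, winNorm]
  simp only [h]
  exact lintegral_neg_eq_self (fun η => winSup g f η)

end TorusKAM

namespace TorusKAM

variable {d : ℕ}

/-! ### Comparison of windows -/

theorem fourier_finset_sum {ι : Type*} (J : Finset ι) (v : ι → E d → ℂ)
    (hv : ∀ i ∈ J, Integrable (v i)) (η : E d) :
    𝓕 (fun ξ => ∑ i ∈ J, v i ξ) η = ∑ i ∈ J, 𝓕 (v i) η := by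
  simp only [Real.fourier_eq, Finset.smul_sum]
  exact integral_finsetSum _ fun i hi => (Real.fourierIntegral_convergent_iff η).2 (hv i hi)

/-- On a compact set on which finitely or infinitely many smooth functions have no common zero,
`1` is a finite combination of these functions with nice coefficients. -/
theorem exists_window_factors {ι : Type*} {K : Set (E d)} (hK : IsCompact K)
    (q : ι → E d → ℂ) (hq : ∀ i, ContDiff ℝ ((⊤ : ℕ∞) : WithTop ℕ∞) (q i))
    (h : ∀ ξ ∈ K, ∃ i, q i ξ ≠ 0) :
    ∃ (J : Finset ι) (θ : ι → E d → ℂ), (∀ i, FourierPair (θ i)) ∧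
      ∀ ξ ∈ K, ∑ i ∈ J, θ i ξ * q i ξ = 1 := by
  obtain ⟨J, hJ⟩ := hK.elim_finite_subcover (fun i => {ξ | q i ξ ≠ 0})
    (fun i => isOpen_ne_fun (hq i).continuous continuous_const)
    (fun ξ hξ => Set.mem_iUnion.2 (h ξ hξ))
  set Θ : E d → ℝ := fun ξ => ∑ i ∈ J, ‖q i ξ‖ ^ 2 with hΘ
  have hΘs : ContDiff ℝ ((⊤ : ℕ∞) : WithTop ℕ∞) Θ := ContDiff.sum fun i _ => (hq i).norm_sq ℝ
  have hpos : ∀ ξ ∈ K, 0 < Θ ξ := by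
    intro ξ hξ
    obtain ⟨i, hi⟩ := Set.mem_iUnion.1 (hJ hξ)
    obtain ⟨hiJ, hi⟩ := Set.mem_iUnion.1 hi
    refine Finset.sum_pos' (fun _ _ => by positivity) ⟨i, hiJ, ?_⟩
    have : 0 < ‖q i ξ‖ := norm_pos_iff.2 hi
    positivity
  obtain ⟨m, hm, hmK⟩ : ∃ m : ℝ, 0 < m ∧ ∀ ξ ∈ K, m ≤ Θ ξ := by
    rcases K.eq_empty_or_nonempty with rfl | hne
    · exact ⟨1, one_pos, fun _ h => h.elim⟩
    · obtain ⟨ξ0, h0, h1⟩ := hK.exists_isMinOn hne hΘs.continuous.continuousOn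
      exact ⟨Θ ξ0, hpos _ h0, fun ξ hξ => h1 hξ⟩
  obtain ⟨r, hr, hrK⟩ : ∃ r : ℝ, 0 < r ∧ K ⊆ Metric.closedBall 0 r := by
    obtain ⟨r, hr⟩ := hK.isBounded.subset_closedBall 0
    exact ⟨max r 1, by positivity, hr.trans (Metric.closedBall_subset_closedBall (le_max_left _ _))⟩
  let b : ContDiffBump (0 : E d) := ⟨r, r + 1, hr, by linarith⟩
  set ψ : E d → ℝ := fun ξ => Real.smoothTransition (2 * Θ ξ / m - 1) / Θ ξ with hψ
  have hψs : ContDiff ℝ ((⊤ : ℕ∞) : WithTop ℕ∞) ψ := by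
    rw [contDiff_iff_contDiffAt]
    intro ξ
    by_cases h0 : Θ ξ = 0
    · have hev : ∀ᶠ ξ' in 𝓝 ξ, Θ ξ' < m / 2 :=
        hΘs.continuous.continuousAt.eventually_lt continuousAt_const (by rw [h0]; positivity)
      refine (contDiffAt_const (c := (0 : ℝ))).congr_of_eventuallyEq ?_
      filter_upwards [hev] with ξ' hξ'
      rw [hψ]
      simp only
      rw [Real.smoothTransition.zero_of_nonpos, zero_div]
      rw [sub_nonpos, div_le_one hm]
      linarith
    · refine ContDiffAt.div ?_ hΘs.contDiffAt h0
      exact (Real.smoothTransition.contDiff.comp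
        (((contDiff_const.mul hΘs).div_const m).sub contDiff_const)).contDiffAt
  have hψK : ∀ ξ ∈ K, ψ ξ * Θ ξ = 1 := by
    intro ξ hξ
    rw [hψ]
    simp only
    rw [Real.smoothTransition.one_of_one_le, div_mul_cancel₀ _ (hpos ξ hξ).ne']
    have : 1 ≤ Θ ξ / m := (one_le_div hm).2 (hmK ξ hξ)
    rw [mul_div_assoc]
    linarith
  refine ⟨J, fun i ξ => ((b ξ * ψ ξ : ℝ) : ℂ) * conj (q i ξ), fun i => ?_, fun ξ hξ => ?_⟩
  · refine fourierPair_of_hasCompactSupport ?_ ?_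
    · refine b.hasCompactSupport.mono fun ξ hξ => ?_
      rw [Function.mem_support] at hξ ⊢
      contrapose! hξ
      rw [hξ]
      simp
    · exact (Complex.ofRealCLM.contDiff.comp (b.contDiff.mul hψs)).mul
        (Complex.conjCLE.contDiff.comp (hq i))
  · have hb : b ξ = 1 := b.one_of_mem_closedBall (hrK hξ)
    simp only [hb, one_mul, mul_assoc, ← Complex.normSq_eq_conj_mul_self,
      Complex.normSq_eq_norm_sq]
    rw [← Finset.mul_sum]
    have := hψK ξ hξ
    rw [hΘ] at this
    exact_mod_cast this

theorem winNorm_le_of_factors {ι : Type*} {K : Set (E d)} {J : Finset ι} {θ q : ι → E d → ℂ}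
    (hθ : ∀ i, FourierPair (θ i)) (hq : ∀ i, Integrable (q i))
    (hJ : ∀ ξ ∈ K, ∑ i ∈ J, θ i ξ * q i ξ = 1) {g f : E d → ℂ} (hg : FourierPair g)
    (hf : Continuous f) (hb : ∃ M : ℝ, ∀ ξ, ‖f ξ‖ ≤ M) {U : E d → ℝ≥0∞} (hU : Measurable U)
    (h : ∀ y, ∃ l : E d, (∀ ξ, g (ξ - y) ≠ 0 → ξ - l ∈ K) ∧
      ∀ i ∈ J, ∀ η, ‖𝓕 (fun ξ => q i (ξ - l) * f ξ) η‖ₑ ≤ U η) :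
    winNorm g f ≤ (∫⁻ ζ, ‖𝓕 g ζ‖ₑ) * ((∑ i ∈ J, ∫⁻ ζ, ‖𝓕 (θ i) ζ‖ₑ) * ∫⁻ η, U η) := by
  have hmθ : ∀ i, Measurable fun ζ => ‖𝓕 (θ i) ζ‖ₑ := fun i =>
    (continuous_fourier (hθ i).integrable).enorm.measurable
  set T : E d → ℝ≥0∞ := fun ζ => ∑ i ∈ J, ‖𝓕 (θ i) ζ‖ₑ with hT
  have hTm : Measurable T := Finset.measurable_sum _ fun i _ => hmθ i
  have hTi : ∫⁻ ζ, T ζ = ∑ i ∈ J, ∫⁻ ζ, ‖𝓕 (θ i) ζ‖ₑ :=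
    lintegral_finsetSum _ fun i _ => hmθ i
  rw [← hTi, ← lintegral_convolution T U hTm hU, ← lintegral_convolution _ _
    (continuous_fourier hg.integrable).enorm.measurable (measurable_convolution T U hTm hU)]
  refine lintegral_mono fun η => iSup_le fun y => ?_
  obtain ⟨l, hl1, hl2⟩ := h y
  have hqf : ∀ i, Integrable fun ξ => q i (ξ - l) * f ξ := fun i =>
    integrable_window (hq i) hf hb l
  obtain ⟨M, hM⟩ : ∃ M : ι → ℝ, ∀ i ξ, ‖θ i ξ‖ ≤ M i := by
    have : ∀ i, ∃ M : ℝ, ∀ ξ, ‖θ i ξ‖ ≤ M := by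
      intro i
      have hfin : ∫⁻ η, ‖𝓕 (θ i) η‖ₑ ≠ ∞ := (hθ i).integrable_fourier.2.ne
      refine ⟨(∫⁻ η, ‖𝓕 (θ i) η‖ₑ).toReal, fun ξ => ?_⟩
      have := ENNReal.toReal_mono hfin (enorm_le_lintegral_fourier (hθ i) ξ)
      rwa [toReal_enorm] at this
    choose M hM using this
    exact ⟨M, hM⟩
  have hθq : ∀ i, Integrable fun ξ => θ i (ξ - l) * (q i (ξ - l) * f ξ) := fun i =>
    (hqf i).bdd_mul (c := M i) ((hθ i).translate l).continuous.aestronglyMeasurable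
      (Eventually.of_forall fun ξ => hM i _)
  have hs : Integrable fun ξ => ∑ i ∈ J, θ i (ξ - l) * (q i (ξ - l) * f ξ) :=
    integrable_finsetSum _ fun i _ => hθq i
  have he : (fun ξ => g (ξ - y) * f ξ)
      = fun ξ => g (ξ - y) * ∑ i ∈ J, θ i (ξ - l) * (q i (ξ - l) * f ξ) := by
    ext ξ
    by_cases h0 : g (ξ - y) = 0
    · simp [h0]
    · have := hJ _ (hl1 ξ h0)
      simp only [← mul_assoc]
      rw [← Finset.sum_mul, this, one_mul]
  rw [he]
  refine (enorm_fourier_mul_le (hg.translate y) hs η).trans (lintegral_mono fun ζ => ?_)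
  rw [norm_fourier_translate]
  gcongr
  rw [fourier_finset_sum _ _ fun i _ => hθq i]
  refine (enorm_sum_le _ _).trans ?_
  simp only [hT, Finset.sum_mul]
  rw [lintegral_finsetSum']
  · refine Finset.sum_le_sum fun i hi => ?_
    refine (enorm_fourier_mul_le ((hθ i).translate l) (hqf i) _).trans
      (lintegral_mono fun ζ' => ?_)
    rw [norm_fourier_translate]
    gcongr
    exact hl2 i hi _
  · intro i _
    exact ((hmθ i).mul (hU.comp (measurable_const.sub measurable_id))).aemeasurable

/-- A fixed real bump function with value `1` at the origin. -/
def bump (d : ℕ) : ContDiffBump (0 : E d) := ⟨1, 2, one_pos, one_lt_two⟩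

/-- The bump function as a complex-valued window. -/
def win (d : ℕ) (ξ : E d) : ℂ := ((bump d ξ : ℝ) : ℂ)

theorem win_zero : win d 0 = 1 := by
  have : bump d (0 : E d) = 1 := (bump d).one_of_mem_closedBall (by simp [bump])
  rw [win, this, Complex.ofReal_one]

theorem conj_win (ξ : E d) : conj (win d ξ) = win d ξ := Complex.conj_ofReal _

theorem contDiff_win : ContDiff ℝ ((⊤ : ℕ∞) : WithTop ℕ∞) (win d) :=
  Complex.ofRealCLM.contDiff.comp (bump d).contDiff

theorem hasCompactSupport_win : HasCompactSupport (win d) :=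
  (bump d).hasCompactSupport.comp_left (g := fun x : ℝ => (x : ℂ)) Complex.ofReal_zero

theorem fourierPair_win : FourierPair (win d) :=
  fourierPair_of_hasCompactSupport hasCompactSupport_win contDiff_win

theorem norm_le_of_win_ne_zero {ξ : E d} (h : win d ξ ≠ 0) : ‖ξ‖ ≤ 2 := by
  have h1 : bump d ξ ≠ 0 := by
    contrapose! h
    rw [win, h, Complex.ofReal_zero]
  have h2 : ξ ∈ Function.support (bump d) := h1
  rw [(bump d).support_eq] at h2
  exact (mem_ball_zero_iff.1 h2).le

theorem fourierPair_win_sq : FourierPair fun ξ => win d ξ * win d ξ :=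
  fourierPair_of_hasCompactSupport hasCompactSupport_win.mul_left
    (contDiff_win.mul contDiff_win)

theorem exists_winNorm_le_sq (d : ℕ) : ∃ C : ℝ≥0, ∀ f : E d → ℂ, Continuous f →
    (∃ M : ℝ, ∀ ξ, ‖f ξ‖ ≤ M) →
    winNorm (win d) f ≤ C * winNorm (fun ξ => win d ξ * win d ξ) f := by
  obtain ⟨J, θ, hθ, hJ⟩ := exists_window_factors (isCompact_closedBall (0 : E d) 2)
    (fun (s : E d) ξ => win d (ξ - s) * win d (ξ - s))
    (fun s => by
      have := contDiff_win (d := d) |>.comp (contDiff_id.sub (contDiff_const (c := s)))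
      exact this.mul this)
    (fun ξ _ => ⟨ξ, by simp [win_zero]⟩)
  obtain ⟨C, hC⟩ : ∃ C : ℝ≥0, (C : ℝ≥0∞) =
    (∫⁻ ζ, ‖𝓕 (win d) ζ‖ₑ) * ∑ i ∈ J, ∫⁻ ζ, ‖𝓕 (θ i) ζ‖ₑ :=
    ⟨_, ENNReal.coe_toNNReal (ENNReal.mul_ne_top fourierPair_win.integrable_fourier.2.ne
      (ENNReal.sum_ne_top.2 fun i _ => (hθ i).integrable_fourier.2.ne))⟩
  refine ⟨C, fun f hf hb => ?_⟩
  rw [hC, mul_assoc]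
  refine winNorm_le_of_factors hθ (fun s => (fourierPair_win_sq.translate s).integrable) hJ
    fourierPair_win hf hb (measurable_winSup fourierPair_win_sq.integrable hf hb) fun y => ?_
  refine ⟨y, fun ξ h => ?_, fun s _ η => ?_⟩
  · rw [mem_closedBall_zero_iff]
    exact norm_le_of_win_ne_zero h
  · have := le_winSup (fun ξ => win d ξ * win d ξ) f (y + s) η
    simpa only [sub_sub] using this

theorem latticePt_add (e : Module.Basis (Fin d) ℝ (E d)) (m n : Freq d) :
    latticePt e (m + n) = latticePt e m + latticePt e n := by
  simp [latticePt, add_smul, Finset.sum_add_distrib]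

theorem exists_winNorm_le_normW (e : Module.Basis (Fin d) ℝ (E d)) (χ : SchwartzMap (E d) ℂ)
    (hχ : IsPartition e χ) : ∃ C : ℝ≥0, ∀ f : E d → ℂ, Continuous f →
    (∃ M : ℝ, ∀ ξ, ‖f ξ‖ ≤ M) → winNorm (win d) f ≤ C * normW e χ f := by
  have hD : IsCompact ((fun t : Fin d → ℝ => ∑ i, t i • e i) '' Set.Icc 0 1) :=
    isCompact_Icc.image (by fun_prop)
  obtain ⟨J, θ, hθ, hJ⟩ := exists_window_factors (hD.add (isCompact_closedBall (0 : E d) 2))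
    (fun (n : Freq d) ξ => χ (ξ - latticePt e n))
    (fun n => (χ.smooth ⊤).comp (contDiff_id.sub contDiff_const))
    (fun ξ _ => by
      by_contra! h
      have := (hχ ξ).unique (by simpa only [h] using hasSum_zero)
      exact one_ne_zero this)
  obtain ⟨C, hC⟩ : ∃ C : ℝ≥0, (C : ℝ≥0∞) =
    (∫⁻ ζ, ‖𝓕 (win d) ζ‖ₑ) * ∑ i ∈ J, ∫⁻ ζ, ‖𝓕 (θ i) ζ‖ₑ :=
    ⟨_, ENNReal.coe_toNNReal (ENNReal.mul_ne_top fourierPair_win.integrable_fourier.2.ne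
      (ENNReal.sum_ne_top.2 fun i _ => (hθ i).integrable_fourier.2.ne))⟩
  refine ⟨C, fun f hf hb => ?_⟩
  rw [hC, mul_assoc]
  refine winNorm_le_of_factors hθ (fun n => χ.integrable.comp_sub_right (latticePt e n)) hJ
    fourierPair_win hf hb
    (measurable_iSup_fourier fun n => integrable_window χ.integrable hf hb (latticePt e n))
    fun y => ?_
  refine ⟨latticePt e (fun i => ⌊e.repr y i⌋), fun ξ h => ?_, fun n _ η => ?_⟩
  · refine ⟨∑ i, Int.fract (e.repr y i) • e i, ⟨_, ?_, rfl⟩, ξ - y, ?_, ?_⟩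
    · exact ⟨fun i => Int.fract_nonneg _, fun i => (Int.fract_lt_one _).le⟩
    · rw [mem_closedBall_zero_iff]
      exact norm_le_of_win_ne_zero h
    · have h1 : y = ∑ i, (e.repr y i) • e i := (e.sum_repr y).symm
      have h2 : ∑ i, Int.fract (e.repr y i) • e i
          = y - latticePt e (fun i => ⌊e.repr y i⌋) := by
        have h3 : y - latticePt e (fun i => ⌊e.repr y i⌋)
            = ∑ i, (e.repr y i) • e i - latticePt e (fun i => ⌊e.repr y i⌋) := by rw [← h1]
        rw [h3, latticePt, ← Finset.sum_sub_distrib]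
        simp only [← sub_smul, Int.fract]
      change ∑ i, Int.fract (e.repr y i) • e i + (ξ - y) = _
      rw [h2, sub_add_sub_comm, add_comm y, add_sub_add_right_eq_sub]
  · have := le_iSup (fun n : Freq d => ‖𝓕 (fun ξ => χ (ξ - latticePt e n) * f ξ) η‖ₑ)
      ((fun i => ⌊e.repr y i⌋) + n)
    simpa only [latticePt_add, sub_sub] using this

end TorusKAM

namespace TorusKAM

variable {d : ℕ}

/-- The integrable weight `(1 + |ζ|)^(-d-1)`. -/
def japWeight (d : ℕ) (ζ : E d) : ℝ := (1 + ‖ζ‖) ^ (-((d + 1 : ℕ) : ℝ))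

theorem integrable_japWeight : Integrable (japWeight d) :=
  integrable_one_add_norm (by simp)

theorem integrable_iteratedFDeriv_of_hasCompactSupport {u : E d → ℂ} (hc : HasCompactSupport u)
    (hu : ContDiff ℝ ((⊤ : ℕ∞) : WithTop ℕ∞) u) (n : ℕ) : Integrable (iteratedFDeriv ℝ n u) :=
  (hu.continuous_iteratedFDeriv (m := n)
    (by exact_mod_cast le_top)).integrable_of_hasCompactSupport (hc.iteratedFDeriv n)

theorem norm_fourier_le_japWeight {u : E d → ℂ} (hc : HasCompactSupport u)
    (hu : ContDiff ℝ ((⊤ : ℕ∞) : WithTop ℕ∞) u) (ζ : E d) :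
    ‖𝓕 u ζ‖ ≤ 2 ^ d * (1 + 2 ^ (d + 1)) * japWeight d ζ *
      ∑ p ∈ Finset.range (d + 2), ∫ ξ, ‖iteratedFDeriv ℝ p u ξ‖ := by
  set S := ∑ p ∈ Finset.range (d + 2), ∫ ξ, ‖iteratedFDeriv ℝ p u ξ‖ with hS
  have key : ∀ n : ℕ, n < d + 2 → ‖ζ‖ ^ n * ‖𝓕 u ζ‖ ≤ 2 ^ n * S := by
    intro n hn
    have h := Real.pow_mul_norm_iteratedFDeriv_fourier_le (f := u) (K := 0) (N := ⊤) hu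
      (fun k n hk _ => by
        have hk0 : k = 0 := by simpa using hk
        subst hk0
        simpa using (integrable_iteratedFDeriv_of_hasCompactSupport hc hu n).norm)
      (k := 0) (n := n) le_rfl le_top ζ
    simp only [norm_iteratedFDeriv_zero, pow_zero, one_mul, zero_add, Finset.range_one,
      Finset.sum_product, Finset.sum_singleton, Nat.cast_zero, mul_zero] at h
    refine h.trans ?_
    gcongr
    refine Finset.sum_le_sum_of_subset_of_nonneg (Finset.range_mono (by omega)) fun p _ _ => ?_
    exact integral_nonneg fun _ => norm_nonneg _
  have h0 := key 0 (by omega)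
  have h1 := key (d + 1) (by omega)
  simp only [pow_zero, one_mul] at h0
  have h2 : (1 + ‖ζ‖) ^ (d + 1) ≤ 2 ^ d * (1 + ‖ζ‖ ^ (d + 1)) := by
    have := add_pow_le (zero_le_one' ℝ) (norm_nonneg ζ) (d + 1)
    simpa using this
  have h3 : (1 + ‖ζ‖) ^ (d + 1) * ‖𝓕 u ζ‖ ≤ 2 ^ d * (1 + 2 ^ (d + 1)) * S := by
    calc (1 + ‖ζ‖) ^ (d + 1) * ‖𝓕 u ζ‖ ≤ 2 ^ d * (1 + ‖ζ‖ ^ (d + 1)) * ‖𝓕 u ζ‖ := by gcongr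
      _ = 2 ^ d * (‖𝓕 u ζ‖ + ‖ζ‖ ^ (d + 1) * ‖𝓕 u ζ‖) := by ring
      _ ≤ 2 ^ d * (S + 2 ^ (d + 1) * S) := by gcongr
      _ = _ := by ring
  have hp : 0 < (1 + ‖ζ‖) ^ (d + 1) := by positivity
  rw [japWeight, Real.rpow_neg (by positivity), Real.rpow_natCast]
  rw [mul_right_comm, ← div_eq_mul_inv, le_div_iff₀ hp, mul_comm]
  exact h3

/-- A majorant, integrable in `y`, of the derivatives of `χ (win (· - y))` in `L¹`. -/
def derivMajorant (χ : E d → ℂ) (y : E d) : ℝ≥0∞ :=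
  ∑ p ∈ Finset.range (d + 2), ∑ i ∈ Finset.range (p + 1), (p.choose i : ℝ≥0∞) *
    ∫⁻ ξ, ‖iteratedFDeriv ℝ i χ ξ‖ₑ * ‖iteratedFDeriv ℝ (p - i) (win d) (ξ - y)‖ₑ

theorem measurable_enorm_iteratedFDeriv {u : E d → ℂ}
    (hu : ContDiff ℝ ((⊤ : ℕ∞) : WithTop ℕ∞) u) (n : ℕ) :
    Measurable fun ξ => ‖iteratedFDeriv ℝ n u ξ‖ₑ :=
  (hu.continuous_iteratedFDeriv (m := n) (by exact_mod_cast le_top)).enorm.measurable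

theorem measurable_lintegral_mul_sub {A B : E d → ℝ≥0∞} (hA : Measurable A) (hB : Measurable B) :
    Measurable fun y => ∫⁻ ξ, A ξ * B (ξ - y) :=
  Measurable.lintegral_prod_right' (f := fun p : E d × E d => A p.2 * B (p.2 - p.1))
    ((hA.comp measurable_snd).mul (hB.comp (measurable_snd.sub measurable_fst)))

theorem measurable_derivMajorant (χ : SchwartzMap (E d) ℂ) : Measurable (derivMajorant χ) :=
  Finset.measurable_sum _ fun _ _ => Finset.measurable_sum _ fun _ _ => Measurable.const_mul
    (measurable_lintegral_mul_sub (measurable_enorm_iteratedFDeriv (χ.smooth ⊤) _)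
      (measurable_enorm_iteratedFDeriv contDiff_win _)) _

theorem lintegral_mul_sub {A B : E d → ℝ≥0∞} (hA : Measurable A) (hB : Measurable B) :
    ∫⁻ y, ∫⁻ ξ, A ξ * B (ξ - y) = (∫⁻ ξ, A ξ) * ∫⁻ ξ, B ξ := by
  rw [lintegral_lintegral_swap]
  · have : ∀ ξ, ∫⁻ y, A ξ * B (ξ - y) = A ξ * ∫⁻ y, B y := by
      intro ξ
      have hm : Measurable fun y => B (ξ - y) := hB.comp (measurable_const.sub measurable_id)
      rw [lintegral_const_mul _ hm, lintegral_sub_left_eq_self]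
    simp only [this]
    rw [lintegral_mul_const _ hA]
  · exact ((hA.comp measurable_snd).mul
      (hB.comp (measurable_snd.sub measurable_fst))).aemeasurable

theorem lintegral_derivMajorant_ne_top (χ : SchwartzMap (E d) ℂ) :
    ∫⁻ y, derivMajorant χ y ≠ ∞ := by
  have hA := fun i => measurable_enorm_iteratedFDeriv (χ.smooth ⊤) i
  have hB := fun i => measurable_enorm_iteratedFDeriv (contDiff_win (d := d)) i
  simp only [derivMajorant]
  rw [lintegral_finsetSum _ fun p _ => Finset.measurable_sum _ fun i _ =>
    Measurable.const_mul (measurable_lintegral_mul_sub (hA i) (hB (p - i))) _]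
  refine ENNReal.sum_ne_top.2 fun p _ => ?_
  rw [lintegral_finsetSum _ fun i _ =>
    Measurable.const_mul (measurable_lintegral_mul_sub (hA i) (hB (p - i))) _]
  refine ENNReal.sum_ne_top.2 fun i _ => ?_
  rw [lintegral_const_mul _ (measurable_lintegral_mul_sub (hA i) (hB (p - i))),
    lintegral_mul_sub (hA i) (hB (p - i))]
  refine ENNReal.mul_ne_top (ENNReal.natCast_ne_top _) (ENNReal.mul_ne_top ?_ ?_)
  · have := χ.integrable_pow_mul_iteratedFDeriv (volume : Measure (E d)) 0 i
    simp only [pow_zero, one_mul] at this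
    have h2 := this.2
    rw [hasFiniteIntegral_iff_enorm] at h2
    simpa only [enorm_norm] using h2.ne
  · exact (integrable_iteratedFDeriv_of_hasCompactSupport hasCompactSupport_win
      contDiff_win (p - i)).2.ne

theorem enorm_fourier_window_le (χ : SchwartzMap (E d) ℂ) (y ζ : E d) :
    ‖𝓕 (fun ξ => χ ξ * win d (ξ - y)) ζ‖ₑ ≤
      ENNReal.ofReal (2 ^ d * (1 + 2 ^ (d + 1)) * japWeight d ζ) * derivMajorant χ y := by
  have hw : ContDiff ℝ ((⊤ : ℕ∞) : WithTop ℕ∞) fun ξ => win d (ξ - y) :=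
    contDiff_win.comp (contDiff_id.sub contDiff_const)
  have hu : ContDiff ℝ ((⊤ : ℕ∞) : WithTop ℕ∞) fun ξ => χ ξ * win d (ξ - y) :=
    (χ.smooth ⊤).mul hw
  have hc : HasCompactSupport fun ξ => χ ξ * win d (ξ - y) :=
    HasCompactSupport.mul_left (f := fun ξ => χ ξ)
      (hasCompactSupport_win.comp_homeomorph (Homeomorph.subRight y))
  have hJ : 0 ≤ japWeight d ζ := by
    unfold japWeight
    positivity
  rw [← ofReal_norm]
  refine (ENNReal.ofReal_le_ofReal (norm_fourier_le_japWeight hc hu ζ)).trans ?_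
  rw [ENNReal.ofReal_mul (by positivity)]
  gcongr
  rw [ENNReal.ofReal_sum_of_nonneg fun p _ => integral_nonneg fun _ => norm_nonneg _,
    derivMajorant]
  refine Finset.sum_le_sum fun p _ => ?_
  rw [ofReal_integral_norm_eq_lintegral_enorm
    (integrable_iteratedFDeriv_of_hasCompactSupport hc hu p)]
  have hA := fun i => measurable_enorm_iteratedFDeriv (χ.smooth ⊤) i
  have hB : ∀ i, Measurable fun ξ => ‖iteratedFDeriv ℝ i (win d) (ξ - y)‖ₑ := fun i =>
    (measurable_enorm_iteratedFDeriv (contDiff_win (d := d)) i).comp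
      (measurable_id.sub measurable_const)
  calc ∫⁻ ξ, ‖iteratedFDeriv ℝ p (fun ξ => χ ξ * win d (ξ - y)) ξ‖ₑ
      ≤ ∫⁻ ξ, ∑ i ∈ Finset.range (p + 1), (p.choose i : ℝ≥0∞) *
        (‖iteratedFDeriv ℝ i χ ξ‖ₑ * ‖iteratedFDeriv ℝ (p - i) (win d) (ξ - y)‖ₑ) := by
        refine lintegral_mono fun ξ => ?_
        have h := norm_iteratedFDeriv_mul_le (χ.smooth ⊤) hw ξ (n := p) (by exact_mod_cast le_top)
        simp only [iteratedFDeriv_comp_sub] at h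
        rw [← ofReal_norm]
        refine (ENNReal.ofReal_le_ofReal h).trans_eq ?_
        rw [ENNReal.ofReal_sum_of_nonneg fun i _ => by positivity]
        refine Finset.sum_congr rfl fun i _ => ?_
        rw [ENNReal.ofReal_mul (by positivity), ENNReal.ofReal_mul (by positivity),
          ofReal_norm, ofReal_norm, ENNReal.ofReal_natCast, mul_assoc]
    _ = _ := by
        have hAB : ∀ i, Measurable fun ξ =>
            ‖iteratedFDeriv ℝ i χ ξ‖ₑ * ‖iteratedFDeriv ℝ (p - i) (win d) (ξ - y)‖ₑ :=
          fun i => (hA i).mul (hB (p - i))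
        rw [lintegral_finsetSum _ fun i _ => (hAB i).const_mul _]
        refine Finset.sum_congr rfl fun i _ => ?_
        exact lintegral_const_mul _ (hAB i)

theorem exists_winNorm_schwartz_le (χ : SchwartzMap (E d) ℂ) : ∃ C : ℝ≥0, ∀ f : E d → ℂ,
    Continuous f → (∃ M : ℝ, ∀ ξ, ‖f ξ‖ ≤ M) → winNorm χ f ≤ C * winNorm (win d) f := by
  set W : E d → ℝ≥0∞ := fun ζ =>
    ENNReal.ofReal (2 ^ d * (1 + 2 ^ (d + 1)) * japWeight d ζ) with hW
  have hJc : Continuous (japWeight d) :=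
    (continuous_const.add continuous_norm).rpow_const fun ζ => Or.inl
      (add_pos_of_pos_of_nonneg one_pos (norm_nonneg ζ)).ne'
  have hWm : Measurable W :=
    ENNReal.measurable_ofReal.comp (continuous_const.mul hJc).measurable
  have hWi : ∫⁻ ζ, W ζ ≠ ∞ := (integrable_japWeight.const_mul _).lintegral_lt_top.ne
  set c : ℂ := ∫ ξ, win d ξ * win d ξ with hc
  have hc0 : c ≠ 0 := by
    have h1 : c = ((∫ ξ, bump d ξ * bump d ξ : ℝ) : ℂ) := by
      rw [hc, ← integral_complex_ofReal]
      simp only [win, Complex.ofReal_mul]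
    rw [h1, Complex.ofReal_ne_zero]
    have hcont : Continuous fun ξ => bump d ξ * bump d ξ :=
      (bump d).continuous.mul (bump d).continuous
    refine (hcont.integral_pos_of_hasCompactSupport_nonneg_nonzero
      (bump d).hasCompactSupport.mul_left (fun ξ => mul_self_nonneg _) (x := 0) ?_).ne'
    have : bump d (0 : E d) = 1 := (bump d).one_of_mem_closedBall (by simp [bump])
    simp [this]
  obtain ⟨C, hC⟩ : ∃ C : ℝ≥0, (C : ℝ≥0∞) =
      ‖c‖ₑ⁻¹ * ((∫⁻ y, derivMajorant χ y) * ∫⁻ ζ, W ζ) :=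
    ⟨_, ENNReal.coe_toNNReal (ENNReal.mul_ne_top
      (ENNReal.inv_ne_top.2 (enorm_ne_zero.2 hc0))
      (ENNReal.mul_ne_top (lintegral_derivMajorant_ne_top χ) hWi))⟩
  refine ⟨C, fun f hf hb => ?_⟩
  have hUm := measurable_winSup fourierPair_win.integrable hf hb (g := win d)
  rw [hC, mul_assoc, mul_assoc, winNorm, winNorm, ← lintegral_convolution W _ hWm hUm,
    ← mul_assoc, ← lintegral_const_mul _ (measurable_convolution _ _ hWm hUm)]
  refine lintegral_mono fun η => iSup_le fun z => ?_
  have hcv := Integrable.convolution_integrand (ContinuousLinearMap.mul ℝ ℂ)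
    (f := fun ξ => 𝐞 (-inner ℝ ξ η) • (χ (ξ - z) * f ξ))
    (g := fun t => win d (-t) * win d (-t)) (μ := (volume : Measure (E d)))
    (ν := (volume : Measure (E d)))
    ((Real.fourierIntegral_convergent_iff η).2 (integrable_window χ.integrable hf hb z))
    fourierPair_win_sq.integrable.comp_neg
  simp only [ContinuousLinearMap.mul_apply', neg_sub] at hcv
  have hswap := integral_integral_swap (f := fun (y ξ : E d) =>
    𝐞 (-inner ℝ ξ η) • (χ (ξ - z) * f ξ) * (win d (ξ - y) * win d (ξ - y))) hcv
  have hR : ∀ ξ : E d, ∫ y, 𝐞 (-inner ℝ ξ η) • (χ (ξ - z) * f ξ) *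
      (win d (ξ - y) * win d (ξ - y)) = 𝐞 (-inner ℝ ξ η) • (χ (ξ - z) * f ξ) * c := by
    intro ξ
    rw [integral_const_mul,
      integral_sub_left_eq_self (fun t => win d t * win d t) (volume : Measure (E d)) ξ]
  simp only [hR] at hswap
  rw [integral_mul_const, ← Real.fourier_eq] at hswap
  have hL : ∀ y : E d, ‖∫ ξ, 𝐞 (-inner ℝ ξ η) • (χ (ξ - z) * f ξ) *
      (win d (ξ - y) * win d (ξ - y))‖ₑ ≤
      derivMajorant χ (y - z) * ∫⁻ ζ, W ζ * winSup (win d) f (η - ζ) := by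
    intro y
    have h1 : ∫ ξ, 𝐞 (-inner ℝ ξ η) • (χ (ξ - z) * f ξ) * (win d (ξ - y) * win d (ξ - y))
        = 𝓕 (fun ξ => (χ (ξ - z) * win d (ξ - z - (y - z))) * (win d (ξ - y) * f ξ)) η := by
      rw [Real.fourier_eq]
      congr 1
      ext ξ
      rw [sub_sub_sub_cancel_right]
      simp only [Circle.smul_def, smul_eq_mul]
      ring
    have hp : FourierPair fun ξ => χ ξ * win d (ξ - (y - z)) :=
      fourierPair_of_hasCompactSupport (HasCompactSupport.mul_left (f := fun ξ => χ ξ)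
        (hasCompactSupport_win.comp_homeomorph (Homeomorph.subRight (y - z))))
        ((χ.smooth ⊤).mul (contDiff_win.comp (contDiff_id.sub contDiff_const)))
    rw [h1]
    refine (enorm_fourier_mul_le (hp.translate z)
      (integrable_window fourierPair_win.integrable hf hb y) η).trans ?_
    have hm : Measurable fun ζ => W ζ * winSup (win d) f (η - ζ) :=
      hWm.mul (hUm.comp (measurable_const.sub measurable_id))
    rw [← lintegral_const_mul _ hm]
    refine lintegral_mono fun ζ => ?_
    rw [norm_fourier_translate (fun ξ => χ ξ * win d (ξ - (y - z)))]
    calc _ ≤ (W ζ * derivMajorant χ (y - z)) * winSup (win d) f (η - ζ) := by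
          gcongr
          · exact enorm_fourier_window_le χ (y - z) ζ
          · exact le_winSup _ _ _ _
      _ = _ := by ring
  have hfinal : ‖𝓕 (fun ξ => χ (ξ - z) * f ξ) η‖ₑ * ‖c‖ₑ ≤
      (∫⁻ y, derivMajorant χ y) * ∫⁻ ζ, W ζ * winSup (win d) f (η - ζ) := by
    rw [← enorm_mul, ← hswap]
    refine (enorm_integral_le_lintegral_enorm _).trans ((lintegral_mono hL).trans_eq ?_)
    have hm : Measurable fun y => derivMajorant χ (y - z) :=
      (measurable_derivMajorant χ).comp (measurable_id.sub measurable_const)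
    rw [lintegral_mul_const _ hm, lintegral_sub_right_eq_self]
  rw [mul_assoc, ← ENNReal.div_eq_inv_mul, ENNReal.le_div_iff_mul_le]
  · exact hfinal
  · exact Or.inl (enorm_ne_zero.2 hc0)
  · exact Or.inl enorm_ne_top

theorem normW_le_winNorm (e : Module.Basis (Fin d) ℝ (E d)) (χ : SchwartzMap (E d) ℂ)
    (f : E d → ℂ) : normW e χ f ≤ winNorm χ f :=
  lintegral_mono fun η => iSup_le fun n => le_winSup χ f (latticePt e n) η

end TorusKAM

namespace TorusKAM

variable {d : ℕ}

/-! ### The Banach algebra of symbols in `ξ` -/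

theorem BoundedContinuousFunction.exists_bound (f : BoundedContinuousFunction (E d) ℂ) :
    ∃ M : ℝ, ∀ ξ, ‖f ξ‖ ≤ M := ⟨‖f‖, f.norm_coe_le_norm⟩

theorem winNorm_le_of_tendsto {g : E d → ℂ} (hg : FourierPair g) {f : ℕ → E d → ℂ}
    {flim : E d → ℂ} (hf : ∀ n, Continuous (f n)) {M : ℝ} (hM : ∀ n ξ, ‖f n ξ‖ ≤ M)
    (hlim : ∀ ξ, Tendsto (fun n => f n ξ) atTop (𝓝 (flim ξ))) {c : ℝ≥0∞}
    (hc : ∀ n, winNorm g (f n) ≤ c) : winNorm g flim ≤ c := by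
  have h1 : ∀ η, winSup g flim η ≤ liminf (fun n => winSup g (f n) η) atTop := by
    intro η
    refine iSup_le fun y => ?_
    have ht : Tendsto (fun n => 𝓕 (fun ξ => g (ξ - y) * f n ξ) η) atTop
        (𝓝 (𝓕 (fun ξ => g (ξ - y) * flim ξ) η)) := by
      simp only [Real.fourier_eq]
      refine tendsto_integral_of_dominated_convergence (fun ξ => ‖g (ξ - y)‖ * M)
        (fun n => ?_) ((hg.translate y).integrable.norm.mul_const M)
        (fun n => Eventually.of_forall fun ξ => ?_) (Eventually.of_forall fun ξ => ?_)
      · exact ((Real.fourierIntegral_convergent_iff η).2 (integrable_window hg.integrable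
          (hf n) ⟨M, hM n⟩ y)).aestronglyMeasurable
      · rw [Circle.norm_smul, norm_mul]
        gcongr
        exact hM n ξ
      · exact ((hlim ξ).const_mul _).const_smul _
    rw [← ht.enorm.liminf_eq]
    exact liminf_le_liminf (Eventually.of_forall fun n => le_winSup g (f n) y η)
  calc winNorm g flim ≤ ∫⁻ η, liminf (fun n => winSup g (f n) η) atTop := lintegral_mono h1
    _ ≤ liminf (fun n => winNorm g (f n)) atTop :=
      lintegral_liminf_le fun n => measurable_winSup hg.integrable (hf n) ⟨M, hM n⟩
    _ ≤ liminf (fun _ : ℕ => c) atTop := liminf_le_liminf (Eventually.of_forall hc)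
    _ = c := liminf_const c

/-- The constant of the algebra inequality for `winNorm`. -/
def algConst (d : ℕ) : ℝ≥0 := max 1 (exists_winNorm_le_sq d).choose

theorem winNorm_mul_le_const {f f' : E d → ℂ} (hf : Continuous f) (hb : ∃ M : ℝ, ∀ ξ, ‖f ξ‖ ≤ M)
    (hf' : Continuous f') (hb' : ∃ M : ℝ, ∀ ξ, ‖f' ξ‖ ≤ M) (h : winNorm (win d) f ≠ ∞) :
    winNorm (win d) (fun ξ => f ξ * f' ξ)
      ≤ algConst d * (winNorm (win d) f * winNorm (win d) f') := by
  have hbm : ∃ M : ℝ, ∀ ξ, ‖f ξ * f' ξ‖ ≤ M := by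
    obtain ⟨M, hM⟩ := hb
    obtain ⟨M', hM'⟩ := hb'
    refine ⟨M * M', fun ξ => ?_⟩
    rw [norm_mul]
    exact mul_le_mul (hM ξ) (hM' ξ) (norm_nonneg _) ((norm_nonneg _).trans (hM ξ))
  refine ((exists_winNorm_le_sq d).choose_spec _ (hf.mul hf') hbm).trans ?_
  refine mul_le_mul' (by exact_mod_cast le_max_right _ _) ?_
  exact winNorm_mul_le fourierPair_win fourierPair_win hf hb hf' hb' h

theorem winNorm_const_ne_top (c : ℂ) : winNorm (win d) (fun _ => c) ≠ ∞ := by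
  have h : winNorm (win d) (fun _ => 1) ≤ ∫⁻ η, ‖𝓕 (win d) η‖ₑ := by
    refine lintegral_mono fun η => iSup_le fun y => ?_
    simp only [mul_one]
    exact (norm_fourier_translate _ _ _).le
  have h2 := winNorm_smul (win d) (fun _ => 1) c
  simp only [mul_one] at h2
  rw [h2]
  exact ENNReal.mul_ne_top enorm_ne_top
    (h.trans_lt fourierPair_win.integrable_fourier.2).ne

/-- The bounded continuous functions of finite amalgam norm. -/
def wSubalgebra (d : ℕ) : Subalgebra ℂ (BoundedContinuousFunction (E d) ℂ) where
  carrier := {f | winNorm (win d) f ≠ ∞}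
  mul_mem' {f f'} hf hf' :=
    ((winNorm_mul_le_const f.continuous (BoundedContinuousFunction.exists_bound f)
      f'.continuous (BoundedContinuousFunction.exists_bound f') hf).trans_lt
      (ENNReal.mul_lt_top ENNReal.coe_lt_top (ENNReal.mul_lt_top hf.lt_top hf'.lt_top))).ne
  add_mem' {f f'} hf hf' :=
    ((winNorm_add_le fourierPair_win f.continuous (BoundedContinuousFunction.exists_bound f)
      f'.continuous (BoundedContinuousFunction.exists_bound f')).trans_lt
      (ENNReal.add_lt_top.2 ⟨hf.lt_top, hf'.lt_top⟩)).ne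
  algebraMap_mem' c := winNorm_const_ne_top c

/-- The algebra of bounded continuous functions of finite amalgam norm, as a Banach algebra. -/
def WAlg (d : ℕ) : Type := wSubalgebra d

namespace WAlg

instance : CommRing (WAlg d) := inferInstanceAs (CommRing (wSubalgebra d))

instance : Algebra ℂ (WAlg d) := inferInstanceAs (Algebra ℂ (wSubalgebra d))

/-- The underlying bounded continuous function. -/
def toBCF (f : WAlg d) : BoundedContinuousFunction (E d) ℂ := f.1

instance : CoeFun (WAlg d) fun _ => E d → ℂ := ⟨fun f => f.toBCF⟩

theorem finite (f : WAlg d) : winNorm (win d) f ≠ ∞ := f.2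

theorem continuous (f : WAlg d) : Continuous f := f.toBCF.continuous

theorem bounded (f : WAlg d) : ∃ M : ℝ, ∀ ξ, ‖f ξ‖ ≤ M :=
  BoundedContinuousFunction.exists_bound f.toBCF

theorem ext {f f' : WAlg d} (h : ∀ ξ, f ξ = f' ξ) : f = f' :=
  Subtype.ext (BoundedContinuousFunction.ext h)

theorem mul_apply (f f' : WAlg d) (ξ : E d) : (f * f') ξ = f ξ * f' ξ := rfl

theorem zero_apply (ξ : E d) : (0 : WAlg d) ξ = 0 := rfl

theorem one_apply (ξ : E d) : (1 : WAlg d) ξ = 1 := rfl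

/-- A bounded continuous function of finite amalgam norm, as an element of the algebra. -/
def mk (f : E d → ℂ) (hf : Continuous f) (hb : ∃ M : ℝ, ∀ ξ, ‖f ξ‖ ≤ M)
    (h : winNorm (win d) f ≠ ∞) : WAlg d :=
  ⟨BoundedContinuousFunction.ofNormedAddCommGroup f hf hb.choose hb.choose_spec, h⟩

theorem norm_apply_le_winNorm (f : WAlg d) (ξ : E d) : ‖f ξ‖ ≤ (winNorm (win d) f).toReal := by
  have := ENNReal.toReal_mono f.finite
    (enorm_le_winNorm fourierPair_win f.continuous f.bounded win_zero ξ)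
  rwa [toReal_enorm] at this

/-- The norm of the Banach algebra. -/
def ringNorm (d : ℕ) : RingNorm (WAlg d) where
  toFun f := algConst d * (winNorm (win d) f).toReal
  map_zero' := by
    have h := winNorm_smul (win d) (fun _ => 0) 0
    simp only [mul_zero, enorm_zero, zero_mul] at h
    have h2 : winNorm (win d) (0 : WAlg d) = 0 := h
    rw [h2, ENNReal.toReal_zero, mul_zero]
  add_le' f f' := by
    have h := winNorm_add_le fourierPair_win f.continuous f.bounded f'.continuous f'.bounded
    rw [← mul_add, ← ENNReal.toReal_add f.finite f'.finite]
    gcongr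
    · exact ENNReal.add_ne_top.2 ⟨f.finite, f'.finite⟩
    · exact h
  neg' f := by
    have h := winNorm_smul (win d) f (-1)
    simp only [neg_mul, one_mul, enorm_neg, enorm_one] at h
    have h2 : winNorm (win d) (-f : WAlg d) = winNorm (win d) f := h
    simp only [h2]
  mul_le' f f' := by
    have h := winNorm_mul_le_const f.continuous f.bounded f'.continuous f'.bounded f.finite
    have h2 := ENNReal.toReal_mono (ENNReal.mul_ne_top ENNReal.coe_ne_top
      (ENNReal.mul_ne_top f.finite f'.finite)) h
    rw [ENNReal.toReal_mul, ENNReal.toReal_mul, ENNReal.coe_toReal] at h2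
    calc _ ≤ (algConst d : ℝ) * (algConst d *
          ((winNorm (win d) f).toReal * (winNorm (win d) f').toReal)) := by
          gcongr
          exact h2
      _ = _ := by ring
  eq_zero_of_map_eq_zero' f h := by
    have h1 : (0 : ℝ) < algConst d := by
      have : (1 : ℝ≥0) ≤ algConst d := le_max_left _ _
      exact_mod_cast zero_lt_one.trans_le this
    have h2 := (mul_eq_zero.1 h).resolve_left h1.ne'
    refine WAlg.ext fun ξ => ?_
    have := norm_apply_le_winNorm f ξ
    rw [h2] at this
    exact norm_le_zero_iff.1 this

instance : NormedRing (WAlg d) := (ringNorm d).toNormedRing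

theorem norm_def (f : WAlg d) : ‖f‖ = algConst d * (winNorm (win d) f).toReal := rfl

theorem one_le_algConst : (1 : ℝ) ≤ algConst d := by
  have : (1 : ℝ≥0) ≤ algConst d := le_max_left _ _
  exact_mod_cast this

theorem enorm_def (f : WAlg d) : ‖f‖ₑ = algConst d * winNorm (win d) f := by
  rw [← ofReal_norm, norm_def, ENNReal.ofReal_mul (by positivity), ENNReal.ofReal_coe_nnreal,
    ENNReal.ofReal_toReal f.finite]

theorem norm_apply_le (f : WAlg d) (ξ : E d) : ‖f ξ‖ ≤ ‖f‖ :=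
  (norm_apply_le_winNorm f ξ).trans (le_mul_of_one_le_left ENNReal.toReal_nonneg one_le_algConst)

theorem winNorm_le (f : WAlg d) : winNorm (win d) f ≤ ‖f‖ₑ := by
  rw [enorm_def]
  refine le_mul_of_one_le_left zero_le ?_
  exact_mod_cast (le_max_left _ _ : (1 : ℝ≥0) ≤ algConst d)

instance : NormedAlgebra ℂ (WAlg d) where
  norm_smul_le c f := by
    rw [norm_def, norm_def]
    have h : winNorm (win d) (c • f : WAlg d) = ‖c‖ₑ * winNorm (win d) f := winNorm_smul _ _ _
    rw [h, ENNReal.toReal_mul, toReal_enorm]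
    exact (mul_left_comm _ _ _).le

instance : CompleteSpace (WAlg d) := by
  refine Metric.complete_of_cauchySeq_tendsto fun u hu => ?_
  have hdist : ∀ f f' : WAlg d, dist f.toBCF f'.toBCF ≤ dist f f' := by
    intro f f'
    rw [BoundedContinuousFunction.dist_le dist_nonneg]
    intro ξ
    rw [dist_eq_norm, dist_eq_norm]
    exact norm_apply_le (f - f') ξ
  have hcs : CauchySeq fun n => (u n).toBCF := by
    rw [Metric.cauchySeq_iff] at hu ⊢
    intro ε hε
    obtain ⟨N, hN⟩ := hu ε hε
    exact ⟨N, fun m hm n hn => (hdist _ _).trans_lt (hN m hm n hn)⟩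
  obtain ⟨f, hf⟩ := cauchySeq_tendsto_of_complete hcs
  have hpt : ∀ ξ, Tendsto (fun n => u n ξ) atTop (𝓝 (f ξ)) := fun ξ =>
    (BoundedContinuousFunction.tendsto_iff_tendstoUniformly.1 hf).tendsto_at ξ
  obtain ⟨M, hM⟩ : ∃ M, ∀ n, ‖(u n).toBCF‖ ≤ M := by
    obtain ⟨M, hM⟩ := hcs.isBounded_range.exists_norm_le
    exact ⟨M, fun n => hM _ ⟨n, rfl⟩⟩
  have key : ∀ (ε : ℝ) (N n : ℕ), (∀ m ≥ N, dist (u n) (u m) ≤ ε) →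
      winNorm (win d) (fun ξ => u n ξ - f ξ) ≤ ENNReal.ofReal ε := by
    intro ε N n h
    refine winNorm_le_of_tendsto fourierPair_win (f := fun m => (u n - u (m + N) : WAlg d))
      (fun m => (u n - u (m + N)).continuous) (M := M + M) (fun m ξ => ?_) (fun ξ => ?_)
      fun m => ?_
    · exact (norm_sub_le _ _).trans (add_le_add
        (((u n).toBCF.norm_coe_le_norm ξ).trans (hM _))
        (((u (m + N)).toBCF.norm_coe_le_norm ξ).trans (hM _)))
    · exact tendsto_const_nhds.sub ((hpt ξ).comp (tendsto_add_atTop_nat N))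
    · refine (winNorm_le _).trans ?_
      rw [← ofReal_norm, ← dist_eq_norm]
      exact ENNReal.ofReal_le_ofReal (h _ (by omega))
  have hmem : winNorm (win d) f ≠ ∞ := by
    obtain ⟨N, hN⟩ := Metric.cauchySeq_iff.1 hu 1 one_pos
    have h1 := key 1 N N fun m hm => (hN N le_rfl m hm).le
    have h2 := winNorm_add_le fourierPair_win (u N).continuous (u N).bounded
      (f' := fun ξ => -1 * (u N ξ - f ξ))
      (continuous_const.mul ((u N).continuous.sub f.continuous))
      (BoundedContinuousFunction.exists_bound ((-1 : ℂ) • ((u N).toBCF - f)))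
    rw [winNorm_smul] at h2
    have h3 : (fun ξ => u N ξ + -1 * (u N ξ - f ξ)) = f := by
      ext ξ
      ring
    rw [h3] at h2
    refine (h2.trans_lt (ENNReal.add_lt_top.2 ⟨(u N).finite.lt_top, ?_⟩)).ne
    exact ENNReal.mul_lt_top enorm_lt_top (h1.trans_lt ENNReal.ofReal_lt_top)
  refine ⟨mk f f.continuous (BoundedContinuousFunction.exists_bound f) hmem, Metric.tendsto_atTop.2 fun ε hε => ?_⟩
  have hκ : (0 : ℝ) < algConst d := zero_lt_one.trans_le one_le_algConst
  obtain ⟨N, hN⟩ := Metric.cauchySeq_iff.1 hu (ε / 2 / algConst d) (by positivity)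
  refine ⟨N, fun n hn => ?_⟩
  have h1 := key _ N n fun m hm => (hN n hn m hm).le
  rw [dist_eq_norm, norm_def]
  have h2 := ENNReal.toReal_mono ENNReal.ofReal_ne_top h1
  rw [ENNReal.toReal_ofReal (by positivity)] at h2
  calc _ ≤ (algConst d : ℝ) * (ε / 2 / algConst d) := by
        gcongr
        exact h2
    _ = ε / 2 := by field_simp
    _ < ε := by linarith

/-- The translation `f ↦ f(· + c)`, as an algebra homomorphism. -/
def shift (c : E d) : WAlg d →ₐ[ℂ] WAlg d where
  toFun f := mk (fun ξ => f (ξ + c)) (f.continuous.comp (continuous_id.add continuous_const))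
    (f.bounded.imp fun _ h ξ => h _) (by
      rw [winNorm_translate]
      exact f.finite)
  map_one' := rfl
  map_mul' _ _ := rfl
  map_zero' := rfl
  map_add' _ _ := rfl
  commutes' _ := rfl

theorem shift_apply (c : E d) (f : WAlg d) (ξ : E d) : shift c f ξ = f (ξ + c) := rfl

theorem norm_shift (c : E d) (f : WAlg d) : ‖shift c f‖ = ‖f‖ := by
  rw [norm_def, norm_def]
  have h : winNorm (win d) (shift c f) = winNorm (win d) f := winNorm_translate _ _ _
  rw [h]

end WAlg

end TorusKAM

namespace TorusKAM

/-! ### Twisted convolution algebras -/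

theorem summable_of_tsum_enorm_ne_top {ι B : Type*} [NormedAddCommGroup B] [CompleteSpace B]
    {f : ι → B} (h : ∑' i, ‖f i‖ₑ ≠ ∞) : Summable f :=
  (tsum_enorm_ne_top_iff_summable_norm.1 h).of_norm

theorem ENNReal.tsum_convolution {G : Type*} [AddCommGroup G] (f g : G → ℝ≥0∞) :
    ∑' n, ∑' m, f (n - m) * g m = (∑' n, f n) * ∑' m, g m := by
  rw [ENNReal.tsum_comm, ← ENNReal.tsum_mul_left]
  refine tsum_congr fun m => ?_
  rw [ENNReal.tsum_mul_right]
  congr 1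
  exact (Equiv.subRight m).tsum_eq f

theorem enorm_mul_le_mul {B : Type*} [NormedRing B] (a b : B) : ‖a * b‖ₑ ≤ ‖a‖ₑ * ‖b‖ₑ := by
  rw [← ofReal_norm, ← ofReal_norm, ← ofReal_norm, ← ENNReal.ofReal_mul (norm_nonneg _)]
  exact ENNReal.ofReal_le_ofReal (norm_mul_le a b)

/-- An action of a group on a Banach algebra by isometric automorphisms. -/
structure IsometricAction (G B : Type*) [AddCommGroup G] [NormedRing B] [NormedAlgebra ℂ B] where
  /-- The automorphism attached to a group element. -/
  act : G → B →ₐ[ℂ] B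
  act_zero : ∀ b, act 0 b = b
  act_add : ∀ m n b, act (m + n) b = act m (act n b)
  norm_act : ∀ m b, ‖act m b‖ = ‖b‖

variable {G B : Type*} [AddCommGroup G] [NormedRing B] [NormedAlgebra ℂ B]

theorem IsometricAction.enorm_act (α : IsometricAction G B) (m : G) (b : B) :
    ‖α.act m b‖ₑ = ‖b‖ₑ := by
  rw [enorm_eq_iff_norm_eq, α.norm_act]

theorem IsometricAction.continuous_act (α : IsometricAction G B) (m : G) :
    Continuous (α.act m) :=
  AddMonoidHomClass.continuous_of_bound (α.act m) 1 fun b => by rw [α.norm_act, one_mul]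

/-- The Banach algebra of absolutely summable families in `B`, with the convolution product
twisted by an action. -/
def Crossed (_α : IsometricAction G B) : Type _ := lp (fun _ : G => B) 1

namespace Crossed

variable {α : IsometricAction G B}

instance : NormedAddCommGroup (Crossed α) :=
  inferInstanceAs (NormedAddCommGroup (lp (fun _ : G => B) 1))

instance : NormedSpace ℂ (Crossed α) :=
  inferInstanceAs (NormedSpace ℂ (lp (fun _ : G => B) 1))

instance [CompleteSpace B] : CompleteSpace (Crossed α) :=
  inferInstanceAs (CompleteSpace (lp (fun _ : G => B) 1))

/-- The coefficients of an element. -/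
def coeff (a : Crossed α) : G → B := a.1

instance : CoeFun (Crossed α) fun _ => G → B := ⟨coeff⟩

theorem ext {a b : Crossed α} (h : ∀ n, a n = b n) : a = b := Subtype.ext (funext h)

theorem add_apply (a b : Crossed α) (n : G) : (a + b) n = a n + b n := rfl

theorem sub_apply (a b : Crossed α) (n : G) : (a - b) n = a n - b n := rfl

theorem neg_apply (a : Crossed α) (n : G) : (-a) n = -a n := rfl

theorem zero_apply (n : G) : (0 : Crossed α) n = 0 := rfl

theorem smul_apply (c : ℂ) (a : Crossed α) (n : G) : (c • a) n = c • a n := rfl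

theorem summable_norm (a : Crossed α) : Summable fun n => ‖a n‖ := by
  have := (memℓp_gen_iff (p := 1) (by simp)).1 a.2
  simp only [ENNReal.toReal_one, Real.rpow_one] at this
  exact this

theorem tsum_enorm_ne_top (a : Crossed α) : ∑' n, ‖a n‖ₑ ≠ ∞ :=
  tsum_enorm_ne_top_iff_summable_norm.2 a.summable_norm

theorem norm_eq (a : Crossed α) : ‖a‖ = ∑' n, ‖a n‖ := by
  have := lp.norm_eq_tsum_rpow (p := 1) (by simp) (a : lp (fun _ : G => B) 1)
  simp only [ENNReal.toReal_one, Real.rpow_one, div_one] at this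
  exact this

theorem enorm_eq (a : Crossed α) : ‖a‖ₑ = ∑' n, ‖a n‖ₑ := by
  rw [← ofReal_norm, norm_eq, ENNReal.ofReal_tsum_of_nonneg (fun _ => norm_nonneg _)
    a.summable_norm]
  simp only [ofReal_norm]

theorem norm_apply_le (a : Crossed α) (n : G) : ‖a n‖ ≤ ‖a‖ := by
  rw [norm_eq]
  exact a.summable_norm.le_tsum n fun _ _ => norm_nonneg _

/-- An absolutely summable family, as an element of the algebra. -/
def mk (f : G → B) (h : ∑' n, ‖f n‖ₑ ≠ ∞) : Crossed α :=
  ⟨f, (memℓp_gen_iff (p := 1) (by simp)).2 (by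
    simpa using tsum_enorm_ne_top_iff_summable_norm.1 h)⟩

theorem mk_apply (f : G → B) (h : ∑' n, ‖f n‖ₑ ≠ ∞) (n : G) : (mk f h : Crossed α) n = f n := rfl

/-- The evaluation of a coefficient, as a continuous linear map. -/
def evalCLM (α : IsometricAction G B) (n : G) : Crossed α →L[ℂ] B :=
  LinearMap.mkContinuous
    { toFun := fun a => a n
      map_add' := fun _ _ => rfl
      map_smul' := fun _ _ => rfl } 1 fun a => by
    rw [one_mul]
    exact norm_apply_le a n

/-- The twisted convolution of two families. -/
def conv (α : IsometricAction G B) (a b : G → B) (n : G) : B :=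
  ∑' m, α.act m (a (n - m)) * b m

theorem enorm_conv_le (a b : G → B) (n : G) :
    ‖conv α a b n‖ₑ ≤ ∑' m, ‖a (n - m)‖ₑ * ‖b m‖ₑ := by
  refine enorm_tsum_le_tsum_enorm.trans (ENNReal.tsum_le_tsum fun m => ?_)
  refine (enorm_mul_le_mul _ _).trans_eq ?_
  rw [α.enorm_act]

theorem tsum_enorm_conv_le (a b : G → B) :
    ∑' n, ‖conv α a b n‖ₑ ≤ (∑' n, ‖a n‖ₑ) * ∑' n, ‖b n‖ₑ := by
  rw [← ENNReal.tsum_convolution]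
  exact ENNReal.tsum_le_tsum fun n => enorm_conv_le a b n

instance : Mul (Crossed α) := ⟨fun a b => mk (conv α a b)
  ((tsum_enorm_conv_le a b).trans_lt
    (ENNReal.mul_lt_top a.tsum_enorm_ne_top.lt_top b.tsum_enorm_ne_top.lt_top)).ne⟩

theorem mul_apply (a b : Crossed α) (n : G) :
    (a * b) n = ∑' m, α.act m (a (n - m)) * b m := rfl

theorem tsum_enorm_mul_ne_top (a b : Crossed α) (n : G) :
    ∑' m, ‖a (n - m)‖ₑ * ‖b m‖ₑ ≠ ∞ := by
  refine ((ENNReal.le_tsum (f := fun n => ∑' m, ‖a (n - m)‖ₑ * ‖b m‖ₑ) n).trans_lt ?_).ne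
  rw [ENNReal.tsum_convolution (fun n => ‖a n‖ₑ) fun n => ‖b n‖ₑ]
  exact ENNReal.mul_lt_top a.tsum_enorm_ne_top.lt_top b.tsum_enorm_ne_top.lt_top

theorem summable_mul [CompleteSpace B] (a b : Crossed α) (n : G) :
    Summable fun m => α.act m (a (n - m)) * b m := by
  refine summable_of_tsum_enorm_ne_top
    ((ENNReal.tsum_le_tsum fun m => ?_).trans_lt (tsum_enorm_mul_ne_top a b n).lt_top).ne
  refine (enorm_mul_le_mul _ _).trans_eq ?_
  rw [α.enorm_act]

open Classical in
/-- The embedding of the coefficient algebra. -/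
def of (α : IsometricAction G B) (r : B) : Crossed α :=
  mk (fun n => if n = 0 then r else 0) (by
    rw [tsum_eq_single 0 fun n hn => by simp [hn]]
    exact enorm_ne_top)

theorem of_zero_apply (r : B) : of α r 0 = r := if_pos rfl

theorem of_apply_of_ne (r : B) {n : G} (hn : n ≠ 0) : of α r n = 0 := if_neg hn

instance : One (Crossed α) := ⟨of α 1⟩

theorem one_def : (1 : Crossed α) = of α 1 := rfl

theorem of_mul_apply (r : B) (a : Crossed α) (n : G) : (of α r * a) n = α.act n r * a n := by
  rw [mul_apply, tsum_eq_single n, sub_self, of_zero_apply]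
  intro m hm
  rw [of_apply_of_ne _ (sub_ne_zero.2 hm.symm), map_zero, zero_mul]

theorem mul_of_apply (r : B) (a : Crossed α) (n : G) : (a * of α r) n = a n * r := by
  rw [mul_apply, tsum_eq_single 0, sub_zero, of_zero_apply, α.act_zero]
  intro m hm
  rw [of_apply_of_ne _ hm, mul_zero]

theorem mul_assoc' [CompleteSpace B] (a b c : Crossed α) : a * b * c = a * (b * c) := by
  refine ext fun n => ?_
  have hfin : ∑' p, ∑' m, ‖a (n - p)‖ₑ * (‖b (p - m)‖ₑ * ‖c m‖ₑ) ≠ ∞ := by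
    have hbc : ∑' p, ∑' m, ‖b (p - m)‖ₑ * ‖c m‖ₑ ≠ ∞ := by
      rw [ENNReal.tsum_convolution (fun n => ‖b n‖ₑ) fun n => ‖c n‖ₑ]
      exact ENNReal.mul_ne_top b.tsum_enorm_ne_top c.tsum_enorm_ne_top
    refine ((ENNReal.le_tsum (f := fun n =>
      ∑' p, ∑' m, ‖a (n - p)‖ₑ * (‖b (p - m)‖ₑ * ‖c m‖ₑ)) n).trans_lt ?_).ne
    simp only [ENNReal.tsum_mul_left]
    rw [ENNReal.tsum_convolution (fun n => ‖a n‖ₑ) fun p => ∑' m, ‖b (p - m)‖ₑ * ‖c m‖ₑ]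
    exact ENNReal.mul_lt_top a.tsum_enorm_ne_top.lt_top hbc.lt_top
  have hsum : Summable (Function.uncurry fun p m =>
      α.act p (a (n - p)) * (α.act m (b (p - m)) * c m)) := by
    refine summable_of_tsum_enorm_ne_top ((?_ : _ ≤ _).trans_lt hfin.lt_top).ne
    rw [ENNReal.tsum_prod']
    refine ENNReal.tsum_le_tsum fun p => ENNReal.tsum_le_tsum fun m => ?_
    refine (enorm_mul_le_mul _ _).trans ?_
    rw [α.enorm_act]
    gcongr
    refine (enorm_mul_le_mul _ _).trans_eq ?_
    rw [α.enorm_act]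
  have hR : (a * (b * c)) n
      = ∑' p, ∑' m, α.act p (a (n - p)) * (α.act m (b (p - m)) * c m) := by
    rw [mul_apply]
    refine tsum_congr fun p => ?_
    rw [mul_apply, (summable_mul b c p).tsum_mul_left]
  rw [hR, ← hsum.tsum_comm, mul_apply]
  refine tsum_congr fun m => ?_
  rw [mul_apply, (summable_mul a b _).map_tsum (α.act m) (α.continuous_act m),
    ← Summable.tsum_mul_right _ (by
      exact (summable_mul a b (n - m)).map (α.act m) (α.continuous_act m)),
    ← (Equiv.addLeft m).tsum_eq
      fun p => α.act p (a (n - p)) * (α.act m (b (p - m)) * c m)]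
  refine tsum_congr fun l => ?_
  simp only [Equiv.coe_addLeft]
  rw [map_mul, ← α.act_add, add_sub_cancel_left, sub_sub, mul_assoc]

instance [CompleteSpace B] : NormedRing (Crossed α) where
  dist_eq a b := dist_eq_norm_neg_add a b
  left_distrib a b c := ext fun n => by
    rw [mul_apply, add_apply, mul_apply, mul_apply,
      ← (summable_mul a b n).tsum_add (summable_mul a c n)]
    simp only [add_apply, mul_add]
  right_distrib a b c := ext fun n => by
    rw [mul_apply, add_apply, mul_apply, mul_apply,
      ← (summable_mul a c n).tsum_add (summable_mul b c n)]
    simp only [add_apply, map_add, add_mul]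
  zero_mul a := ext fun n => by
    rw [mul_apply]
    simp only [zero_apply, map_zero, zero_mul, tsum_zero]
  mul_zero a := ext fun n => by
    rw [mul_apply]
    simp only [zero_apply, mul_zero, tsum_zero]
  mul_assoc := mul_assoc'
  one_mul a := ext fun n => by rw [one_def, of_mul_apply, map_one, one_mul]
  mul_one a := ext fun n => by rw [one_def, mul_of_apply, mul_one]
  norm_mul_le a b := by
    have h : ‖a * b‖ₑ ≤ ‖a‖ₑ * ‖b‖ₑ := by
      rw [enorm_eq, enorm_eq, enorm_eq]
      exact tsum_enorm_conv_le a b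
    have h2 := ENNReal.toReal_mono (ENNReal.mul_ne_top enorm_ne_top enorm_ne_top) h
    simpa only [ENNReal.toReal_mul, toReal_enorm] using h2
  zsmul := fun n a => n • a
  zsmul_zero' := SubNegMonoid.zsmul_zero'
  zsmul_succ' := SubNegMonoid.zsmul_succ'
  zsmul_neg' := SubNegMonoid.zsmul_neg'
  nsmul := fun n a => n • a
  nsmul_zero := AddMonoid.nsmul_zero
  nsmul_succ := AddMonoid.nsmul_succ
  sub_eq_add_neg := sub_eq_add_neg
  neg_add_cancel := neg_add_cancel

end Crossed

end TorusKAM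

namespace TorusKAM

set_option linter.unusedSectionVars false

variable {G B : Type*} [AddCommGroup G] [NormedRing B] [NormedAlgebra ℂ B]

namespace Crossed

variable {α : IsometricAction G B}

theorem mul_smul' (c : ℂ) (a b : Crossed α) : a * (c • b) = c • (a * b) := ext fun n => by
  rw [smul_apply, mul_apply, mul_apply, ← tsum_const_smul'']
  simp only [smul_apply, mul_smul_comm]

theorem smul_mul' (c : ℂ) (a b : Crossed α) : (c • a) * b = c • (a * b) := ext fun n => by
  rw [smul_apply, mul_apply, mul_apply, ← tsum_const_smul'']
  simp only [smul_apply, map_smul, smul_mul_assoc]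

theorem of_add (r r' : B) : of α (r + r') = of α r + of α r' := ext fun n => by
  by_cases hn : n = 0
  · subst hn
    rw [add_apply, of_zero_apply, of_zero_apply, of_zero_apply]
  · rw [add_apply, of_apply_of_ne _ hn, of_apply_of_ne _ hn, of_apply_of_ne _ hn, add_zero]

theorem of_smul (c : ℂ) (r : B) : of α (c • r) = c • of α r := ext fun n => by
  by_cases hn : n = 0
  · subst hn
    rw [smul_apply, of_zero_apply, of_zero_apply]
  · rw [smul_apply, of_apply_of_ne _ hn, of_apply_of_ne _ hn, smul_zero]

theorem norm_of (r : B) : ‖of α r‖ = ‖r‖ := by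
  rw [norm_eq, tsum_eq_single 0 fun n hn => by rw [of_apply_of_ne _ hn, norm_zero],
    of_zero_apply]

theorem continuous_of : Continuous (of α) := by
  refine Metric.continuous_iff.2 fun r ε hε => ⟨ε, hε, fun r' h => ?_⟩
  have h2 : of α r' - of α r = of α (r' - r) := by
    rw [sub_eq_iff_eq_add, ← of_add, sub_add_cancel]
  rw [dist_eq_norm, h2, norm_of, ← dist_eq_norm]
  exact h

/-- Pointwise multiplication by an additive character is a derivation. -/
theorem derivation_mul [CompleteSpace B] (φ : G →+ ℝ) {a b a' b' : Crossed α}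
    (ha : ∀ n, (φ n : ℂ) • a n = a' n) (hb : ∀ n, (φ n : ℂ) • b n = b' n) (n : G) :
    (φ n : ℂ) • (a * b) n = (a' * b + a * b') n := by
  rw [add_apply, mul_apply, mul_apply, mul_apply, ← (summable_mul a' b n).tsum_add
    (summable_mul a b' n), ← tsum_const_smul'']
  refine tsum_congr fun m => ?_
  rw [← ha, ← hb, map_smul, smul_mul_assoc, mul_smul_comm, ← add_smul, ← Complex.ofReal_add,
    ← map_add, sub_add_cancel]

end Crossed

/-! ### Weighted norms -/

/-- A length function on a group. -/
structure IsLength (len : G → ℝ) : Prop where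
  nonneg : ∀ n, 0 ≤ len n
  zero : len 0 = 0
  add_le : ∀ m n, len (m + n) ≤ len m + len n

/-- The weighted norm `∑ ‖a n‖ exp (s |n|)`. -/
def expNorm (len : G → ℝ) (s : ℝ) (a : G → B) : ℝ≥0∞ :=
  ∑' n, ‖a n‖ₑ * ENNReal.ofReal (Real.exp (s * len n))

/-- The weighted norm of `a` is at most `x`. -/
def ExpBound (len : G → ℝ) (s : ℝ) (a : G → B) (x : ℝ) : Prop :=
  expNorm len s a ≤ ENNReal.ofReal x

namespace ExpBound

variable {α : IsometricAction G B} {len : G → ℝ} {s s' x y : ℝ}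

theorem mono {a : G → B} (h : ExpBound len s a x) (hxy : x ≤ y) : ExpBound len s a y :=
  h.trans (ENNReal.ofReal_le_ofReal hxy)

theorem mono_exp (hl : IsLength len) {a : G → B} (h : ExpBound len s a x) (hs : s' ≤ s) :
    ExpBound len s' a x := by
  refine (ENNReal.tsum_le_tsum fun n => ?_).trans h
  have := hl.nonneg n
  gcongr

theorem tsum_enorm_le (hl : IsLength len) (hs : 0 ≤ s) {a : G → B} (h : ExpBound len s a x) :
    ∑' n, ‖a n‖ₑ ≤ ENNReal.ofReal x := by
  refine (ENNReal.tsum_le_tsum fun n => ?_).trans h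
  refine le_mul_of_one_le_right zero_le ?_
  rw [ENNReal.one_le_ofReal]
  exact Real.one_le_exp (mul_nonneg hs (hl.nonneg n))

theorem norm_le (hl : IsLength len) (hs : 0 ≤ s) (hx : 0 ≤ x) {a : Crossed α}
    (h : ExpBound len s a x) : ‖a‖ ≤ x := by
  have h1 := tsum_enorm_le hl hs h
  rw [← Crossed.enorm_eq, ← ofReal_norm] at h1
  exact (ENNReal.ofReal_le_ofReal_iff hx).1 h1

theorem add {a b : Crossed α} (ha : ExpBound len s a x) (hb : ExpBound len s b y)
    (hx : 0 ≤ x) (hy : 0 ≤ y) : ExpBound len s (a + b : Crossed α) (x + y) := by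
  rw [ExpBound, ENNReal.ofReal_add hx hy]
  refine le_trans ?_ (add_le_add ha hb)
  rw [expNorm, expNorm, expNorm, ← ENNReal.tsum_add]
  refine ENNReal.tsum_le_tsum fun n => ?_
  rw [← add_mul]
  gcongr
  exact enorm_add_le _ _

theorem neg {a : Crossed α} (ha : ExpBound len s a x) : ExpBound len s (-a : Crossed α) x := by
  have h : ∀ n, ‖(-a : Crossed α) n‖ₑ = ‖a n‖ₑ := fun n => by rw [Crossed.neg_apply, enorm_neg]
  simp only [ExpBound, expNorm, h]
  exact ha

theorem sub {a b : Crossed α} (ha : ExpBound len s a x) (hb : ExpBound len s b y)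
    (hx : 0 ≤ x) (hy : 0 ≤ y) : ExpBound len s (a - b : Crossed α) (x + y) := by
  rw [sub_eq_add_neg]
  exact ha.add hb.neg hx hy

theorem mul (hl : IsLength len) (hs : 0 ≤ s) {a b : Crossed α} (ha : ExpBound len s a x)
    (hb : ExpBound len s b y) (hx : 0 ≤ x) : ExpBound len s (a * b : Crossed α) (x * y) := by
  rw [ExpBound, ENNReal.ofReal_mul hx]
  refine le_trans ?_ (mul_le_mul' ha hb)
  rw [expNorm, expNorm, expNorm, ← ENNReal.tsum_convolution
    (fun n => ‖a n‖ₑ * ENNReal.ofReal (Real.exp (s * len n)))]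
  refine ENNReal.tsum_le_tsum fun n => ?_
  refine (mul_le_mul_left (Crossed.enorm_conv_le (α := α) a b n) _).trans ?_
  rw [← ENNReal.tsum_mul_right]
  refine ENNReal.tsum_le_tsum fun m => ?_
  rw [mul_mul_mul_comm, ← ENNReal.ofReal_mul (Real.exp_nonneg _), ← Real.exp_add, ← mul_add]
  gcongr
  have := hl.add_le (n - m) m
  rwa [sub_add_cancel] at this

theorem of (hl : IsLength len) (r : B) : ExpBound len s (Crossed.of α r) ‖r‖ := by
  rw [ExpBound, expNorm, tsum_eq_single 0 fun n hn => by
    rw [Crossed.of_apply_of_ne _ hn, enorm_zero, zero_mul], Crossed.of_zero_apply, hl.zero,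
    mul_zero, Real.exp_zero, ENNReal.ofReal_one, mul_one, ofReal_norm]

theorem pow_succ [CompleteSpace B] (hl : IsLength len) (hs : 0 ≤ s) {a : Crossed α}
    (ha : ExpBound len s a x) (hx : 0 ≤ x) (k : ℕ) :
    ExpBound len s (a ^ (k + 1) : Crossed α) (x ^ (k + 1)) := by
  induction k with
  | zero => simpa using ha
  | succ k ih =>
    rw [_root_.pow_succ, _root_.pow_succ x]
    exact ih.mul hl hs ha (by positivity)

theorem tsum_pow [CompleteSpace B] (hl : IsLength len) (hs : 0 ≤ s) {a : Crossed α}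
    (ha : ExpBound len s a x) (hx : 0 ≤ x) (hx2 : x ≤ 1 / 2)
    (hsum : Summable fun k : ℕ => a ^ (k + 1)) :
    ExpBound len s (∑' k : ℕ, a ^ (k + 1) : Crossed α) (2 * x) := by
  have h1 : ∀ n, (∑' k : ℕ, a ^ (k + 1) : Crossed α) n = ∑' k : ℕ, (a ^ (k + 1) : Crossed α) n :=
    fun n => (Crossed.evalCLM α n).map_tsum hsum
  have hgeo : HasSum (fun k : ℕ => x ^ (k + 1)) (x * (1 - x)⁻¹) := by
    simp only [_root_.pow_succ']
    exact (hasSum_geometric_of_lt_one hx (by linarith)).mul_left x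
  calc expNorm len s (∑' k : ℕ, a ^ (k + 1) : Crossed α)
      ≤ ∑' n, ∑' k : ℕ, ‖(a ^ (k + 1) : Crossed α) n‖ₑ
          * ENNReal.ofReal (Real.exp (s * len n)) := by
        refine ENNReal.tsum_le_tsum fun n => ?_
        rw [h1, ENNReal.tsum_mul_right]
        gcongr
        exact enorm_tsum_le_tsum_enorm
    _ = ∑' k : ℕ, expNorm len s (a ^ (k + 1) : Crossed α) := ENNReal.tsum_comm
    _ ≤ ∑' k : ℕ, ENNReal.ofReal (x ^ (k + 1)) :=
        ENNReal.tsum_le_tsum fun k => ha.pow_succ hl hs hx k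
    _ = ENNReal.ofReal (x * (1 - x)⁻¹) := by
        rw [← ENNReal.ofReal_tsum_of_nonneg (fun k => by positivity) hgeo.summable,
          hgeo.tsum_eq]
    _ ≤ ENNReal.ofReal (2 * x) := by
        refine ENNReal.ofReal_le_ofReal ?_
        rw [mul_comm]
        gcongr
        rw [inv_le_comm₀ (by linarith) (by norm_num)]
        linarith

/-- The Neumann series in the weighted norm. -/
theorem exists_inverse [CompleteSpace B] (hl : IsLength len) (hs : 0 ≤ s) {w : Crossed α}
    (hw : ExpBound len s w x) (hx : 0 ≤ x) (hx2 : x ≤ 1 / 2) :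
    ∃ y : Crossed α, (1 + w) * (1 + y) = 1 ∧ (1 + y) * (1 + w) = 1 ∧
      ExpBound len s y (2 * x) := by
  have hn : ‖-w‖ < 1 := by
    rw [norm_neg]
    linarith [hw.norm_le hl hs hx]
  have hS := summable_geometric_of_norm_lt_one hn
  have hS' : Summable fun k : ℕ => (-w) ^ (k + 1) := (summable_nat_add_iff 1).2 hS
  have h1 : ∑' k : ℕ, (-w) ^ k = 1 + ∑' k : ℕ, (-w) ^ (k + 1) := by
    rw [hS.tsum_eq_zero_add, pow_zero]
  have h2 := mul_neg_geom_series (-w) hn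
  have h3 := geom_series_mul_neg (-w) hn
  rw [h1, sub_neg_eq_add] at h2 h3
  exact ⟨_, h2, h3, hw.neg.tsum_pow hl hs hx hx2 hS'⟩

/-- Division by small divisors costs an arbitrarily small part of the weight. -/
theorem div_small_divisor (hl : IsLength len) {φ : G →+ ℝ} {K : ℝ} {τ : ℕ} (hK : 0 ≤ K)
    (hφ : ∀ n, n ≠ 0 → |φ n|⁻¹ ≤ K * len n ^ τ) {σ : ℝ} (hσ : 0 < σ)
    {F : G → B} (hF : ExpBound len s F x) :
    ExpBound len (s - σ) (fun n => -((φ n : ℂ)⁻¹ • F n)) (K * τ.factorial / σ ^ τ * x) := by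
  have hfac : (0 : ℝ) < τ.factorial := by exact_mod_cast τ.factorial_pos
  have hc : 0 ≤ K * τ.factorial / σ ^ τ := by positivity
  rw [ExpBound, ENNReal.ofReal_mul hc]
  refine le_trans ?_ (mul_le_mul_right hF _)
  rw [expNorm, expNorm, ← ENNReal.tsum_mul_left]
  refine ENNReal.tsum_le_tsum fun n => ?_
  have hln := hl.nonneg n
  have key : |φ n|⁻¹ * Real.exp ((s - σ) * len n)
      ≤ K * τ.factorial / σ ^ τ * Real.exp (s * len n) := by
    have h1 : |φ n|⁻¹ ≤ K * len n ^ τ := by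
      by_cases hn : n = 0
      · rw [hn, map_zero, abs_zero, inv_zero]
        exact mul_nonneg hK (pow_nonneg (hl.nonneg 0) _)
      · exact hφ n hn
    have h2 := Real.pow_div_factorial_le_exp (σ * len n) (by positivity) τ
    have h3 : len n ^ τ ≤ τ.factorial / σ ^ τ * Real.exp (σ * len n) := by
      rw [div_le_iff₀ hfac, mul_pow] at h2
      rw [div_mul_eq_mul_div, le_div_iff₀ (by positivity)]
      linarith
    calc |φ n|⁻¹ * Real.exp ((s - σ) * len n)
        ≤ K * (τ.factorial / σ ^ τ * Real.exp (σ * len n)) * Real.exp ((s - σ) * len n) := by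
          gcongr
          exact h1.trans (mul_le_mul_of_nonneg_left h3 hK)
      _ = K * τ.factorial / σ ^ τ * (Real.exp (σ * len n) * Real.exp ((s - σ) * len n)) := by
          ring
      _ = _ := by
          rw [← Real.exp_add]
          ring_nf
  have hkey : ‖(φ n : ℂ)⁻¹‖ₑ * ENNReal.ofReal (Real.exp ((s - σ) * len n))
      ≤ ENNReal.ofReal (K * τ.factorial / σ ^ τ) * ENNReal.ofReal (Real.exp (s * len n)) := by
    rw [← ofReal_norm, norm_inv, Complex.norm_real, Real.norm_eq_abs,
      ← ENNReal.ofReal_mul (by positivity), ← ENNReal.ofReal_mul hc]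
    exact ENNReal.ofReal_le_ofReal key
  rw [enorm_neg, enorm_smul, mul_right_comm, mul_left_comm, mul_comm]
  exact mul_le_mul_right hkey _

end ExpBound

theorem exists_eq_of_near_id {F : Type*} [NormedAddCommGroup F] [NormedSpace ℂ F]
    [CompleteSpace F] (T : F →L[ℂ] F) (h : ∀ r, ‖r - T r‖ ≤ 1 / 2 * ‖r‖) (x : F) :
    ∃ r, T r = x ∧ ‖r‖ ≤ 2 * ‖x‖ := by
  have hn : ‖1 - T‖ < 1 :=
    ((1 - T).opNorm_le_bound (by norm_num) h).trans_lt (by norm_num)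
  have hT : (Units.oneSub (1 - T) hn : F →L[ℂ] F) = T := by
    rw [Units.val_oneSub, sub_sub_cancel]
  have h1 : T ((↑(Units.oneSub (1 - T) hn)⁻¹ : F →L[ℂ] F) x) = x := by
    have := congrArg (fun A : F →L[ℂ] F => A x) (Units.mul_inv (Units.oneSub (1 - T) hn))
    rw [hT] at this
    exact this
  refine ⟨_, h1, ?_⟩
  set r := (↑(Units.oneSub (1 - T) hn)⁻¹ : F →L[ℂ] F) x
  have h2 := h r
  rw [h1] at h2
  have h3 : ‖r‖ ≤ ‖r - x‖ + ‖x‖ := by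
    simpa using norm_add_le (r - x) x
  linarith

end TorusKAM

namespace TorusKAM

variable {G B : Type*} [AddCommGroup G] [NormedRing B] [NormedAlgebra ℂ B] [CompleteSpace B]
  {α : IsometricAction G B} {len : G → ℝ} {φ : G →+ ℝ}

/-! ### The Newton iteration with counterterms -/

/-- An approximate solution `(u, S)` of the conjugation equation
`[φ, 1 + u] + (P - S) (1 + u) = 0`, with error `E`, together with the inverse `1 + v` of
`1 + u`. -/
structure ApproxSolution (len : G → ℝ) (φ : G →+ ℝ) (P : Crossed α) (s ε a : ℝ)
    (u v : Crossed α) (S : B) (E : Crossed α) : Prop where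
  eq : ∀ n, (φ n : ℂ) • u n = (E - (P - Crossed.of α S) * (1 + u)) n
  inv_right : (1 + u) * (1 + v) = 1
  inv_left : (1 + v) * (1 + u) = 1
  bound_error : ExpBound len s E ε
  bound : ExpBound len s u a
  bound_inv : ExpBound len s v a

/-- The linearization of the counterterm equation. -/
def countertermMap (u v : Crossed α) : B →L[ℂ] B :=
  (Crossed.evalCLM α 0).comp (LinearMap.mkContinuous
    { toFun := fun r => (1 + v) * Crossed.of α r * (1 + u)
      map_add' := fun r r' => by
        rw [Crossed.of_add]
        noncomm_ring
      map_smul' := fun c r => by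
        rw [Crossed.of_smul, Crossed.mul_smul', Crossed.smul_mul', RingHom.id_apply] }
    (‖1 + v‖ * ‖1 + u‖) fun r => by
      calc _ ≤ ‖1 + v‖ * ‖Crossed.of α r‖ * ‖1 + u‖ :=
            (norm_mul_le _ _).trans (by gcongr; exact norm_mul_le _ _)
        _ = _ := by rw [Crossed.norm_of]; ring)

theorem countertermMap_apply (u v : Crossed α) (r : B) :
    countertermMap u v r = ((1 + v) * Crossed.of α r * (1 + u) : Crossed α) 0 := rfl

theorem ApproxSolution.step (hl : IsLength len) {K : ℝ} {τ : ℕ} (hK : 0 ≤ K)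
    (hφ : ∀ n, n ≠ 0 → φ n ≠ 0 ∧ |φ n|⁻¹ ≤ K * len n ^ τ) {P : Crossed α} {s σ ε a b : ℝ}
    {u v : Crossed α} {S : B} {E : Crossed α} (h : ApproxSolution len φ P s ε a u v S E)
    (hσ : 0 < σ) (hσs : σ ≤ s) (hε : 0 ≤ ε) (ha : 0 ≤ a) (ha2 : a ≤ 1 / 8)
    (hb : K * τ.factorial / σ ^ τ * (4 * ε) ≤ b) (hb2 : b ≤ 1 / 2) :
    ∃ (u' v' : Crossed α) (S' : B) (E' : Crossed α),
      ApproxSolution len φ P (s - σ) (4 * ε * b) (a + 3 * b) u' v' S' E' ∧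
      ‖S - S'‖ ≤ 3 * ε ∧ ‖u - u'‖ ≤ 2 * b := by
  have hs : 0 ≤ s := hσ.le.trans hσs
  have hs' : 0 ≤ s - σ := sub_nonneg.2 hσs
  have hb0 : 0 ≤ b := le_trans (by positivity) hb
  have hu := h.bound.norm_le hl hs ha
  have hv := h.bound_inv.norm_le hl hs ha
  have hE := h.bound_error.norm_le hl hs hε
  obtain ⟨r, hr, hrn⟩ := exists_eq_of_near_id (countertermMap u v) (fun r => by
    have h1 : r - countertermMap u v r
        = (-(Crossed.of α r * u + v * Crossed.of α r + v * Crossed.of α r * u) : Crossed α) 0 := by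
      rw [countertermMap_apply]
      nth_rewrite 1 [← Crossed.of_zero_apply (α := α) r]
      rw [← Crossed.sub_apply]
      congr 1
      noncomm_ring
    rw [h1, Crossed.neg_apply, norm_neg]
    have e1 : ‖Crossed.of α r * u‖ ≤ ‖r‖ * (1 / 8) :=
      (norm_mul_le _ _).trans (by rw [Crossed.norm_of]; gcongr; linarith)
    have e2 : ‖v * Crossed.of α r‖ ≤ 1 / 8 * ‖r‖ :=
      (norm_mul_le _ _).trans (by rw [Crossed.norm_of]; gcongr; linarith)
    have e3 : ‖v * Crossed.of α r * u‖ ≤ 1 / 8 * ‖r‖ * (1 / 8) :=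
      (norm_mul_le _ _).trans (mul_le_mul e2 (by linarith) (norm_nonneg _) (by positivity))
    have e4 := (Crossed.norm_apply_le
      (Crossed.of α r * u + v * Crossed.of α r + v * Crossed.of α r * u) 0).trans
      ((norm_add_le _ _).trans (add_le_add_left (norm_add_le _ _) _))
    have := norm_nonneg r
    linarith) (((1 + v) * E : Crossed α) 0)
  have hd : ‖((1 + v) * E : Crossed α) 0‖ ≤ 9 / 8 * ε := by
    refine (Crossed.norm_apply_le _ 0).trans ?_
    rw [add_mul, one_mul]
    refine (norm_add_le _ _).trans ?_
    have : ‖v * E‖ ≤ 1 / 8 * ε :=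
      (norm_mul_le _ _).trans (mul_le_mul (by linarith) hE (norm_nonneg _) (by positivity))
    linarith
  have hr3 : ‖r‖ ≤ 9 / 4 * ε := by linarith
  set M : Crossed α := E - Crossed.of α r * (1 + u) with hM
  set F : Crossed α := (1 + v) * M with hF
  have hof : ExpBound len s (Crossed.of α r) (9 / 4 * ε) := (ExpBound.of hl r).mono hr3
  have hMb : ExpBound len s M (113 / 32 * ε) := by
    have h1 : M = E - (Crossed.of α r + Crossed.of α r * u) := by rw [hM, mul_add, mul_one]
    rw [h1]
    refine (h.bound_error.sub (hof.add (hof.mul hl hs h.bound (by positivity))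
      (by positivity) (by positivity)) hε (by positivity)).mono ?_
    nlinarith
  have hFb : ExpBound len s F (4 * ε) := by
    rw [hF, add_mul, one_mul]
    refine (hMb.add (h.bound_inv.mul hl hs hMb ha) (by positivity) (by positivity)).mono ?_
    nlinarith
  have hF0 : F 0 = 0 := by
    have h1 : F = (1 + v) * E - (1 + v) * Crossed.of α r * (1 + u) := by
      rw [hF, hM]
      noncomm_ring
    rw [h1, Crossed.sub_apply, ← countertermMap_apply, hr, sub_self]
  have hwb := (hFb.div_small_divisor hl hK (fun n hn => (hφ n hn).2) hσ).mono hb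
  have hwt : ∑' n, ‖-((φ n : ℂ)⁻¹ • F n)‖ₑ ≠ ∞ :=
    ((hwb.tsum_enorm_le hl hs').trans_lt ENNReal.ofReal_lt_top).ne
  set w : Crossed α := Crossed.mk (fun n => -((φ n : ℂ)⁻¹ • F n)) hwt with hw
  replace hwb : ExpBound len (s - σ) w b := hwb
  have hwφ : ∀ n, (φ n : ℂ) • w n = (-F) n := by
    intro n
    rw [hw, Crossed.mk_apply, Crossed.neg_apply, smul_neg]
    by_cases hn : n = 0
    · rw [hn, hF0, smul_zero, smul_zero]
    · rw [smul_inv_smul₀]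
      exact_mod_cast (hφ n hn).1
  obtain ⟨y, hy1, hy2, hyb⟩ := hwb.exists_inverse hl hs' hb0 hb2
  have hub := h.bound.mono_exp hl (sub_le_self s hσ.le)
  have hvb := h.bound_inv.mono_exp hl (sub_le_self s hσ.le)
  have hMb' := hMb.mono_exp hl (sub_le_self s hσ.le)
  have hu1 : 1 + (u + (w + u * w)) = (1 + u) * (1 + w) := by noncomm_ring
  have hv1 : 1 + (v + (y + y * v)) = (1 + y) * (1 + v) := by noncomm_ring
  have hwu : ExpBound len (s - σ) (w + u * w : Crossed α) (b + a * b) :=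
    hwb.add (hub.mul hl hs' hwb ha) hb0 (by positivity)
  refine ⟨u + (w + u * w), v + (y + y * v), S + r, M * w, ⟨fun n => ?_, ?_, ?_, ?_, ?_, ?_⟩, ?_, ?_⟩
  · have hL := Crossed.derivation_mul φ h.eq hwφ n
    rw [Crossed.add_apply, Crossed.add_apply, smul_add, smul_add, hL, h.eq, hwφ,
      ← Crossed.add_apply, ← Crossed.add_apply, Crossed.of_add]
    congr 1
    have hMF : (1 + u) * F = M := by rw [hF, ← mul_assoc, h.inv_right, one_mul]
    set D := P - Crossed.of α S with hD
    have h1 : P - (Crossed.of α S + Crossed.of α r) = D - Crossed.of α r := by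
      rw [hD, sub_sub]
    have h2 : Crossed.of α r * (1 + u) = E - M := by rw [hM, sub_sub_cancel]
    rw [h1, hu1]
    calc _ = (E - D * (1 + u)) * (1 + w) - (1 + u) * F := by noncomm_ring
      _ = M * w - (D * (1 + u) - (E - M)) * (1 + w) := by
        rw [hMF]
        noncomm_ring
      _ = _ := by
        rw [← h2]
        noncomm_ring
  · rw [hu1, hv1]
    calc _ = (1 + u) * ((1 + w) * (1 + y)) * (1 + v) := by noncomm_ring
      _ = 1 := by rw [hy1, mul_one, h.inv_right]
  · rw [hu1, hv1]
    calc _ = (1 + y) * ((1 + v) * (1 + u)) * (1 + w) := by noncomm_ring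
      _ = 1 := by rw [h.inv_left, mul_one, hy2]
  · refine (hMb'.mul hl hs' hwb (by positivity)).mono ?_
    gcongr
    norm_num
  · refine (hub.add hwu ha (by positivity)).mono ?_
    nlinarith
  · refine (hvb.add (hyb.add (hyb.mul hl hs' hvb (by positivity)) (by positivity)
      (by positivity)) ha (by positivity)).mono ?_
    nlinarith
  · rw [sub_add_cancel_left, norm_neg]
    linarith
  · rw [sub_add_cancel_left, norm_neg]
    refine (hwu.norm_le hl hs' (by positivity)).trans ?_
    nlinarith

/-- The smallness constant of the iteration. -/
def newtonConst (K : ℝ) (τ : ℕ) (ρ : ℝ) : ℝ :=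
  4 ^ (τ + 1) * 48 * (4 * (K * τ.factorial * (2 / ρ) ^ τ))

theorem newton_arith {K : ℝ} {τ : ℕ} {ρ ε : ℝ} (hρ : 0 < ρ) (n : ℕ) :
    K * τ.factorial / (ρ / 2 ^ (n + 1)) ^ τ * (4 * (ε / (4 ^ τ) ^ n))
      = 4 * (K * τ.factorial * (2 / ρ) ^ τ) * ε / (2 ^ τ) ^ n := by
  have h4 : ((4 : ℝ) ^ τ) ^ n = (2 ^ τ) ^ n * (2 ^ τ) ^ n := by
    rw [← mul_pow, ← mul_pow]
    norm_num
  have h2 : ((2 : ℝ) ^ (n + 1)) ^ τ = (2 ^ τ) ^ n * 2 ^ τ := by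
    rw [← pow_mul, ← pow_mul, ← pow_add]
    ring_nf
  rw [div_pow, div_pow, h4, h2]
  field_simp

/-- **Conjugation to the diagonal with counterterms.** If `P` is small in a weighted norm, there
are `S` in the coefficient algebra and `u` small with `[φ, 1 + u] + (P - S) (1 + u) = 0`. -/
theorem exists_conjugation (hl : IsLength len) {K : ℝ} {τ : ℕ} (hK : 0 ≤ K) (hτ : 1 ≤ τ)
    (hφ : ∀ n, n ≠ 0 → φ n ≠ 0 ∧ |φ n|⁻¹ ≤ K * len n ^ τ) {ρ ε : ℝ} (hρ : 0 < ρ) (hε : 0 ≤ ε)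
    {P : Crossed α} (hP : ExpBound len ρ P ε) (hs : newtonConst K τ ρ * ε ≤ 1) :
    ∃ (u : Crossed α) (S : B), ‖S‖ ≤ 4 * ε ∧ ‖u‖ ≤ newtonConst K τ ρ * ε ∧
      ∀ n, (φ n : ℂ) • u n + ((P - Crossed.of α S) * (1 + u)) n = 0 := by
  set L1 : ℝ := 4 * (K * τ.factorial * (2 / ρ) ^ τ) with hL1
  have hL1n : 0 ≤ L1 := by positivity
  set β : ℝ := L1 * ε with hβ
  have hβ0 : 0 ≤ β := by positivity
  have h4τ : (1 : ℝ) ≤ 4 ^ τ := one_le_pow₀ (by norm_num)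
  have hβs : 4 ^ (τ + 1) * 48 * β ≤ 1 := by
    rw [newtonConst, mul_assoc] at hs
    exact hs
  have hβ1 : 4 * β * 4 ^ τ ≤ 1 / 48 := by
    rw [_root_.pow_succ] at hβs
    linarith
  have hβ2 : β ≤ 1 / 192 := by nlinarith
  set e : ℕ → ℝ := fun n => ε / (4 ^ τ) ^ n with he
  set s : ℕ → ℝ := fun n => ρ / 2 ^ n with hsdef
  set a : ℕ → ℝ := fun n => 6 * β * (1 - 1 / 2 ^ n) with hadef
  set b : ℕ → ℝ := fun n => β / 2 ^ n with hbdef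
  have hstep : ∀ (n : ℕ) (X : Crossed α × Crossed α × B × Crossed α),
      ApproxSolution len φ P (s n) (e n) (a n) X.1 X.2.1 X.2.2.1 X.2.2.2 →
      ∃ Y : Crossed α × Crossed α × B × Crossed α,
        ApproxSolution len φ P (s (n + 1)) (e (n + 1)) (a (n + 1)) Y.1 Y.2.1 Y.2.2.1 Y.2.2.2 ∧
        ‖X.2.2.1 - Y.2.2.1‖ ≤ 3 * e n ∧ ‖X.1 - Y.1‖ ≤ 2 * b n := by
    intro n X hX
    have hp2 : (1 : ℝ) ≤ 2 ^ n := one_le_pow₀ (by norm_num)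
    have hp2i : (1 : ℝ) / 2 ^ n ≤ 1 := (div_le_one (by positivity)).2 hp2
    have hpτ : (2 : ℝ) ^ n ≤ (2 ^ τ) ^ n := by
      refine pow_le_pow_left₀ (by norm_num) ?_ n
      exact le_self_pow₀ (by norm_num) (by omega)
    have hbn : b n ≤ β := div_le_self hβ0 hp2
    have hbn0 : 0 ≤ b n := by positivity
    have hen : 0 ≤ e n := by positivity
    have h1 : K * τ.factorial / (ρ / 2 ^ (n + 1)) ^ τ * (4 * e n) ≤ b n := by
      rw [he]
      simp only
      rw [newton_arith hρ, hbdef]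
      simp only
      rw [← hL1, ← hβ]
      gcongr
    obtain ⟨u', v', S', E', hY, h2, h3⟩ := hX.step hl hK hφ (σ := ρ / 2 ^ (n + 1)) (b := b n)
      (by positivity) (by
        rw [hsdef]
        simp only
        gcongr
        · norm_num
        · omega) hen (by
        rw [hadef]
        simp only
        have : 0 ≤ 1 - (1 : ℝ) / 2 ^ n := by linarith
        positivity) (by
        rw [hadef]
        simp only
        have : 0 ≤ (1 : ℝ) / 2 ^ n := by positivity
        nlinarith) h1 (by linarith)
    refine ⟨(u', v', S', E'), ?_, h2, h3⟩
    have hs1 : s n - ρ / 2 ^ (n + 1) = s (n + 1) := by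
      rw [hsdef]
      simp only
      rw [_root_.pow_succ]
      field_simp
      ring
    have ha1 : a n + 3 * b n = a (n + 1) := by
      rw [hadef, hbdef]
      simp only
      rw [_root_.pow_succ]
      field_simp
      ring
    have he1 : 4 * e n * b n ≤ e (n + 1) := by
      have : e (n + 1) = e n / 4 ^ τ := by
        rw [he]
        simp only
        rw [_root_.pow_succ, div_div]
      rw [this, le_div_iff₀ (by positivity)]
      calc 4 * e n * b n * 4 ^ τ ≤ 4 * e n * β * 4 ^ τ := by gcongr
        _ = e n * (4 * β * 4 ^ τ) := by ring
        _ ≤ e n * 1 := by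
          gcongr
          linarith
        _ = e n := mul_one _
    rw [hs1, ha1] at hY
    exact ⟨hY.eq, hY.inv_right, hY.inv_left, hY.bound_error.mono he1, hY.bound, hY.bound_inv⟩
  choose! Φ hΦ using hstep
  set X : ℕ → Crossed α × Crossed α × B × Crossed α :=
    fun n => Nat.rec (0, 0, 0, P) (fun n x => Φ n x) n with hXdef
  have hz : ∀ x : ℝ, ExpBound len x (0 : Crossed α) 0 := by
    intro x
    simp [ExpBound, expNorm, Crossed.zero_apply]
  have hX0 : ∀ n, ApproxSolution len φ P (s n) (e n) (a n)
      (X n).1 (X n).2.1 (X n).2.2.1 (X n).2.2.2 := by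
    intro n
    induction n with
    | zero =>
      have hs0 : s 0 = ρ := by simp [hsdef]
      have he0 : e 0 = ε := by simp [he]
      have ha0 : a 0 = 0 := by simp [hadef]
      have h0 : Crossed.of α (0 : B) = 0 := Crossed.ext fun n => by
        by_cases hn : n = 0
        · rw [hn, Crossed.of_zero_apply, Crossed.zero_apply]
        · rw [Crossed.of_apply_of_ne _ hn, Crossed.zero_apply]
      rw [hs0, he0, ha0]
      refine ⟨fun n => ?_, ?_, ?_, hP, hz ρ, hz ρ⟩
      · change (φ n : ℂ) • (0 : Crossed α) n = (P - (P - Crossed.of α 0) * (1 + 0)) n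
        rw [h0, sub_zero, add_zero, mul_one, sub_self, Crossed.zero_apply, smul_zero]
      · change (1 + (0 : Crossed α)) * (1 + 0) = 1
        rw [add_zero, mul_one]
      · change (1 + (0 : Crossed α)) * (1 + 0) = 1
        rw [add_zero, mul_one]
    | succ n ih => exact (hΦ n (X n) ih).1
  have hd1 : ∀ n, dist (X n).2.2.1 (X (n + 1)).2.2.1 ≤ 3 * ε * (1 / 4) ^ n := by
    intro n
    rw [dist_eq_norm]
    refine (hΦ n (X n) (hX0 n)).2.1.trans ?_
    have h1 : 3 * e n = 3 * ε * ((4 ^ τ) ^ n)⁻¹ := by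
      rw [he]
      ring
    rw [h1, one_div, inv_pow]
    gcongr
    exact le_self_pow₀ (by norm_num) (by omega)
  have hd2 : ∀ n, dist (X n).1 (X (n + 1)).1 ≤ 2 * β * (1 / 2) ^ n := by
    intro n
    rw [dist_eq_norm]
    refine (hΦ n (X n) (hX0 n)).2.2.trans_eq ?_
    rw [hbdef, one_div, inv_pow]
    ring
  obtain ⟨S, hS⟩ := cauchySeq_tendsto_of_complete
    (cauchySeq_of_le_geometric _ _ (by norm_num) hd1)
  obtain ⟨u, hu⟩ := cauchySeq_tendsto_of_complete
    (cauchySeq_of_le_geometric _ _ (by norm_num) hd2)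
  refine ⟨u, S, ?_, ?_, fun n => ?_⟩
  · have h1 := dist_le_of_le_geometric_of_tendsto₀ _ _ (by norm_num) hd1 hS
    have h2 : dist (X 0).2.2.1 S = ‖S‖ := dist_zero_left S
    have h3 : 3 * ε / (1 - 1 / 4) = 4 * ε := by ring
    rwa [h2, h3] at h1
  · have h1 := dist_le_of_le_geometric_of_tendsto₀ _ _ (by norm_num) hd2 hu
    have h2 : dist (X 0).1 u = ‖u‖ := dist_zero_left u
    rw [h2] at h1
    have h3 : newtonConst K τ ρ * ε = 4 ^ (τ + 1) * 48 * β := by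
      rw [newtonConst, mul_assoc]
    have h5 : (1 : ℝ) ≤ 4 ^ (τ + 1) := one_le_pow₀ (by norm_num)
    have h6 : 2 * β / (1 - 1 / 2) = 4 * β := by ring
    rw [h6] at h1
    rw [h3]
    nlinarith
  · have hE : Tendsto (fun m => (X m).2.2.2) atTop (𝓝 0) := by
      rw [tendsto_zero_iff_norm_tendsto_zero]
      refine squeeze_zero (fun _ => norm_nonneg _) (fun m =>
        ((hX0 m).bound_error.norm_le hl (by positivity) (by positivity)).trans
        (le_of_eq (div_eq_mul_inv _ _))) ?_
      rw [← mul_zero ε]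
      refine Tendsto.const_mul ε ?_
      simp only [← inv_pow]
      refine tendsto_pow_atTop_nhds_zero_of_lt_one (by positivity) ?_
      rw [inv_pow]
      refine inv_lt_one_of_one_lt₀ (one_lt_pow₀ (a := (4 : ℝ)) (by norm_num) (Nat.one_le_iff_ne_zero.1 hτ))
    have hev : ∀ {f : ℕ → Crossed α} {l : Crossed α}, Tendsto f atTop (𝓝 l) →
        Tendsto (fun m => f m n) atTop (𝓝 (l n)) := fun hf =>
      ((Crossed.evalCLM α n).continuous.tendsto _).comp hf
    have hl1 := (hev hu).const_smul (φ n : ℂ)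
    have hl2 := hev (hE.sub ((tendsto_const_nhds (x := P)).sub
      ((Crossed.continuous_of.tendsto S).comp hS) |>.mul
        ((tendsto_const_nhds (x := (1 : Crossed α))).add hu)))
    have hl3 := tendsto_nhds_unique hl1 (hl2.congr fun m => ((hX0 m).eq n).symm)
    rw [hl3, ← Crossed.add_apply, zero_sub, neg_add_cancel, Crossed.zero_apply]

end TorusKAM

namespace TorusKAM

/-! ### Hermitian matrices with summable off-diagonal decay -/

/-- The entries of `M` are dominated by a summable function of the difference of the indices. -/
structure SummableDecay {G : Type*} [AddCommGroup G] (M : G → G → ℂ) (m : G → ℝ) : Prop where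
  summable : Summable m
  le : ∀ j i, ‖M j i‖ ≤ m (j - i)

section Decay

variable {G : Type*} [AddCommGroup G] {M : G → G → ℂ} {m : G → ℝ}

theorem SummableDecay.nonneg (h : SummableDecay M m) (n : G) : 0 ≤ m n := by
  have := (norm_nonneg _).trans (h.le n 0)
  rwa [sub_zero] at this

theorem SummableDecay.summable_row (h : SummableDecay M m) (j : G) : Summable fun i => m (j - i) :=
  (Equiv.subLeft j).summable_iff.2 h.summable

theorem SummableDecay.summable_column (h : SummableDecay M m) (i : G) :
    Summable fun j => m (j - i) :=
  (Equiv.subRight i).summable_iff.2 h.summable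

theorem tsum_sub_left (m : G → ℝ) (j : G) :
    ∑' i, m (j - i) = ∑' n, m n := (Equiv.subLeft j).tsum_eq m

theorem SummableDecay.summable_mul_bounded (h : SummableDecay M m) {y : G → ℂ} {C : ℝ}
    (hy : ∀ i, ‖y i‖ ≤ C) (j : G) : Summable fun i => M j i * y i := by
  refine Summable.of_norm_bounded ((h.summable_row j).mul_right C) fun i => ?_
  rw [norm_mul]
  exact mul_le_mul (h.le j i) (hy i) (norm_nonneg _) (h.nonneg _)

theorem SummableDecay.norm_tsum_le (h : SummableDecay M m) {y : G → ℂ} {C : ℝ}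
    (hy : ∀ i, ‖y i‖ ≤ C) (j : G) : ‖∑' i, M j i * y i‖ ≤ (∑' n, m n) * C := by
  rw [← tsum_sub_left m j, ← tsum_mul_right]
  refine tsum_of_norm_bounded ((h.summable_row j).mul_right C).hasSum fun i => ?_
  rw [norm_mul]
  exact mul_le_mul (h.le j i) (hy i) (norm_nonneg _) (h.nonneg _)

theorem SummableDecay.summable_pair (h : SummableDecay M m) {x y : G → ℂ} {C : ℝ}
    (hx : Summable fun i => ‖x i‖) (hy : ∀ i, ‖y i‖ ≤ C) :
    Summable fun p : G × G => ‖x p.1‖ * m (p.1 - p.2) * C := by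
  have hC : 0 ≤ C := (norm_nonneg _).trans (hy 0)
  have h1 : Summable fun p : G × G => ‖x p.1‖ * m p.2 :=
    hx.mul_of_nonneg h.summable (fun _ => norm_nonneg _) h.nonneg
  let e : G × G ≃ G × G := Equiv.prodShear (Equiv.refl G) fun j => Equiv.subLeft j
  exact (e.summable_iff.2 h1).mul_right C

theorem SummableDecay.tsum_conj_mul (h : SummableDecay M m) (hM : ∀ i j, conj (M i j) = M j i)
    {x y : G → ℂ} {C : ℝ} (hx : Summable fun i => ‖x i‖) (hy : ∀ i, ‖y i‖ ≤ C) :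
    ∑' j, conj (∑' i, M j i * x i) * y j = ∑' j, conj (x j) * ∑' i, M j i * y i := by
  have hxb : ∃ C', ∀ i, ‖x i‖ ≤ C' := ⟨∑' i, ‖x i‖, fun i =>
    hx.le_tsum i fun _ _ => norm_nonneg _⟩
  obtain ⟨C', hC'⟩ := hxb
  have hs : Summable (Function.uncurry fun j i => conj (x j) * (M j i * y i)) := by
    refine Summable.of_norm_bounded (h.summable_pair hx hy) fun p => ?_
    rw [Function.uncurry, norm_mul, norm_mul, RCLike.norm_conj, mul_assoc]
    gcongr
    · exact (norm_nonneg _).trans (h.le _ _)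
    · exact h.le _ _
    · exact hy _
  have hr : ∀ j, conj (x j) * ∑' i, M j i * y i = ∑' i, conj (x j) * (M j i * y i) := fun j =>
    ((h.summable_mul_bounded hy j).tsum_mul_left _).symm
  have hl : ∀ j, conj (∑' i, M j i * x i) * y j = ∑' i, conj (x i) * (M i j * y j) := by
    intro j
    have h1 := (h.summable_mul_bounded hC' j)
    rw [Complex.conj_tsum, ← Summable.tsum_mul_right]
    · refine tsum_congr fun i => ?_
      rw [map_mul, hM]
      ring
    · exact h1.map (starRingEnd ℂ) Complex.continuous_conj
  simp only [hr, hl]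
  exact hs.tsum_comm

/-- The matrix `U` is close to the identity and its columns are eigenvectors of the Hermitian
matrix `D + M`, with the eigenvalues of the diagonal matrix `D`. -/
structure DiagonalizingMatrix [DecidableEq G] (D : G → ℝ) (M U : G → G → ℂ) (m μ : G → ℝ) :
    Prop where
  hermitian : ∀ i j, conj (M i j) = M j i
  decay : SummableDecay M m
  near_one : SummableDecay (fun j k => U j k - if j = k then 1 else 0) μ
  small : ∑' n, μ n ≤ 1 / 8
  eigen : ∀ j k, D j * U j k + ∑' i, M j i * U i k = D k * U j k

theorem summable_norm_column [DecidableEq G] {U : G → G → ℂ} {μ : G → ℝ}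
    (h : SummableDecay (fun j k => U j k - if j = k then 1 else 0) μ) (k : G) :
    Summable fun j => ‖U j k‖ := by
  have h1 : Summable fun j => if j = k then (1 : ℝ) else 0 := by
    refine summable_of_ne_finset_zero (s := {k}) fun j hj => if_neg (by simpa using hj)
  refine Summable.of_nonneg_of_le (fun _ => norm_nonneg _) (fun j => ?_)
    ((h.summable_column k).add h1)
  have h2 := norm_add_le (U j k - if j = k then 1 else 0) (if j = k then 1 else 0)
  rw [sub_add_cancel] at h2
  refine h2.trans (add_le_add (h.le j k) ?_)
  split_ifs <;> simp

theorem norm_column_le [DecidableEq G] {U : G → G → ℂ} {μ : G → ℝ}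
    (h : SummableDecay (fun j k => U j k - if j = k then 1 else 0) μ)
    (hs : ∑' n, μ n ≤ 1 / 8) (j k : G) : ‖U j k‖ ≤ 9 / 8 := by
  have h2 := norm_add_le (U j k - if j = k then 1 else 0) (if j = k then 1 else 0)
  rw [sub_add_cancel] at h2
  have h3 : ‖(if j = k then 1 else 0 : ℂ)‖ ≤ 1 := by split_ifs <;> simp
  have h4 := (h.le j k).trans (h.summable.le_tsum (j - k) fun _ _ => h.nonneg _)
  linarith

/-- A bounded vector orthogonal to all columns of a matrix close to the identity vanishes. -/
theorem eq_zero_of_orthogonal_columns [DecidableEq G] {U : G → G → ℂ} {μ : G → ℝ}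
    (h : SummableDecay (fun j k => U j k - if j = k then 1 else 0) μ)
    (hs : ∑' n, μ n ≤ 1 / 8) {c : G → ℂ} {C : ℝ} (hc : ∀ i, ‖c i‖ ≤ C)
    (h0 : ∀ k, ∑' j, conj (U j k) * c j = 0) : c = 0 := by
  have hbdd : BddAbove (Set.range fun i => ‖c i‖) := ⟨C, by rintro _ ⟨i, rfl⟩; exact hc i⟩
  set B := ⨆ i, ‖c i‖ with hB
  have hcB : ∀ i, ‖c i‖ ≤ B := fun i => le_ciSup hbdd i
  have hB0 : 0 ≤ B := (norm_nonneg _).trans (hcB 0)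
  have key : ∀ k, ‖c k‖ ≤ 1 / 8 * B := by
    intro k
    have hs1 : Summable fun j => conj (U j k - if j = k then 1 else 0) * c j := by
      refine Summable.of_norm_bounded ((h.summable_column k).mul_right B) fun j => ?_
      rw [norm_mul, RCLike.norm_conj]
      exact mul_le_mul (h.le j k) (hcB j) (norm_nonneg _) (h.nonneg _)
    have hs2 : HasSum (fun j => conj (if j = k then 1 else 0 : ℂ) * c j) (c k) := by
      have := hasSum_single (f := fun j => conj (if j = k then 1 else 0 : ℂ) * c j) k
        fun j hj => by simp [hj]
      simpa using this
    have h1 : ∑' j, conj (U j k) * c j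
        = ∑' j, conj (U j k - if j = k then 1 else 0) * c j + c k := by
      rw [← hs2.tsum_eq, ← hs1.tsum_add hs2.summable]
      refine tsum_congr fun j => ?_
      rw [← add_mul, ← map_add, sub_add_cancel]
    rw [h0, eq_comm, add_eq_zero_iff_neg_eq] at h1
    rw [← h1, norm_neg]
    calc _ ≤ ∑' j, μ (j - k) * B := by
          refine tsum_of_norm_bounded ((h.summable_column k).mul_right B).hasSum fun j => ?_
          rw [norm_mul, RCLike.norm_conj]
          exact mul_le_mul (h.le j k) (hcB j) (norm_nonneg _) (h.nonneg _)
      _ = (∑' n, μ n) * B := by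
          rw [tsum_mul_right]
          congr 1
          exact (Equiv.subRight k).tsum_eq μ
      _ ≤ _ := by gcongr
  have hBle : B ≤ 1 / 8 * B := ciSup_le key
  have hB00 : B = 0 := by linarith
  funext i
  have := hcB i
  rw [hB00] at this
  exact norm_le_zero_iff.1 this

theorem DiagonalizingMatrix.orthogonal [DecidableEq G] {D : G → ℝ} {U : G → G → ℂ} {μ : G → ℝ}
    (h : DiagonalizingMatrix D M U m μ) {c : G → ℂ} {C : ℝ} (hc : ∀ i, ‖c i‖ ≤ C) {z : ℂ}
    (hz : ∀ j, D j * c j + ∑' i, M j i * c i = z * c j) (k : G) :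
    (D k - z) * ∑' j, conj (U j k) * c j = 0 := by
  have hU := summable_norm_column h.near_one k
  have h1 := h.decay.tsum_conj_mul h.hermitian hU hc
  have hUc : Summable fun j => conj (U j k) * c j := by
    refine Summable.of_norm_bounded (hU.mul_right C) fun j => ?_
    rw [norm_mul, RCLike.norm_conj]
    gcongr
    exact hc j
  have hr : Summable fun j => conj (U j k) * ∑' i, M j i * c i := by
    refine Summable.of_norm_bounded (hU.mul_right ((∑' n, m n) * C)) fun j => ?_
    rw [norm_mul, RCLike.norm_conj]
    gcongr
    exact h.decay.norm_tsum_le hc j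
  have hterm : ∀ j, conj (∑' i, M j i * U i k) * c j
      = (D k - z) * (conj (U j k) * c j) + conj (U j k) * ∑' i, M j i * c i := by
    intro j
    have e1 : ∑' i, M j i * U i k = D k * U j k - D j * U j k := by
      rw [← h.eigen j k]
      ring
    have e2 : ∑' i, M j i * c i = z * c j - D j * c j := by
      rw [← hz j]
      ring
    rw [e1, e2, map_sub, map_mul, map_mul, Complex.conj_ofReal, Complex.conj_ofReal]
    ring
  simp only [hterm] at h1
  rw [(hUc.mul_left _).tsum_add hr, hUc.tsum_mul_left] at h1
  simpa using h1

theorem DiagonalizingMatrix.eq_smul_column [DecidableEq G] {D : G → ℝ} {U : G → G → ℂ}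
    {μ : G → ℝ} (h : DiagonalizingMatrix D M U m μ) (hD : Function.Injective D)
    {c : G → ℂ} {C : ℝ} (hc : ∀ i, ‖c i‖ ≤ C) (hc0 : c ≠ 0) {z : ℂ}
    (hz : ∀ j, D j * c j + ∑' i, M j i * c i = z * c j) :
    ∃ (k : G) (a : ℂ), z = D k ∧ ∀ j, c j = a * U j k := by
  obtain ⟨k, hk⟩ : ∃ k, z = D k := by
    by_contra! hne
    refine hc0 (eq_zero_of_orthogonal_columns h.near_one h.small hc fun k => ?_)
    exact (mul_eq_zero.1 (h.orthogonal hc hz k)).resolve_left (sub_ne_zero.2 (hne k).symm)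
  have hU := summable_norm_column h.near_one k
  have hUb := fun j => norm_column_le h.near_one h.small j k
  have horth : ∀ (c' : G → ℂ) (C' : ℝ), (∀ i, ‖c' i‖ ≤ C') →
      (∀ j, D j * c' j + ∑' i, M j i * c' i = z * c' j) → ∀ l, l ≠ k →
      ∑' j, conj (U j l) * c' j = 0 := by
    intro c' C' hc' hz' l hl
    refine (mul_eq_zero.1 (h.orthogonal hc' hz' l)).resolve_left (sub_ne_zero.2 ?_)
    rw [hk]
    exact fun he => hl (hD (Complex.ofReal_injective he))
  set N : ℂ := ∑' j, conj (U j k) * U j k with hN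
  have hsum : ∀ (c' : G → ℂ) (C' : ℝ), (∀ i, ‖c' i‖ ≤ C') →
      ∀ l, Summable fun j => conj (U j l) * c' j := by
    intro c' C' hc' l
    refine Summable.of_norm_bounded ((summable_norm_column h.near_one l).mul_right C') fun j => ?_
    rw [norm_mul, RCLike.norm_conj]
    gcongr
    exact hc' j
  have hN0 : N ≠ 0 := by
    intro hN0
    have h1 : (fun j => U j k) = 0 := by
      refine eq_zero_of_orthogonal_columns h.near_one h.small hUb fun l => ?_
      by_cases hl : l = k
      · rw [hl, ← hN, hN0]
      · exact horth _ _ hUb (fun j => by rw [hk, h.eigen]) l hl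
    have h2 := h.near_one.le k k
    have h3 := h.near_one.summable.le_tsum (k - k) fun _ _ => h.near_one.nonneg _
    have h4 : U k k = 0 := congrFun h1 k
    rw [h4, if_pos rfl, zero_sub, norm_neg, norm_one] at h2
    linarith [h.small]
  set t : ℂ := (∑' j, conj (U j k) * c j) / N with ht
  have hfin : (fun j => c j - t * U j k) = 0 := by
    refine eq_zero_of_orthogonal_columns h.near_one h.small (C := C + ‖t‖ * (9 / 8))
      (fun j => ?_) fun l => ?_
    · refine (norm_sub_le _ _).trans (add_le_add (hc j) ?_)
      rw [norm_mul]
      gcongr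
      exact hUb j
    · have e1 : ∀ j, conj (U j l) * (c j - t * U j k)
          = conj (U j l) * c j - t * (conj (U j l) * U j k) := fun j => by ring
      simp only [e1]
      rw [(hsum c C hc l).tsum_sub ((hsum _ _ hUb l).mul_left t), (hsum _ _ hUb l).tsum_mul_left]
      by_cases hl : l = k
      · rw [hl, ← hN, ht, div_mul_cancel₀ _ hN0, sub_self]
      · rw [horth c C hc hz l hl, horth _ _ hUb (fun j => by rw [hk, h.eigen]) l hl, mul_zero,
          sub_zero]
  exact ⟨k, t, hk, fun j => sub_eq_zero.1 (congrFun hfin j)⟩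

/-- If the columns of a matrix close to the identity are eigenvectors of `D + M - diag s` with real
eigenvalues, where `M` is Hermitian and `D` real diagonal, then `s` is real. -/
theorem im_eq_zero_of_eigen [DecidableEq G] {D : G → ℝ} {U : G → G → ℂ} {μ : G → ℝ}
    (hM : ∀ i j, conj (M i j) = M j i) (hm : SummableDecay M m)
    (h : SummableDecay (fun j k => U j k - if j = k then 1 else 0) μ) (hs : ∑' n, μ n ≤ 1 / 8)
    {s : G → ℂ} {C : ℝ} (hC : ∀ j, ‖s j‖ ≤ C)
    (he : ∀ j k, D j * U j k + ∑' i, M j i * U i k - s j * U j k = D k * U j k) (j : G) :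
    (s j).im = 0 := by
  have hbdd : BddAbove (Set.range fun i => |(s i).im|) :=
    ⟨C, by rintro _ ⟨i, rfl⟩; exact (Complex.abs_im_le_norm _).trans (hC i)⟩
  set B := ⨆ i, |(s i).im| with hB
  have hsB : ∀ i, |(s i).im| ≤ B := fun i => le_ciSup hbdd i
  have hB0 : 0 ≤ B := (abs_nonneg _).trans (hsB 0)
  have key : ∀ k, |(s k).im| ≤ 1 / 2 * B := by
    intro k
    have hU := summable_norm_column h k
    have hUb := fun j => norm_column_le h hs j k
    have h1 := hm.tsum_conj_mul hM hU hUb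
    set f : G → ℂ := fun j => conj (U j k) * ∑' i, M j i * U i k with hf
    have hfs : Summable f := by
      refine Summable.of_norm_bounded (hU.mul_right ((∑' n, m n) * (9 / 8))) fun j => ?_
      rw [hf, norm_mul, RCLike.norm_conj]
      gcongr
      exact hm.norm_tsum_le hUb j
    have h2 : conj (∑' j, f j) = ∑' j, f j := by
      rw [Complex.conj_tsum, ← h1]
      refine tsum_congr fun j => ?_
      rw [hf, map_mul, Complex.conj_conj, mul_comm]
    have h3 : ∑' j, (f j).im = 0 := by
      rw [← Complex.im_tsum hfs]
      exact Complex.conj_eq_iff_im.1 h2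
    have h4 : ∀ j, (f j).im = (s j).im * ‖U j k‖ ^ 2 := by
      intro j
      have e1 : ∑' i, M j i * U i k = ((D k - D j : ℝ) + s j) * U j k := by
        push_cast
        rw [sub_add_eq_add_sub, ← sub_eq_zero]
        have := he j k
        rw [← sub_eq_zero] at this
        rw [← this]
        ring
      have e2 : f j = ((D k - D j : ℝ) + s j) * ((‖U j k‖ ^ 2 : ℝ) : ℂ) := by
        rw [hf]
        simp only
        rw [e1, ← Complex.normSq_eq_norm_sq, Complex.normSq_eq_conj_mul_self]
        ring
      rw [e2, Complex.im_mul_ofReal, Complex.add_im, Complex.ofReal_im, zero_add]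
    simp only [h4] at h3
    have hsm : Summable fun j => (s j).im * ‖U j k‖ ^ 2 := by
      have := (Complex.hasSum_im hfs.hasSum).summable
      simpa only [h4] using this
    have h5 : ∑' j, (s j).im * ‖U j k‖ ^ 2
        = (s k).im * ‖U k k‖ ^ 2 + ∑' j, if j = k then 0 else (s j).im * ‖U j k‖ ^ 2 :=
      hsm.tsum_eq_add_tsum_ite k
    have h6 : ‖∑' j, if j = k then 0 else (s j).im * ‖U j k‖ ^ 2‖ ≤ B * (1 / 8) * (1 / 8) := by
      calc _ ≤ ∑' j, B * (1 / 8) * μ (j - k) := by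
            refine tsum_of_norm_bounded ((h.summable_column k).mul_left _).hasSum fun j => ?_
            split_ifs with hj
            · rw [norm_zero]
              exact mul_nonneg (by positivity) (h.nonneg _)
            · have e1 := h.le j k
              rw [if_neg hj, sub_zero] at e1
              have e2 := h.summable.le_tsum (j - k) fun _ _ => h.nonneg _
              rw [norm_mul, Real.norm_eq_abs, norm_pow, norm_norm, sq, mul_assoc]
              refine mul_le_mul (hsB j) ?_ (by positivity) hB0
              exact mul_le_mul (by linarith) e1 (norm_nonneg _) (by norm_num)
        _ = B * (1 / 8) * ∑' n, μ n := by
            rw [tsum_mul_left]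
            congr 1
            exact (Equiv.subRight k).tsum_eq μ
        _ ≤ _ := by gcongr
    rw [h3, eq_comm, add_eq_zero_iff_neg_eq] at h5
    rw [← h5, norm_neg, Real.norm_eq_abs, abs_mul, abs_of_nonneg (sq_nonneg ‖U k k‖)] at h6
    have h7 : 7 / 8 ≤ ‖U k k‖ := by
      have e1 := h.le k k
      have e2 := h.summable.le_tsum (k - k) fun _ _ => h.nonneg _
      rw [if_pos rfl] at e1
      have e3 := norm_sub_norm_le (1 : ℂ) (1 - U k k)
      rw [sub_sub_cancel, norm_one, norm_sub_rev] at e3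
      linarith
    have h8 : 49 / 64 ≤ ‖U k k‖ ^ 2 := by nlinarith
    nlinarith [abs_nonneg (s k).im]
  have hBle : B ≤ 1 / 2 * B := ciSup_le key
  have := hsB j
  rw [← abs_nonpos_iff]
  linarith

end Decay

end TorusKAM

namespace TorusKAM

variable {d : ℕ}

/-! ### Symbols and their matrices -/

theorem isOpenQuotientMap_lift (d : ℕ) : IsOpenQuotientMap
    fun p : E d × E d => ((fun i => (p.1 i : AddCircle (2 * π)), p.2) : Phase d) := by
  have h1 : IsOpenQuotientMap fun x : E d => (fun i => (x i : AddCircle (2 * π)) : Torus d) :=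
    (IsOpenQuotientMap.piMap fun _ : Fin d => QuotientAddGroup.isOpenQuotientMap_mk
      (N := AddSubgroup.zmultiples (2 * π))).comp
      (PiLp.homeomorph 2 fun _ : Fin d => ℝ).isOpenQuotientMap
  exact h1.prodMap IsOpenQuotientMap.id

theorem SmoothSymbol.continuous {F : Type*} [NormedAddCommGroup F] [NormedSpace ℝ F]
    {a : Phase d → F} (ha : SmoothSymbol a) : Continuous a :=
  (isOpenQuotientMap_lift d).continuous_comp_iff.1 (ContDiff.continuous (𝕜 := ℝ) ha)

theorem norm_char (k : Freq d) (x : Torus d) : ‖char k x‖ = 1 := by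
  change ‖∏ i, fourier (k i) (x i)‖ = 1
  rw [norm_prod]
  exact Finset.prod_eq_one fun i _ => Circle.norm_coe _

theorem sqrt_two_pi_pow_ne_zero (d : ℕ) : ((√(2 * π) : ℝ) : ℂ) ^ d ≠ 0 :=
  pow_ne_zero _ (by exact_mod_cast (Real.sqrt_pos.mpr Real.two_pi_pos).ne')

theorem sqrt_two_pi_pow_mul_self (d : ℕ) :
    ((√(2 * π) : ℝ) : ℂ) ^ d * ((√(2 * π) : ℝ) : ℂ) ^ d = (((2 * π) ^ d : ℝ) : ℂ) := by
  rw [← mul_pow, ← Complex.ofReal_mul, Real.mul_self_sqrt Real.two_pi_pos.le]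
  push_cast
  rfl

theorem integrable_symbol_mul_char {a : Phase d → ℂ} (ha : Continuous a) (k : Freq d) (ξ : E d) :
    Integrable fun x : Torus d => a (x, ξ) * conj (char k x) := by
  refine Continuous.integrable_of_hasCompactSupport ?_ (HasCompactSupport.of_compactSpace _)
  exact (ha.comp (by fun_prop)).mul (Complex.continuous_conj.comp (char k).continuous)

theorem symbolCoeff_sub {a b : Phase d → ℂ} (ha : Continuous a) (hb : Continuous b) (k : Freq d)
    (ξ : E d) : symbolCoeff (fun p => a p - b p) k ξ = symbolCoeff a k ξ - symbolCoeff b k ξ := by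
  rw [symbolCoeff, symbolCoeff, symbolCoeff, ← mul_sub,
    ← integral_sub (integrable_symbol_mul_char ha k ξ) (integrable_symbol_mul_char hb k ξ)]
  simp only [sub_mul]

theorem conj_symbolCoeff (a : Phase d → ℝ) (k : Freq d) (ξ : E d) :
    conj (symbolCoeff (fun p => (a p : ℂ)) k ξ) = symbolCoeff (fun p => (a p : ℂ)) (-k) ξ := by
  rw [symbolCoeff, symbolCoeff, map_mul, map_inv₀, map_pow, Complex.conj_ofReal, ← integral_conj]
  simp only [map_mul, Complex.conj_ofReal, char_neg]

theorem weylMatrix_sub {a b : Phase d → ℂ} (ha : Continuous a) (hb : Continuous b) (ħ : ℝ)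
    (j k : Freq d) :
    weylMatrix ħ (fun p => a p - b p) j k = weylMatrix ħ a j k - weylMatrix ħ b j k := by
  rw [weylMatrix, symbolCoeff_sub ha hb, mul_sub]
  rfl

theorem conj_weylMatrix (ħ : ℝ) (a : Phase d → ℝ) (j k : Freq d) :
    conj (weylMatrix ħ (fun p => (a p : ℂ)) j k) = weylMatrix ħ (fun p => (a p : ℂ)) k j := by
  rw [weylMatrix, weylMatrix, map_mul, map_inv₀, map_pow, Complex.conj_ofReal, conj_symbolCoeff,
    neg_sub, add_comm k j]

theorem half_smul_intVec_add_self (ħ : ℝ) (k : Freq d) :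
    (ħ / 2) • intVec (k + k) = ħ • intVec k := by
  ext i
  simp only [intVec, PiLp.smul_apply, smul_eq_mul, Pi.add_apply]
  push_cast
  ring

theorem weylMatrix_fiber (ħ : ℝ) (f : E d → ℂ) (j k : Freq d) :
    weylMatrix ħ (fun p => f p.2) j k = if j = k then f (ħ • intVec k) else 0 := by
  rw [weylMatrix, symbolCoeff]
  simp only [integral_const_mul]
  simp only [← char_neg, integral_char, neg_eq_zero, sub_eq_zero]
  split_ifs with h
  · subst h
    rw [half_smul_intVec_add_self, ← sqrt_two_pi_pow_mul_self]
    have := sqrt_two_pi_pow_ne_zero d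
    field_simp
  · simp

theorem summable_diagonal_mul (D c : Freq d → ℂ) (j : Freq d) :
    Summable fun k => (if j = k then D k else 0) * c k := by
  refine summable_of_ne_finset_zero (s := {j}) fun k hk => ?_
  rw [if_neg (fun h => hk (by simp [h])), zero_mul]

theorem tsum_diagonal_mul (D c : Freq d → ℂ) (j : Freq d) :
    ∑' k, (if j = k then D k else 0) * c k = D j * c j := by
  rw [tsum_eq_single j]
  · rw [if_pos rfl]
  · intro k hk
    rw [if_neg hk.symm, zero_mul]

theorem matApply_diagonal {D : Freq d → ℂ} (ψ : L2T d) (j : Freq d) :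
    matApply (fun j k => if j = k then D k else 0) ψ j = D j * (torusBasis d).repr ψ j :=
  tsum_diagonal_mul _ _ j

/-! ### Eigenvalue equations in terms of Fourier coefficients -/

theorem repr_matOp (m : Freq d → Freq d → ℂ) (ψ : (matOp m).domain) (j : Freq d) :
    (torusBasis d).repr (matOp m ψ) j = matApply m ψ j := by
  change (torusBasis d).repr ((torusBasis d).repr.symm ⟨matApply m (ψ : L2T d), ψ.2.2⟩) j = _
  rw [LinearIsometryEquiv.apply_symm_apply]

theorem repr_ext {φ ψ : L2T d} (h : ∀ j, (torusBasis d).repr φ j = (torusBasis d).repr ψ j) :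
    φ = ψ :=
  (torusBasis d).repr.injective (lp.ext (funext h))

theorem eigenEq_matOp_iff {m : Freq d → Freq d → ℂ} {z : ℂ} {ψ : L2T d} :
    EigenEq (matOp m) z ψ ↔ ψ ∈ matDomain m ∧
      ∀ j, matApply m ψ j = z * (torusBasis d).repr ψ j := by
  constructor
  · rintro ⟨h, he⟩
    refine ⟨h, fun j => ?_⟩
    rw [← repr_matOp m ⟨ψ, h⟩, he, map_smul]
    rfl
  · rintro ⟨h, he⟩
    refine ⟨h, repr_ext fun j => ?_⟩
    rw [repr_matOp, he, map_smul]
    rfl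

theorem eigenEq_add_smul_iff {m m' : Freq d → Freq d → ℂ} {c z : ℂ} {ψ : L2T d} :
    EigenEq (matOp m + c • matOp m') z ψ ↔ ψ ∈ matDomain m ∧ ψ ∈ matDomain m' ∧
      ∀ j, matApply m ψ j + c * matApply m' ψ j = z * (torusBasis d).repr ψ j := by
  have key : ∀ (h : ψ ∈ matDomain m) (h' : ψ ∈ matDomain m') j,
      (torusBasis d).repr ((matOp m + c • matOp m') ⟨ψ, h, h'⟩) j
        = matApply m ψ j + c * matApply m' ψ j := by
    intro h h' j
    rw [LinearPMap.add_apply, LinearPMap.smul_apply, map_add, map_smul]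
    exact congrArg₂ (fun a b => a + c * b) (repr_matOp m ⟨ψ, h⟩ j) (repr_matOp m' ⟨ψ, h'⟩ j)
  constructor
  · rintro ⟨h, he⟩
    refine ⟨h.1, h.2, fun j => ?_⟩
    rw [← key h.1 h.2, he, map_smul]
    rfl
  · rintro ⟨h, h', he⟩
    refine ⟨⟨h, h'⟩, repr_ext fun j => ?_⟩
    rw [key h h', he, map_smul]
    rfl

theorem memℓp_two_of_summable {c : Freq d → ℂ} (h : Summable fun j => ‖c j‖) : Memℓp c 2 := by
  refine Memℓp.of_exponent_ge (q := 1) (memℓp_gen ?_) (by norm_num)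
  simpa using h

theorem exists_repr_eq {c : Freq d → ℂ} (h : Summable fun j => ‖c j‖) :
    ∃ ψ : L2T d, ∀ j, (torusBasis d).repr ψ j = c j :=
  ⟨(torusBasis d).repr.symm ⟨c, memℓp_two_of_summable h⟩, fun j => by
    rw [LinearIsometryEquiv.apply_symm_apply]⟩

theorem norm_repr_le (ψ : L2T d) (j : Freq d) : ‖(torusBasis d).repr ψ j‖ ≤ ‖ψ‖ := by
  rw [← (torusBasis d).repr.norm_map ψ]
  exact lp.norm_apply_le_norm (by norm_num) _ j

theorem SummableDecay.summable_norm_tsum {M : Freq d → Freq d → ℂ} {m : Freq d → ℝ}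
    (h : SummableDecay M m) {c : Freq d → ℂ} (hc : Summable fun j => ‖c j‖) :
    Summable fun j => ‖∑' i, M j i * c i‖ := by
  have h1 : Summable fun p : Freq d × Freq d => m (p.1 - p.2) * ‖c p.2‖ := by
    have h2 : Summable fun p : Freq d × Freq d => m p.1 * ‖c p.2‖ :=
      h.summable.mul_of_nonneg hc h.nonneg fun _ => norm_nonneg _
    let e : Freq d × Freq d ≃ Freq d × Freq d :=
      { toFun := fun p => (p.1 - p.2, p.2)
        invFun := fun p => (p.1 + p.2, p.2)
        left_inv := fun p => by simp
        right_inv := fun p => by simp }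
    exact e.summable_iff.2 h2
  refine Summable.of_nonneg_of_le (fun _ => norm_nonneg _) (fun j => ?_) h1.prod
  refine tsum_of_norm_bounded (h1.prod_factor j).hasSum fun i => ?_
  rw [norm_mul]
  exact mul_le_mul_of_nonneg_right (h.le j i) (norm_nonneg _)

/-- The eigenvalues of `A` are the numbers `D k`, and the eigenspaces are spanned by the functions
whose Fourier coefficients are the columns of the matrix `U`, which is `κ`-close to the
identity. -/
structure Diagonalized (A : L2T d →ₗ.[ℂ] L2T d) (D : Freq d → ℝ) (κ : ℝ)
    (U : Freq d → Freq d → ℂ) (μ : Freq d → ℝ) : Prop where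
  near_one : SummableDecay (fun j k => U j k - if j = k then 1 else 0) μ
  le : ∑' n, μ n ≤ κ
  eigen : ∀ k ψ, (∀ j, (torusBasis d).repr ψ j = U j k) → EigenEq A (D k : ℂ) ψ
  unique : ∀ z ψ, ψ ≠ 0 → EigenEq A z ψ →
    ∃ k a, z = (D k : ℂ) ∧ ∀ j, (torusBasis d).repr ψ j = a * U j k

theorem repr_ne_zero {ψ : L2T d} (h : ψ ≠ 0) : (fun j => (torusBasis d).repr ψ j) ≠ 0 := by
  refine fun h0 => h (repr_ext fun j => ?_)
  rw [map_zero]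
  exact congrFun h0 j

theorem DiagonalizingMatrix.diagonalized {D : Freq d → ℝ} {M U : Freq d → Freq d → ℂ}
    {m μ : Freq d → ℝ} (h : DiagonalizingMatrix D M U m μ) (hD : Function.Injective D) {ħ : ℝ}
    (hħ : ħ ≠ 0) {c : ℂ} (hc : c ≠ 0) {W : Freq d → Freq d → ℂ}
    (hW : ∀ j i, c * W j i = ħ * M j i) :
    Diagonalized (matOp (fun j k => if j = k then ((ħ * D k : ℝ) : ℂ) else 0) + c • matOp W)
      (fun k => ħ * D k) (∑' n, μ n) U μ where
  near_one := h.near_one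
  le := le_rfl
  eigen := by
    intro k ψ hψ
    have hU := summable_norm_column h.near_one k
    have hWd : SummableDecay W fun n => ‖c⁻¹ * ħ‖ * m n := by
      refine ⟨h.decay.summable.mul_left _, fun j i => ?_⟩
      have : W j i = c⁻¹ * ħ * M j i := by
        rw [mul_assoc, ← hW, inv_mul_cancel_left₀ hc]
      rw [this, norm_mul]
      exact mul_le_mul_of_nonneg_left (h.decay.le j i) (norm_nonneg _)
    have hWa : ∀ j, matApply W ψ j = ∑' i, W j i * U i k := fun j => by
      simp only [matApply, hψ]
    have hs : Summable fun j => ‖matApply W ψ j‖ := by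
      simp only [hWa]
      exact hWd.summable_norm_tsum hU
    have hcW : ∀ j, c * matApply W ψ j = ħ * ∑' i, M j i * U i k := by
      intro j
      rw [hWa, ← tsum_mul_left, ← tsum_mul_left]
      refine tsum_congr fun i => ?_
      rw [← mul_assoc, hW, mul_assoc]
    have heq : ∀ j, ((ħ * D j : ℝ) : ℂ) * U j k + c * matApply W ψ j
        = ((ħ * D k : ℝ) : ℂ) * U j k := by
      intro j
      rw [hcW, Complex.ofReal_mul, Complex.ofReal_mul, mul_assoc, mul_assoc, ← mul_add, h.eigen]
    refine eigenEq_add_smul_iff.2 ⟨⟨fun j => ?_, memℓp_two_of_summable ?_⟩,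
      ⟨fun j => ?_, memℓp_two_of_summable hs⟩, fun j => ?_⟩
    · exact summable_diagonal_mul _ _ j
    · have : ∀ j, matApply (fun j k => if j = k then ((ħ * D k : ℝ) : ℂ) else 0) ψ j
          = ((ħ * D k : ℝ) : ℂ) * U j k - c * matApply W ψ j := by
        intro j
        rw [matApply_diagonal, hψ, ← heq, add_sub_cancel_right]
      simp only [this]
      refine Summable.of_nonneg_of_le (fun _ => norm_nonneg _) (fun j => norm_sub_le _ _) ?_
      simp only [norm_mul]
      exact (hU.mul_left _).add (hs.mul_left _)
    · simp only [hψ]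
      exact hWd.summable_mul_bounded (fun i => norm_column_le h.near_one h.small i k) j
    · rw [matApply_diagonal, hψ, heq]
  unique := by
    intro z ψ hψ0 hψ
    obtain ⟨h1, h2, he⟩ := eigenEq_add_smul_iff.1 hψ
    have hħ' : (ħ : ℂ) ≠ 0 := by exact_mod_cast hħ
    obtain ⟨k, a, hk, ha⟩ := h.eq_smul_column hD (c := fun j => (torusBasis d).repr ψ j)
      (norm_repr_le ψ) (repr_ne_zero hψ0) (z := z / ħ) (fun j => by
        have e1 := he j
        have e2 : c * matApply W ψ j = ħ * ∑' i, M j i * (torusBasis d).repr ψ i := by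
          rw [matApply, ← tsum_mul_left, ← tsum_mul_left]
          refine tsum_congr fun i => ?_
          rw [← mul_assoc, hW, mul_assoc]
        rw [matApply_diagonal, e2, Complex.ofReal_mul, mul_assoc, ← mul_add] at e1
        rw [div_mul_eq_mul_div, ← e1, mul_div_cancel_left₀ _ hħ'])
    refine ⟨k, a, ?_, ha⟩
    rw [div_eq_iff hħ'] at hk
    rw [hk, Complex.ofReal_mul, mul_comm]

theorem diagonalized_diagonal {D : Freq d → ℝ} (hD : Function.Injective D) :
    Diagonalized (matOp (fun j k => if j = k then (D k : ℂ) else 0)) D 0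
      (fun j k => if j = k then 1 else 0) 0 where
  near_one := ⟨summable_zero, fun j i => by simp⟩
  le := by simp
  eigen := by
    intro k ψ hψ
    have he : ∀ j, matApply (fun j k => if j = k then (D k : ℂ) else 0) ψ j
        = D k * if j = k then 1 else 0 := by
      intro j
      rw [matApply_diagonal, hψ]
      split_ifs with h <;> simp [h]
    refine eigenEq_matOp_iff.2 ⟨⟨fun j => ?_, memℓp_two_of_summable ?_⟩, fun j => ?_⟩
    · exact summable_diagonal_mul _ _ j
    · simp only [he]
      refine summable_of_ne_finset_zero (s := {k}) fun i hi => ?_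
      rw [if_neg (by simpa using hi), mul_zero, norm_zero]
    · rw [he, hψ]
  unique := by
    intro z ψ hψ0 hψ
    obtain ⟨-, he⟩ := eigenEq_matOp_iff.1 hψ
    obtain ⟨k, hk⟩ := Function.ne_iff.1 (repr_ne_zero hψ0)
    simp only [matApply_diagonal] at he
    have hz : z = D k := (mul_right_cancel₀ hk (he k)).symm
    refine ⟨k, (torusBasis d).repr ψ k, hz, fun j => ?_⟩
    split_ifs with h
    · rw [h, mul_one]
    · rw [mul_zero]
      by_contra h0
      have := mul_right_cancel₀ h0 (he j)
      rw [hz] at this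
      exact h (hD (Complex.ofReal_injective this))

theorem linSymbol_weylMatrix (ω : E d) (ħ : ℝ) : weylMatrix ħ (linSymbol ω)
    = fun j k => if j = k then ((ħ * inner ℝ ω (intVec k) : ℝ) : ℂ) else 0 := by
  funext j k
  have := weylMatrix_fiber ħ (fun ξ : E d => ((inner ℝ ω ξ : ℝ) : ℂ)) j k
  rw [real_inner_smul_right] at this
  exact this

theorem Diagonalized.pointSpectrum_eq {A : L2T d →ₗ.[ℂ] L2T d} {D : Freq d → ℝ} {κ : ℝ}
    {U : Freq d → Freq d → ℂ} {μ : Freq d → ℝ} (h : Diagonalized A D κ U μ) (hκ : κ ≤ 1 / 8) :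
    pointSpectrum A = {z : ℂ | ∃ k, z = (D k : ℂ)} := by
  ext z
  constructor
  · rintro ⟨ψ, hψ0, hψ⟩
    obtain ⟨k, a, hk, -⟩ := h.unique z ψ hψ0 hψ
    exact ⟨k, hk⟩
  · rintro ⟨k, rfl⟩
    obtain ⟨ψ, hψ⟩ := exists_repr_eq (summable_norm_column h.near_one k)
    refine ⟨ψ, fun h0 => ?_, h.eigen k ψ hψ⟩
    have h1 := h.near_one.le k k
    have h2 := h.near_one.summable.le_tsum (k - k) fun _ _ => h.near_one.nonneg _
    simp only [← hψ, h0, map_zero] at h1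
    change ‖(0 : ℂ) - _‖ ≤ _ at h1
    rw [if_pos trivial, zero_sub, norm_neg, norm_one] at h1
    linarith [h.le]

end TorusKAM

namespace TorusKAM

variable {d : ℕ}

/-! ### Representation of the twisted convolution algebra by matrices -/

theorem intVec_zero : intVec (0 : Freq d) = 0 := by
  ext i
  simp [intVec]

theorem intVec_add (m n : Freq d) : intVec (m + n) = intVec m + intVec n := by
  ext i
  simp [intVec]

theorem intVec_sub (m n : Freq d) : intVec (m - n) = intVec m - intVec n := by
  ext i
  simp [intVec]

/-- The action of `ℤ^d` by translations of length `ħ`. -/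
def shiftAction (d : ℕ) (ħ : ℝ) : IsometricAction (Freq d) (WAlg d) where
  act m := WAlg.shift (ħ • intVec m)
  act_zero b := WAlg.ext fun ξ => by
    rw [WAlg.shift_apply, intVec_zero, smul_zero, add_zero]
  act_add m n b := WAlg.ext fun ξ => by
    rw [WAlg.shift_apply, WAlg.shift_apply, WAlg.shift_apply, intVec_add, smul_add, add_assoc]
  norm_act m b := WAlg.norm_shift _ _

theorem shiftAction_act_apply (ħ : ℝ) (m : Freq d) (b : WAlg d) (ξ : E d) :
    (shiftAction d ħ).act m b ξ = b (ξ + ħ • intVec m) := rfl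

/-- Evaluation at a point, as a continuous linear functional on the algebra of symbols. -/
def WAlg.eval (ξ : E d) : WAlg d →L[ℂ] ℂ :=
  LinearMap.mkContinuous
    { toFun := fun f => f ξ
      map_add' := fun _ _ => rfl
      map_smul' := fun _ _ => rfl } 1 fun f => by
    rw [one_mul]
    exact f.norm_apply_le ξ

theorem WAlg.eval_apply (ξ : E d) (f : WAlg d) : WAlg.eval ξ f = f ξ := rfl

/-- The matrix represented by an element of the twisted convolution algebra. -/
def mat {ħ : ℝ} (a : Crossed (shiftAction d ħ)) (j k : Freq d) : ℂ := a (j - k) (ħ • intVec k)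

section Mat

variable {ħ : ℝ}

theorem smul_intVec_add_sub (j k : Freq d) :
    ħ • intVec k + ħ • intVec (j - k) = ħ • intVec j := by
  rw [← smul_add, ← intVec_add, add_sub_cancel]

theorem mat_add (a b : Crossed (shiftAction d ħ)) (j k : Freq d) :
    mat (a + b) j k = mat a j k + mat b j k := rfl

theorem mat_sub (a b : Crossed (shiftAction d ħ)) (j k : Freq d) :
    mat (a - b) j k = mat a j k - mat b j k := rfl

theorem mat_of (S : WAlg d) (j k : Freq d) :
    mat (Crossed.of (shiftAction d ħ) S) j k = if j = k then S (ħ • intVec k) else 0 := by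
  rw [mat]
  split_ifs with h
  · rw [h, sub_self, Crossed.of_zero_apply]
  · rw [Crossed.of_apply_of_ne _ (sub_ne_zero.2 h), WAlg.zero_apply]

theorem mat_one (j k : Freq d) :
    mat (1 : Crossed (shiftAction d ħ)) j k = if j = k then 1 else 0 := by
  rw [Crossed.one_def, mat_of, WAlg.one_apply]

theorem summableDecay_mat (a : Crossed (shiftAction d ħ)) :
    SummableDecay (mat a) fun n => ‖a n‖ :=
  ⟨a.summable_norm, fun _ _ => WAlg.norm_apply_le _ _⟩

theorem mat_mul (a b : Crossed (shiftAction d ħ)) (j k : Freq d) :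
    mat (a * b) j k = ∑' i, mat a j i * mat b i k := by
  rw [mat, Crossed.mul_apply, ← WAlg.eval_apply, ContinuousLinearMap.map_tsum _
    (Crossed.summable_mul a b _), ← (Equiv.subRight k).tsum_eq]
  refine tsum_congr fun i => ?_
  rw [WAlg.eval_apply, WAlg.mul_apply, shiftAction_act_apply, Equiv.subRight_apply,
    sub_sub_sub_cancel_right, smul_intVec_add_sub]
  rfl

end Mat

/-! ### Small divisors -/

/-- The frequencies `k ↦ ω · k`. -/
def frequency (ω : E d) : Freq d →+ ℝ where
  toFun k := inner ℝ ω (intVec k)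
  map_zero' := by rw [intVec_zero, inner_zero_right]
  map_add' m n := by rw [intVec_add, inner_add_right]

theorem frequency_apply (ω : E d) (k : Freq d) : frequency ω k = inner ℝ ω (intVec k) := rfl

theorem isLength_norm_intVec (d : ℕ) : IsLength fun k : Freq d => ‖intVec k‖ where
  nonneg _ := norm_nonneg _
  zero := by rw [intVec_zero, norm_zero]
  add_le m n := by
    rw [intVec_add]
    exact norm_add_le _ _

theorem one_le_norm_intVec {k : Freq d} (hk : k ≠ 0) : 1 ≤ ‖intVec k‖ := by
  obtain ⟨i, hi⟩ := Function.ne_iff.1 hk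
  have h1 : ‖intVec k i‖ ≤ ‖intVec k‖ := PiLp.norm_apply_le _ i
  refine le_trans ?_ h1
  rw [intVec, Real.norm_eq_abs]
  change (1 : ℝ) ≤ |(k i : ℝ)|
  exact_mod_cast Int.one_le_abs hi

theorem Diophantine.small_divisor {ω : E d} {γ ς : ℝ} (h : Diophantine ω γ ς) (hς : 0 < ς)
    (k : Freq d) (hk : k ≠ 0) :
    frequency ω k ≠ 0 ∧ |frequency ω k|⁻¹ ≤ ς⁻¹ * ‖intVec k‖ ^ ⌈γ⌉₊ := by
  have h1 := h k hk
  rw [real_inner_comm] at h1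
  change _ ≤ |frequency ω k| at h1
  have h2 : 0 < ‖intVec k‖ := zero_lt_one.trans_le (one_le_norm_intVec hk)
  have h3 : 0 < ‖intVec k‖ ^ (γ - 1) := Real.rpow_pos_of_pos h2 _
  have h4 : 0 < ς / ‖intVec k‖ ^ (γ - 1) := div_pos hς h3
  refine ⟨abs_pos.1 (h4.trans_le h1), ?_⟩
  calc |frequency ω k|⁻¹ ≤ (ς / ‖intVec k‖ ^ (γ - 1))⁻¹ := inv_anti₀ h4 h1
    _ = ς⁻¹ * ‖intVec k‖ ^ (γ - 1) := by rw [inv_div, div_eq_inv_mul]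
    _ ≤ ς⁻¹ * ‖intVec k‖ ^ ((⌈γ⌉₊ : ℕ) : ℝ) := by
      gcongr
      · exact one_le_norm_intVec hk
      · linarith [Nat.le_ceil γ]
    _ = _ := by rw [Real.rpow_natCast]

theorem Diophantine.injective {ω : E d} {γ ς : ℝ} (h : Diophantine ω γ ς) (hς : 0 < ς) :
    Function.Injective (frequency ω) := by
  refine (injective_iff_map_eq_zero _).2 fun k hk => ?_
  by_contra h0
  exact (h.small_divisor hς k h0).1 hk

/-! ### The counterterm -/

theorem winNorm_re_le {f : E d → ℂ} (hf : Continuous f) (hb : ∃ M : ℝ, ∀ ξ, ‖f ξ‖ ≤ M) :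
    winNorm (win d) (fun ξ => ((f ξ).re : ℂ)) ≤ winNorm (win d) f := by
  have h1 : (fun ξ => ((f ξ).re : ℂ)) = fun ξ => (1 / 2 : ℂ) * (f ξ + conj (f ξ)) := by
    funext ξ
    rw [Complex.add_conj]
    push_cast
    ring
  rw [h1, winNorm_smul]
  have h2 := winNorm_add_le (fourierPair_win (d := d)) hf hb (Complex.continuous_conj.comp hf)
    (hb.imp fun M hM ξ => by simpa using hM ξ)
  have h3 : winNorm (win d) (Complex.conjCLE ∘ f) = winNorm (win d) f :=
    winNorm_conj conj_win f
  have h4 : ‖(1 / 2 : ℂ)‖ₑ = 2⁻¹ := by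
    rw [← ofReal_norm, norm_div, norm_one, RCLike.norm_ofNat, one_div,
      ENNReal.ofReal_inv_of_pos two_pos, ENNReal.ofReal_ofNat]
  calc ‖(1 / 2 : ℂ)‖ₑ * winNorm (win d) (fun ξ => f ξ + conj (f ξ))
      ≤ 2⁻¹ * (winNorm (win d) f + winNorm (win d) f) := by
        rw [h4]
        refine mul_le_mul' le_rfl (h2.trans (add_le_add le_rfl h3.le))
    _ = _ := by
      rw [← two_mul, ← mul_assoc, ENNReal.inv_mul_cancel (by norm_num) (by norm_num), one_mul]

theorem winNorm_const_mul_re_le {f : E d → ℂ} (hf : Continuous f) (hb : ∃ M : ℝ, ∀ ξ, ‖f ξ‖ ≤ M)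
    (c : ℝ) : winNorm (win d) (fun ξ => ((c * (f ξ).re : ℝ) : ℂ))
      ≤ ENNReal.ofReal |c| * winNorm (win d) f := by
  simp only [Complex.ofReal_mul]
  rw [winNorm_smul, ← ofReal_norm, Complex.norm_real, Real.norm_eq_abs]
  exact mul_le_mul' le_rfl (winNorm_re_le hf hb)

/-- For a small perturbation `(δ / ħ) V` there is a symbol `r` of `ξ` alone such that the
perturbation `ε Op(V - r)` of `ω · ħ D` leaves the spectrum unchanged. -/
theorem exists_counterterm {ω : E d} {K : ℝ} {τ : ℕ} (hK : 0 ≤ K) (hτ : 1 ≤ τ)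
    (hω : ∀ n, n ≠ 0 → frequency ω n ≠ 0 ∧ |frequency ω n|⁻¹ ≤ K * ‖intVec n‖ ^ τ)
    {V : Phase d → ℝ} (hV : Continuous V) {F : Freq d → WAlg d}
    (hF : ∀ n ξ, F n ξ = symbolCoeff (fun p => (V p : ℂ)) n ξ) {ρ X ε ħ : ℝ} (hρ : 0 < ρ)
    (hX : 0 ≤ X) (hFX : ENNReal.ofReal ((√(2 * π)) ^ d)⁻¹ * expNorm (fun n => ‖intVec n‖) ρ F
      ≤ ENNReal.ofReal X) (hε : 0 < ε) (hħ : 0 < ħ)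
    (hs : newtonConst K τ ρ * (ε / ħ * X) ≤ 1 / 8) :
    ∃ r : E d → ℝ, Continuous r ∧ (∃ M : ℝ, ∀ ξ, |r ξ| ≤ M) ∧
      winNorm (win d) (fun ξ => (r ξ : ℂ)) ≤ ENNReal.ofReal (4 * X) ∧
      ∃ U μ, Diagonalized (opL ω ħ + (ε : ℂ) • weylOp ħ (fun p => ((V p - r p.2 : ℝ) : ℂ)))
        (fun k => ħ * inner ℝ ω (intVec k)) (newtonConst K τ ρ * (ε / ħ * X)) U μ := by
  set δ := ε / ħ with hδ
  have hδ0 : 0 < δ := div_pos hε hħ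
  set cd : ℝ := ((√(2 * π)) ^ d)⁻¹ with hcd
  have hcd0 : 0 < cd := by positivity
  have hsum : ∑' n, ‖((δ * cd : ℝ) : ℂ) • WAlg.shift ((ħ / 2) • intVec n) (F n)‖ₑ *
      ENNReal.ofReal (Real.exp (ρ * ‖intVec n‖)) ≤ ENNReal.ofReal (δ * X) := by
    have h1 : ∀ n, ‖((δ * cd : ℝ) : ℂ) • WAlg.shift ((ħ / 2) • intVec n) (F n)‖ₑ
        = ENNReal.ofReal δ * (ENNReal.ofReal cd * ‖F n‖ₑ) := by
      intro n
      rw [← ofReal_norm, norm_smul, WAlg.norm_shift, Complex.norm_real,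
        Real.norm_of_nonneg (by positivity), ENNReal.ofReal_mul (by positivity),
        ENNReal.ofReal_mul hδ0.le, ofReal_norm, mul_assoc]
    simp only [h1, mul_assoc]
    rw [ENNReal.tsum_mul_left, ENNReal.tsum_mul_left, ENNReal.ofReal_mul hδ0.le]
    exact mul_le_mul' le_rfl hFX
  have hne : ∑' n, ‖((δ * cd : ℝ) : ℂ) • WAlg.shift ((ħ / 2) • intVec n) (F n)‖ₑ ≠ ∞ := by
    refine ne_top_of_le_ne_top (ENNReal.ofReal_ne_top (r := δ * X)) (le_trans ?_ hsum)
    refine ENNReal.tsum_le_tsum fun n => le_mul_of_one_le_right' ?_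
    rw [← ENNReal.ofReal_one]
    exact ENNReal.ofReal_le_ofReal (Real.one_le_exp (by positivity))
  set P : Crossed (shiftAction d ħ) := Crossed.mk _ hne with hP
  have hPb : ExpBound (fun n => ‖intVec n‖) ρ P (δ * X) := hsum
  obtain ⟨u, S, hS, hu, heq⟩ := exists_conjugation (isLength_norm_intVec d) hK hτ hω hρ
    (mul_nonneg hδ0.le hX) hPb (hs.trans (by norm_num))
  have hPW : ∀ j k, mat P j k = δ * weylMatrix ħ (fun p => (V p : ℂ)) j k := by
    intro j k
    have h1 : mat P j k = ((δ * cd : ℝ) : ℂ) *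
        symbolCoeff (fun p => (V p : ℂ)) (j - k) (ħ • intVec k + (ħ / 2) • intVec (j - k)) := by
      rw [← hF]
      rfl
    have h2 : ħ • intVec k + (ħ / 2) • intVec (j - k) = (ħ / 2) • intVec (j + k) := by
      rw [intVec_sub, intVec_add, smul_sub, smul_add]
      nth_rewrite 1 [← add_halves ħ]
      rw [add_smul]
      abel
    rw [h1, h2, weylMatrix, hcd]
    push_cast
    ring
  have hherm : ∀ i j, conj (mat P i j) = mat P j i := by
    intro i j
    rw [hPW, hPW, map_mul, Complex.conj_ofReal, conj_weylMatrix]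
  set U : Freq d → Freq d → ℂ := mat (1 + u) with hU
  have hUu : (fun j k => U j k - if j = k then 1 else 0) = mat u := by
    funext j k
    rw [hU, mat_add, mat_one, add_sub_cancel_left]
  have hnear : SummableDecay (fun j k => U j k - if j = k then 1 else 0) fun n => ‖u n‖ := by
    rw [hUu]
    exact summableDecay_mat u
  have hule : ∑' n, ‖u n‖ ≤ newtonConst K τ ρ * (δ * X) := by
    rw [← Crossed.norm_eq]
    exact hu
  have heig : ∀ j k, (frequency ω j : ℂ) * U j k + ∑' i, mat (P - Crossed.of _ S) j i * U i k
      = frequency ω k * U j k := by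
    intro j k
    have h1 : ((frequency ω (j - k) : ℝ) : ℂ) * mat u j k
        + mat ((P - Crossed.of _ S) * (1 + u)) j k = 0 :=
      congrArg (fun f : WAlg d => f (ħ • intVec k)) (heq (j - k))
    have h2 : ((frequency ω (j - k) : ℝ) : ℂ) * mat u j k
        = (frequency ω j - frequency ω k) * U j k := by
      rw [hU, mat_add, mat_one, map_sub]
      push_cast
      split_ifs with h
      · rw [h, sub_self, zero_mul, zero_mul]
      · rw [zero_add]
    rw [h2, mat_mul] at h1
    rw [← sub_eq_zero, ← h1]
    ring
  have hmat : ∀ j k, ∑' i, mat (P - Crossed.of _ S) j i * U i k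
      = ∑' i, mat P j i * U i k - S (ħ • intVec j) * U j k := by
    intro j k
    have h1 : ∀ i, mat (P - Crossed.of _ S) j i * U i k = mat P j i * U i k
        - (if j = i then S (ħ • intVec i) else 0) * U i k := by
      intro i
      rw [mat_sub, mat_of, sub_mul]
    simp only [h1]
    rw [((summableDecay_mat P).summable_mul_bounded
      (fun i => norm_column_le hnear (hule.trans hs) i k) j).tsum_sub
      (summable_diagonal_mul (fun i => S (ħ • intVec i)) _ j),
      tsum_diagonal_mul (fun i => S (ħ • intVec i))]
  have hreal : ∀ j : Freq d, (S (ħ • intVec j)).im = 0 :=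
    im_eq_zero_of_eigen (D := frequency ω) (s := fun j => S (ħ • intVec j)) hherm
      (summableDecay_mat P) hnear (hule.trans hs)
      (fun j => S.norm_apply_le _) (fun j k => by
        rw [← heig, hmat]
        ring)
  have hre : ∀ j : Freq d, (((S (ħ • intVec j)).re : ℝ) : ℂ) = S (ħ • intVec j) := fun j =>
    Complex.ext rfl (hreal j).symm
  have hcS := S.continuous
  have hr : Continuous fun ξ => δ⁻¹ * (S ξ).re :=
    continuous_const.mul (Complex.continuous_re.comp hcS)
  refine ⟨fun ξ => δ⁻¹ * (S ξ).re, hr, ⟨δ⁻¹ * ‖S‖, fun ξ => ?_⟩, ?_, U, fun n => ‖u n‖, ?_⟩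
  · rw [abs_mul, abs_of_pos (inv_pos.2 hδ0)]
    gcongr
    exact (Complex.abs_re_le_norm _).trans (S.norm_apply_le ξ)
  · refine (winNorm_const_mul_re_le hcS S.bounded _).trans ?_
    rw [abs_of_pos (inv_pos.2 hδ0)]
    calc ENNReal.ofReal δ⁻¹ * winNorm (win d) S
        ≤ ENNReal.ofReal δ⁻¹ * ENNReal.ofReal (4 * (δ * X)) := by
          refine mul_le_mul' le_rfl (S.winNorm_le.trans ?_)
          rw [← ofReal_norm]
          exact ENNReal.ofReal_le_ofReal hS
      _ = _ := by
        rw [← ENNReal.ofReal_mul (by positivity)]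
        congr 1
        field_simp
  · have hdiag : DiagonalizingMatrix (frequency ω) (mat (P - Crossed.of _ S)) U
        (fun n => ‖(P - Crossed.of (shiftAction d ħ) S) n‖) (fun n => ‖u n‖) := by
      refine ⟨fun i j => ?_, summableDecay_mat _, hnear, hule.trans hs, heig⟩
      rw [mat_sub, mat_sub, map_sub, hherm, mat_of, mat_of]
      congr 1
      by_cases h : i = j
      · rw [if_pos h, if_pos h.symm, h, ← hre, Complex.conj_ofReal]
      · rw [if_neg h, if_neg (Ne.symm h), map_zero]
    set W := weylMatrix ħ (fun p : Phase d => ((V p - δ⁻¹ * (S p.2).re : ℝ) : ℂ)) with hWdef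
    have hW : ∀ j i, (ε : ℂ) * W j i = ħ * mat (P - Crossed.of _ S) j i := by
      intro j i
      have hVc : Continuous fun p : Phase d => (V p : ℂ) := Complex.continuous_ofReal.comp hV
      have hrc : Continuous fun p : Phase d => ((δ⁻¹ * (S p.2).re : ℝ) : ℂ) :=
        Complex.continuous_ofReal.comp (hr.comp continuous_snd)
      have hW1 : W j i = weylMatrix ħ (fun p => (V p : ℂ)) j i
          - if j = i then ((δ⁻¹ * (S (ħ • intVec i)).re : ℝ) : ℂ) else 0 := by
        rw [← weylMatrix_fiber ħ (fun ξ => ((δ⁻¹ * (S ξ).re : ℝ) : ℂ)),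
          ← weylMatrix_sub hVc hrc, hWdef]
        simp only [Complex.ofReal_sub]
      have hεδ : (ε : ℂ) = ħ * δ := by
        rw [← Complex.ofReal_mul, hδ, mul_div_cancel₀ _ hħ.ne']
      have hδc : (δ : ℂ) ≠ 0 := by exact_mod_cast hδ0.ne'
      rw [hW1, hεδ, mat_sub, mat_of, hPW, mul_assoc, mul_sub]
      congr 2
      split_ifs
      · rw [Complex.ofReal_mul, hre, Complex.ofReal_inv, mul_inv_cancel_left₀ hδc]
      · rw [mul_zero]
    have hmain := hdiag.diagonalized ?_ hħ.ne' (c := (ε : ℂ)) (by exact_mod_cast hε.ne') hW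
    · have hL : opL ω ħ = matOp fun j k : Freq d =>
          if j = k then ((ħ * frequency ω k : ℝ) : ℂ) else 0 := by
        rw [opL, weylOp, linSymbol_weylMatrix]
        rfl
      rw [hL]
      exact ⟨hmain.near_one, hule, hmain.eigen, hmain.unique⟩
    · refine (injective_iff_map_eq_zero _).2 fun k hk => ?_
      by_contra h0
      exact (hω k h0).1 hk

/-- A family of operators is diagonalized, for small `ħ`, by matrices that tend to the identity as
`ħ → 0`, with eigenvalues `ħ ω · k`. -/
def AsymptoticallyDiagonalized (A : ℝ → L2T d →ₗ.[ℂ] L2T d) (ω : E d) : Prop :=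
  ∃ (κ : ℝ → ℝ) (ħ₀ : ℝ), Tendsto κ (𝓝[>] 0) (𝓝 0) ∧ ħ₀ ∈ Set.Ioc (0 : ℝ) 1 ∧
    ∀ ħ ∈ Set.Ioc (0 : ℝ) ħ₀, κ ħ ≤ 1 / 8 ∧
      ∃ U μ, Diagonalized (A ħ) (fun k => ħ * inner ℝ ω (intVec k)) (κ ħ) U μ

theorem exists_counterterm_family (e : Module.Basis (Fin d) ℝ (E d)) (χ : SchwartzMap (E d) ℂ)
    (hχ : IsPartition e χ) :
    ∃ C : ℝ≥0, ∀ (ω : E d) (γ ς ρ : ℝ), (d : ℝ) < γ → 0 < ς → 0 < ρ → Diophantine ω γ ς →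
      ∀ V : Phase d → ℝ, MemAW e χ ρ V →
      ∀ ε : ℝ → ℝ, (∀ ħ ∈ Set.Ioc (0 : ℝ) 1, 0 < ε ħ) →
        Tendsto (fun ħ => ε ħ / ħ) (𝓝[>] 0) (𝓝 0) →
      ∃ R : ℝ → E d → ℝ,
        (∀ ħ ∈ Set.Ioc (0 : ℝ) 1, MemSW e χ (fun ξ => (R ħ ξ : ℂ)) ∧
          normW e χ (fun ξ => (R ħ ξ : ℂ)) ≤ C * normWρ e χ ρ V) ∧
        AsymptoticallyDiagonalized (opQ ω ε V R) ω := by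
  obtain ⟨C₁, hC₁⟩ := exists_winNorm_le_normW e χ hχ
  obtain ⟨C₂, hC₂⟩ := exists_winNorm_schwartz_le χ
  refine ⟨C₂ * (4 * (algConst d * C₁)), ?_⟩
  intro ω γ ς ρ hγ hς hρ hω V hV ε hε hlim
  have hcoef : ∀ n, winNorm (win d) (symbolCoeff (fun p => (V p : ℂ)) n)
      ≤ C₁ * normW e χ (symbolCoeff (fun p => (V p : ℂ)) n) := fun n =>
    hC₁ _ (hV.coeff n).continuous (hV.coeff n).bounded
  set F : Freq d → WAlg d := fun n => WAlg.mk _ (hV.coeff n).continuous (hV.coeff n).bounded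
    (ne_top_of_le_ne_top (ENNReal.mul_ne_top ENNReal.coe_ne_top (hV.coeff n).finite.ne)
      (hcoef n)) with hF
  set X : ℝ := (algConst d * C₁ * normWρ e χ ρ V).toReal with hX
  have hX0 : 0 ≤ X := ENNReal.toReal_nonneg
  have hXeq : ENNReal.ofReal X = algConst d * C₁ * normWρ e χ ρ V :=
    ENNReal.ofReal_toReal (ENNReal.mul_ne_top (by finiteness) hV.finite.ne)
  have hFX : ENNReal.ofReal ((√(2 * π)) ^ d)⁻¹ * expNorm (fun n => ‖intVec n‖) ρ F
      ≤ ENNReal.ofReal X := by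
    rw [hXeq, normWρ, mul_left_comm (algConst d * C₁ : ℝ≥0∞), ← ENNReal.tsum_mul_left]
    refine mul_le_mul' le_rfl (ENNReal.tsum_le_tsum fun n => ?_)
    rw [WAlg.enorm_def]
    exact (mul_le_mul' (mul_le_mul' le_rfl (hcoef n)) le_rfl).trans_eq (by ring)
  set K := newtonConst ς⁻¹ ⌈γ⌉₊ ρ with hK
  have hτ : 1 ≤ ⌈γ⌉₊ := Nat.one_le_ceil_iff.2 ((Nat.cast_nonneg d).trans_lt hγ)
  have hmain : ∀ ħ, ∃ r : E d → ℝ, Continuous r ∧ (∃ M : ℝ, ∀ ξ, |r ξ| ≤ M) ∧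
      winNorm (win d) (fun ξ => (r ξ : ℂ)) ≤ ENNReal.ofReal (4 * X) ∧
      (ħ ∈ Set.Ioc (0 : ℝ) 1 → K * (ε ħ / ħ * X) ≤ 1 / 8 →
        ∃ U μ, Diagonalized
          (opL ω ħ + (ε ħ : ℂ) • weylOp ħ (fun p => ((V p - r p.2 : ℝ) : ℂ)))
          (fun k => ħ * inner ℝ ω (intVec k)) (K * (ε ħ / ħ * X)) U μ) := by
    intro ħ
    by_cases h : ħ ∈ Set.Ioc (0 : ℝ) 1 ∧ K * (ε ħ / ħ * X) ≤ 1 / 8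
    · obtain ⟨r, h1, h2, h3, h4⟩ := exists_counterterm (inv_nonneg.2 hς.le) hτ
        (hω.small_divisor hς) hV.smooth.continuous (F := F) (fun n ξ => rfl) hρ hX0 hFX
        (hε ħ h.1) h.1.1 h.2
      exact ⟨r, h1, h2, h3, fun _ _ => h4⟩
    · refine ⟨0, continuous_zero, ⟨0, fun ξ => by simp⟩, ?_, fun h1 h2 => absurd ⟨h1, h2⟩ h⟩
      have : winNorm (win d) (fun _ => (0 : ℂ) * 0) = 0 := by
        rw [winNorm_smul (win d) (fun _ => 0) 0, enorm_zero, zero_mul]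
      simp only [mul_zero] at this
      simp [this]
  choose R hRc hRb hRn hRd using hmain
  refine ⟨R, fun ħ _ => ?_, ?_⟩
  · have hc : Continuous fun ξ => (R ħ ξ : ℂ) := Complex.continuous_ofReal.comp (hRc ħ)
    have hb : ∃ M : ℝ, ∀ ξ, ‖(R ħ ξ : ℂ)‖ ≤ M := (hRb ħ).imp fun M hM ξ => by
      simpa using hM ξ
    have hn : normW e χ (fun ξ => (R ħ ξ : ℂ))
        ≤ (C₂ * (4 * (algConst d * C₁)) : ℝ≥0) * normWρ e χ ρ V := by
      calc normW e χ (fun ξ => (R ħ ξ : ℂ)) ≤ winNorm χ (fun ξ => (R ħ ξ : ℂ)) :=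
            normW_le_winNorm _ _ _
        _ ≤ C₂ * winNorm (win d) (fun ξ => (R ħ ξ : ℂ)) := hC₂ _ hc hb
        _ ≤ C₂ * ENNReal.ofReal (4 * X) := mul_le_mul' le_rfl (hRn ħ)
        _ = _ := by
          rw [ENNReal.ofReal_mul (by norm_num), hXeq, ENNReal.ofReal_ofNat]
          push_cast
          ring
    exact ⟨⟨hc, hb, hn.trans_lt (ENNReal.mul_lt_top ENNReal.coe_lt_top hV.finite)⟩, hn⟩
  · have hκ : Tendsto (fun ħ => K * (ε ħ / ħ * X)) (𝓝[>] 0) (𝓝 0) := by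
      simpa using (hlim.mul_const X).const_mul K
    have hev : ∀ᶠ ħ in 𝓝[>] 0, K * (ε ħ / ħ * X) ≤ 1 / 8 :=
      (hκ.eventually_lt_const (by norm_num : (0 : ℝ) < 1 / 8)).mono fun _ h => h.le
    obtain ⟨b, hb0, hb⟩ := (mem_nhdsGT_iff_exists_Ioc_subset).1 hev
    refine ⟨_, min b 1, hκ, ⟨lt_min hb0 one_pos, min_le_right _ _⟩, fun ħ hħ => ?_⟩
    have h1 : K * (ε ħ / ħ * X) ≤ 1 / 8 := hb ⟨hħ.1, hħ.2.trans (min_le_left _ _)⟩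
    exact ⟨h1, hRd ħ ⟨hħ.1, hħ.2.trans (min_le_right _ _)⟩ h1⟩

theorem diagonalized_opL {ω : E d} (hω : Function.Injective (frequency ω)) {ħ : ℝ} (hħ : 0 < ħ) :
    Diagonalized (opL ω ħ) (fun k => ħ * inner ℝ ω (intVec k)) 0
      (fun j k => if j = k then 1 else 0) 0 := by
  have h : Function.Injective fun k : Freq d => ħ * inner ℝ ω (intVec k) := fun j k h =>
    hω (mul_left_cancel₀ hħ.ne' h)
  rw [opL, weylOp, linSymbol_weylMatrix]
  exact diagonalized_diagonal h

theorem asymptoticallyDiagonalized_opL {ω : E d} (hω : Function.Injective (frequency ω)) :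
    AsymptoticallyDiagonalized (opL ω) ω :=
  ⟨fun _ => 0, 1, tendsto_const_nhds, ⟨one_pos, le_rfl⟩, fun _ hħ =>
    ⟨by norm_num, _, _, diagonalized_opL hω hħ.1⟩⟩

end TorusKAM

namespace TorusKAM

variable {d : ℕ}

/-! ### Functions close to a single mode -/

section Bilinear

variable {G : Type*} {W : G → G → ℂ} {B : ℝ}

theorem summable_mul_of_bounded (hW : ∀ j i, ‖W j i‖ ≤ B) {z : G → ℂ}
    (hz : Summable fun i => ‖z i‖) (j : G) : Summable fun i => W j i * z i :=
  Summable.of_norm_bounded (hz.mul_left B) fun i => by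
    rw [norm_mul]
    exact mul_le_mul_of_nonneg_right (hW j i) (norm_nonneg _)

theorem norm_tsum_mul_le (hW : ∀ j i, ‖W j i‖ ≤ B) {z : G → ℂ}
    (hz : Summable fun i => ‖z i‖) (j : G) : ‖∑' i, W j i * z i‖ ≤ B * ∑' i, ‖z i‖ := by
  rw [← tsum_mul_left]
  refine tsum_of_norm_bounded (hz.mul_left B).hasSum fun i => ?_
  rw [norm_mul]
  exact mul_le_mul_of_nonneg_right (hW j i) (norm_nonneg _)

theorem summable_form (hW : ∀ j i, ‖W j i‖ ≤ B) {y z : G → ℂ} (hy : Summable fun i => ‖y i‖)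
    (hz : Summable fun i => ‖z i‖) : Summable fun j => (∑' i, W j i * z i) * conj (y j) :=
  Summable.of_norm_bounded (hy.mul_left (B * ∑' i, ‖z i‖)) fun j => by
    rw [norm_mul, RCLike.norm_conj]
    exact mul_le_mul_of_nonneg_right (norm_tsum_mul_le hW hz j) (norm_nonneg _)

theorem norm_form_le (hW : ∀ j i, ‖W j i‖ ≤ B) {y z : G → ℂ} (hy : Summable fun i => ‖y i‖)
    (hz : Summable fun i => ‖z i‖) :
    ‖∑' j, (∑' i, W j i * z i) * conj (y j)‖ ≤ B * (∑' i, ‖z i‖) * ∑' i, ‖y i‖ := by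
  rw [← tsum_mul_left]
  refine tsum_of_norm_bounded (hy.mul_left (B * ∑' i, ‖z i‖)).hasSum fun j => ?_
  rw [norm_mul, RCLike.norm_conj]
  exact mul_le_mul_of_nonneg_right (norm_tsum_mul_le hW hz j) (norm_nonneg _)

theorem norm_form_sub_le (hW : ∀ j i, ‖W j i‖ ≤ B) {x c : G → ℂ}
    (hc : Summable fun i => ‖c i‖) (hw : Summable fun i => ‖x i - c i‖) :
    ‖∑' j, (∑' i, W j i * x i) * conj (x j) - ∑' j, (∑' i, W j i * c i) * conj (c j)‖
      ≤ B * (∑' i, ‖x i - c i‖) * (∑' i, ‖x i - c i‖ + 2 * ∑' i, ‖c i‖) := by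
  have hx : Summable fun i => ‖x i‖ := by
    refine Summable.of_nonneg_of_le (fun _ => norm_nonneg _) (fun i => ?_) (hw.add hc)
    have := norm_add_le (x i - c i) (c i)
    rwa [sub_add_cancel] at this
  have h1 : ∀ j, (∑' i, W j i * x i) * conj (x j) = (∑' i, W j i * x i) * conj (x j - c j)
      + (∑' i, W j i * (x i - c i)) * conj (c j) + (∑' i, W j i * c i) * conj (c j) := by
    intro j
    simp only [mul_sub, map_sub]
    rw [(summable_mul_of_bounded hW hx j).tsum_sub (summable_mul_of_bounded hW hc j)]
    ring
  simp only [h1]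
  rw [((summable_form hW hw hx).add (summable_form hW hc hw)).tsum_add (summable_form hW hc hc),
    add_sub_cancel_right, (summable_form hW hw hx).tsum_add (summable_form hW hc hw)]
  refine (norm_add_le _ _).trans ((add_le_add (norm_form_le hW hw hx)
    (norm_form_le hW hc hw)).trans ?_)
  have h2 : ∑' i, ‖x i‖ ≤ ∑' i, ‖x i - c i‖ + ∑' i, ‖c i‖ := by
    rw [← hw.tsum_add hc]
    refine hx.tsum_le_tsum (fun i => ?_) (hw.add hc)
    have := norm_add_le (x i - c i) (c i)
    rwa [sub_add_cancel] at this
  have hB : 0 ≤ B * ∑' i, ‖x i - c i‖ := by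
    rcases isEmpty_or_nonempty G with h | ⟨⟨j⟩⟩
    · simp
    · exact mul_nonneg ((norm_nonneg _).trans (hW j j)) (tsum_nonneg fun _ => norm_nonneg _)
  calc B * (∑' i, ‖x i‖) * ∑' i, ‖x i - c i‖ + B * (∑' i, ‖x i - c i‖) * ∑' i, ‖c i‖
      = B * (∑' i, ‖x i - c i‖) * (∑' i, ‖x i‖ + ∑' i, ‖c i‖) := by ring
    _ ≤ _ := by
      refine mul_le_mul_of_nonneg_left ?_ hB
      linarith

end Bilinear

/-- The function `ψ` is `η`-close to a multiple of the mode `e_k`, in the `ℓ¹`-norm of the Fourier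
coefficients, and the absolute value of the factor is `η`-close to `1`. -/
def NearMode (ψ : L2T d) (k : Freq d) (η : ℝ) : Prop :=
  ∃ a : ℂ, |‖a‖ - 1| ≤ η ∧
    (Summable fun j => ‖(torusBasis d).repr ψ j - if j = k then a else 0‖) ∧
    ∑' j, ‖(torusBasis d).repr ψ j - if j = k then a else 0‖ ≤ η

theorem norm_torusBasis (k : Freq d) : ‖torusBasis d k‖ = 1 := (torusBasis d).orthonormal.1 k

theorem norm_le_tsum_repr {ψ : L2T d} (h : Summable fun j => ‖(torusBasis d).repr ψ j‖) :
    ‖ψ‖ ≤ ∑' j, ‖(torusBasis d).repr ψ j‖ := by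
  have h1 := ((torusBasis d).hasSum_repr ψ).tsum_eq
  refine (congrArg norm h1).ge.trans (tsum_of_norm_bounded h.hasSum fun j => ?_)
  rw [norm_smul, norm_torusBasis, mul_one]

theorem repr_smul_torusBasis (a : ℂ) (k j : Freq d) :
    (torusBasis d).repr (a • torusBasis d k) j = if j = k then a else 0 := by
  rw [map_smul, HilbertBasis.repr_self]
  change a * (lp.single 2 k (1 : ℂ) : Freq d → ℂ) j = _
  rw [lp.single_apply, Pi.single_apply]
  split_ifs <;> simp

theorem repr_sub_apply (φ ψ : L2T d) (j : Freq d) : (torusBasis d).repr (φ - ψ) j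
    = (torusBasis d).repr φ j - (torusBasis d).repr ψ j := by
  rw [map_sub]
  rfl

theorem norm_sub_mode_le {ψ : L2T d} {k : Freq d} {a : ℂ}
    (h : Summable fun j => ‖(torusBasis d).repr ψ j - if j = k then a else 0‖) :
    ‖ψ - a • torusBasis d k‖ ≤ ∑' j, ‖(torusBasis d).repr ψ j - if j = k then a else 0‖ := by
  have h1 : ∀ j, (torusBasis d).repr (ψ - a • torusBasis d k) j
      = (torusBasis d).repr ψ j - if j = k then a else 0 := fun j => by
    rw [repr_sub_apply, repr_smul_torusBasis]
  simp only [← h1] at h ⊢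
  exact norm_le_tsum_repr h

theorem Diagonalized.nearMode {A : L2T d →ₗ.[ℂ] L2T d} {D : Freq d → ℝ} {κ : ℝ}
    {U : Freq d → Freq d → ℂ} {μ : Freq d → ℝ} (h : Diagonalized A D κ U μ) (hκ : κ ≤ 1 / 8)
    {ψ : L2T d} (hψ : ‖ψ‖ = 1) {k : Freq d} {a : ℂ}
    (ha : ∀ j, (torusBasis d).repr ψ j = a * U j k) : NearMode ψ k (2 * κ) := by
  have h1 : ∀ j, ‖(torusBasis d).repr ψ j - if j = k then a else 0‖ ≤ ‖a‖ * μ (j - k) := by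
    intro j
    have : (torusBasis d).repr ψ j - (if j = k then a else 0)
        = a * (U j k - if j = k then 1 else 0) := by
      rw [ha, mul_sub, mul_ite, mul_one, mul_zero]
    rw [this, norm_mul]
    exact mul_le_mul_of_nonneg_left (h.near_one.le j k) (norm_nonneg _)
  have hs : Summable fun j => ‖a‖ * μ (j - k) := (h.near_one.summable_column k).mul_left _
  have hsum : Summable fun j => ‖(torusBasis d).repr ψ j - if j = k then a else 0‖ :=
    Summable.of_nonneg_of_le (fun _ => norm_nonneg _) h1 hs
  have hle : ∑' j, ‖(torusBasis d).repr ψ j - if j = k then a else 0‖ ≤ ‖a‖ * κ := by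
    refine (hsum.tsum_le_tsum h1 hs).trans ?_
    rw [tsum_mul_left]
    refine mul_le_mul_of_nonneg_left (le_trans (le_of_eq ?_) h.le) (norm_nonneg _)
    exact (Equiv.subRight k).tsum_eq μ
  have hn := norm_sub_mode_le hsum
  have hna : ‖a • torusBasis d k‖ = ‖a‖ := by rw [norm_smul, norm_torusBasis, mul_one]
  have h2 : |‖a‖ - 1| ≤ ‖a‖ * κ := by
    rw [← hna, ← hψ, hna]
    rw [← hna]
    refine (abs_norm_sub_norm_le _ _).trans ?_
    rw [norm_sub_rev, hna]
    exact hn.trans hle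
  have hκ0 : 0 ≤ κ := (tsum_nonneg h.near_one.nonneg).trans h.le
  have h3 : ‖a‖ ≤ 2 := by
    have := le_abs_self (‖a‖ - 1)
    nlinarith [norm_nonneg a]
  have h4 : ‖a‖ * κ ≤ 2 * κ := mul_le_mul_of_nonneg_right h3 hκ0
  exact ⟨a, h2.trans h4, hsum, hle.trans h4⟩

theorem NearMode.mono {ψ : L2T d} {k : Freq d} {η η' : ℝ} (h : NearMode ψ k η) (hη : η ≤ η') :
    NearMode ψ k η' := by
  obtain ⟨a, h1, h2, h3⟩ := h
  exact ⟨a, h1.trans hη, h2, h3.trans hη⟩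

/-! ### Wigner distributions -/

theorem integral_normalizedLebesgue {F : Type*} [NormedAddCommGroup F] [NormedSpace ℝ F]
    (f : Torus d → F) :
    ∫ x, f x ∂normalizedLebesgue d = ((2 * π) ^ d)⁻¹ • ∫ x, f x := by
  rw [normalizedLebesgue, integral_smul_measure, ENNReal.toReal_inv, ENNReal.toReal_pow,
    ENNReal.toReal_ofReal Real.two_pi_pos.le]

instance isProbabilityMeasure_normalizedLebesgue (d : ℕ) :
    IsProbabilityMeasure (normalizedLebesgue d) := by
  refine ⟨?_⟩
  rw [normalizedLebesgue, Measure.smul_apply, volume_pi, Measure.pi_univ]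
  simp only [AddCircle.measure_univ, Finset.prod_const, Finset.card_univ, Fintype.card_fin,
    smul_eq_mul]
  refine ENNReal.inv_mul_cancel (pow_ne_zero _ ?_) (ENNReal.pow_ne_top ENNReal.ofReal_ne_top)
  exact (ENNReal.ofReal_pos.2 Real.two_pi_pos).ne'

instance isProbabilityMeasure_haarOn (ξ : E d) : IsProbabilityMeasure (haarOn ξ) := by
  unfold haarOn
  infer_instance

theorem integral_haarOn {a : Phase d → ℂ} (ha : Continuous a) (ξ : E d) :
    ∫ p, a p ∂haarOn ξ = ∫ x, a (x, ξ) ∂normalizedLebesgue d := by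
  rw [haarOn, Measure.prod_dirac, integral_map (by fun_prop) ha.aestronglyMeasurable]

theorem weylMatrix_self {a : Phase d → ℂ} (ha : Continuous a) (ħ : ℝ) (k : Freq d) :
    weylMatrix ħ a k k = ∫ p, a p ∂haarOn (ħ • intVec k) := by
  rw [weylMatrix, symbolCoeff, half_smul_intVec_add_self, sub_self, integral_haarOn ha,
    integral_normalizedLebesgue, ← mul_assoc, ← mul_inv, sqrt_two_pi_pow_mul_self]
  simp only [char_zero, map_one, mul_one]
  rw [Complex.real_smul, Complex.ofReal_inv]

theorem norm_weylMatrix_le {a : Phase d → ℂ} {B : ℝ} (hB : ∀ p, ‖a p‖ ≤ B) (ħ : ℝ)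
    (j k : Freq d) : ‖weylMatrix ħ a j k‖ ≤ B := by
  rw [weylMatrix, symbolCoeff, ← mul_assoc, ← mul_inv, sqrt_two_pi_pow_mul_self,
    ← Complex.ofReal_inv, ← Complex.real_smul, ← integral_normalizedLebesgue]
  have := norm_integral_le_of_norm_le_const (μ := normalizedLebesgue d)
    (f := fun x : Torus d => a (x, (ħ / 2) • intVec (j + k)) * conj (char (j - k) x)) (C := B)
    (Eventually.of_forall fun x => by
      rw [norm_mul, RCLike.norm_conj, norm_char, mul_one]
      exact hB _)
  simpa using this

theorem finite_intVec_mem {K : Set (E d)} (hK : IsCompact K) {c : ℝ} (hc : 0 < c) :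
    {s : Freq d | c • intVec s ∈ K}.Finite := by
  obtain ⟨R, hR⟩ := hK.isBounded.exists_norm_le
  refine (Set.finite_Icc (fun _ : Fin d => -⌈R / c⌉) (fun _ => ⌈R / c⌉)).subset fun s hs => ?_
  have h1 : ∀ i, |(s i : ℝ)| ≤ R / c := by
    intro i
    rw [le_div_iff₀ hc]
    have h2 := (PiLp.norm_apply_le (c • intVec s) i).trans (hR _ hs)
    rw [PiLp.smul_apply, smul_eq_mul, norm_mul, Real.norm_of_nonneg hc.le, mul_comm] at h2
    exact h2
  refine ⟨fun i => ?_, fun i => ?_⟩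
  · have := (abs_le.1 ((h1 i).trans (Int.le_ceil _))).1
    exact_mod_cast this
  · have := (abs_le.1 ((h1 i).trans (Int.le_ceil _))).2
    exact_mod_cast this

theorem weylMatrix_eq_zero {a : Phase d → ℂ} {ħ : ℝ} {j k : Freq d}
    (h : (ħ / 2) • intVec (j + k) ∉ Prod.snd '' tsupport a) : weylMatrix ħ a j k = 0 := by
  have h0 : ∀ x, a (x, (ħ / 2) • intVec (j + k)) = 0 := fun x => by
    by_contra hne
    exact h ⟨_, subset_tsupport _ hne, rfl⟩
  simp only [weylMatrix, symbolCoeff, h0, zero_mul, integral_zero, mul_zero]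

theorem summableDecay_weylMatrix {a : Phase d → ℂ} (hs : HasCompactSupport a) {B : ℝ}
    (hB : ∀ p, ‖a p‖ ≤ B) {ħ : ℝ} (hħ : 0 < ħ) :
    ∃ m, SummableDecay (fun j k => weylMatrix ħ a j (-k)) m := by
  have hfin := finite_intVec_mem (hs.isCompact.image continuous_snd) (half_pos hħ)
  refine ⟨Set.indicator {s : Freq d | (ħ / 2) • intVec s ∈ Prod.snd '' tsupport a} fun _ => B,
    summable_of_hasFiniteSupport (hfin.subset Set.support_indicator_subset), fun j k => ?_⟩
  by_cases h : (ħ / 2) • intVec (j + -k) ∈ Prod.snd '' tsupport a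
  · rw [sub_eq_add_neg, Set.indicator_of_mem (by exact h)]
    exact norm_weylMatrix_le hB ħ _ _
  · rw [weylMatrix_eq_zero h, norm_zero]
    exact Set.indicator_nonneg (fun _ _ => (norm_nonneg _).trans (hB 0)) _

theorem SummableDecay.summable_norm_tsum_neg {M : Freq d → Freq d → ℂ} {m : Freq d → ℝ}
    (h : SummableDecay (fun j k => M j (-k)) m) {c : Freq d → ℂ} (hc : Summable fun j => ‖c j‖) :
    Summable fun j => ‖∑' i, M j i * c i‖ := by
  have h0 : Summable fun k => ‖c (-k)‖ := (Equiv.neg (Freq d)).summable_iff.2 hc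
  have h1 := h.summable_norm_tsum h0
  have h2 : ∀ j, ∑' k, M j (-k) * c (-k) = ∑' k, M j k * c k := fun j =>
    (Equiv.neg (Freq d)).tsum_eq fun k => M j k * c k
  simpa only [h2] using h1

theorem mem_weylOp_domain {a : Phase d → ℂ} (hs : HasCompactSupport a) {B : ℝ}
    (hB : ∀ p, ‖a p‖ ≤ B) {ħ : ℝ} (hħ : 0 < ħ) {ψ : L2T d}
    (hψ : Summable fun j => ‖(torusBasis d).repr ψ j‖) : ψ ∈ (weylOp ħ a).domain := by
  obtain ⟨m, hdec⟩ := summableDecay_weylMatrix hs hB hħ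
  exact ⟨summable_mul_of_bounded (norm_weylMatrix_le hB ħ) hψ,
    memℓp_two_of_summable (hdec.summable_norm_tsum_neg hψ)⟩

theorem wigner_eq {a : Phase d → ℂ} {ħ : ℝ} {ψ : L2T d} (h : ψ ∈ (weylOp ħ a).domain) :
    wigner ħ ψ a = ∑' j, (∑' i, weylMatrix ħ a j i * (torusBasis d).repr ψ i)
      * conj ((torusBasis d).repr ψ j) := by
  rw [wigner, dif_pos h, ← (torusBasis d).repr.inner_map_map, lp.inner_eq_tsum]
  refine tsum_congr fun j => ?_
  have h1 : (torusBasis d).repr (weylOp ħ a ⟨ψ, h⟩) j = matApply (weylMatrix ħ a) ψ j :=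
    repr_matOp (weylMatrix ħ a) ⟨ψ, h⟩ j
  rw [h1]
  rfl

theorem NearMode.summable_repr {ψ : L2T d} {k : Freq d} {η : ℝ} (h : NearMode ψ k η) :
    Summable fun j => ‖(torusBasis d).repr ψ j‖ := by
  obtain ⟨a, -, h2, -⟩ := h
  have hc : Summable fun j => ‖if j = k then a else 0‖ := by
    refine summable_of_ne_finset_zero (s := {k}) fun j hj => ?_
    rw [if_neg (by simpa using hj), norm_zero]
  refine Summable.of_nonneg_of_le (fun _ => norm_nonneg _) (fun i => ?_) (h2.add hc)
  have := norm_add_le ((torusBasis d).repr ψ i - if i = k then a else 0) (if i = k then a else 0)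
  rwa [sub_add_cancel] at this

/-- The Wigner distribution of a function close to a mode is close to the Haar measure of an
invariant torus. -/
theorem NearMode.norm_wigner_sub_le {ψ : L2T d} {k : Freq d} {η : ℝ} (h : NearMode ψ k η)
    (hη : η ≤ 1) {a : Phase d → ℂ} (ha : Continuous a) (hs : HasCompactSupport a) {B : ℝ}
    (hB : ∀ p, ‖a p‖ ≤ B) {ħ : ℝ} (hħ : 0 < ħ) :
    ‖wigner ħ ψ a - ∫ p, a p ∂haarOn (ħ • intVec k)‖ ≤ 8 * B * η := by
  have hdom := mem_weylOp_domain hs hB hħ h.summable_repr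
  obtain ⟨b, h1, h2, h3⟩ := h
  set w := ∑' j, ‖(torusBasis d).repr ψ j - if j = k then b else 0‖ with hw
  have hw0 : 0 ≤ w := tsum_nonneg fun _ => norm_nonneg _
  have hB0 : 0 ≤ B := (norm_nonneg _).trans (hB 0)
  have hc : HasSum (fun j => ‖if j = k then b else 0‖) ‖b‖ := by
    have := hasSum_single (f := fun j => ‖if j = k then b else 0‖) k fun j hj => by
      rw [if_neg hj, norm_zero]
    simpa using this
  have hbl := abs_le.1 h1
  have hform := norm_form_sub_le (norm_weylMatrix_le hB ħ) hc.summable h2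
  rw [← wigner_eq hdom, ← hw, hc.tsum_eq] at hform
  have hdiag : ∑' j, (∑' i, weylMatrix ħ a j i * (if i = k then b else 0))
      * conj (if j = k then b else 0) = ((‖b‖ ^ 2 : ℝ) : ℂ) * ∫ p, a p ∂haarOn (ħ • intVec k) := by
    rw [tsum_eq_single k, tsum_eq_single k, if_pos rfl, weylMatrix_self ha,
      ← Complex.normSq_eq_norm_sq, ← Complex.mul_conj]
    · ring
    · intro i hi
      rw [if_neg hi, mul_zero]
    · intro i hi
      rw [if_neg hi, map_zero, mul_zero]
  have hI : ‖∫ p, a p ∂haarOn (ħ • intVec k)‖ ≤ B := by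
    rw [← weylMatrix_self ha]
    exact norm_weylMatrix_le hB _ _ _
  have h5 : ‖((‖b‖ ^ 2 : ℝ) : ℂ) * ∫ p, a p ∂haarOn (ħ • intVec k)
      - ∫ p, a p ∂haarOn (ħ • intVec k)‖ ≤ 3 * η * B := by
    rw [← sub_one_mul, norm_mul, ← Complex.ofReal_one, ← Complex.ofReal_sub, Complex.norm_real,
      Real.norm_eq_abs]
    refine mul_le_mul ?_ hI (norm_nonneg _) (by linarith)
    have : ‖b‖ ^ 2 - 1 = (‖b‖ - 1) * (‖b‖ + 1) := by ring
    rw [this, abs_mul, abs_of_nonneg (by positivity : (0 : ℝ) ≤ ‖b‖ + 1), mul_comm (3 : ℝ)]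
    exact mul_le_mul h1 (by linarith) (by positivity) (by linarith)
  have h6 : B * w * (w + 2 * ‖b‖) ≤ B * η * 5 := by
    refine mul_le_mul (mul_le_mul_of_nonneg_left h3 hB0) (by linarith) (by positivity) ?_
    exact mul_nonneg hB0 (by linarith)
  rw [hdiag] at hform
  calc _ = ‖(wigner ħ ψ a - ((‖b‖ ^ 2 : ℝ) : ℂ) * ∫ p, a p ∂haarOn (ħ • intVec k))
        + (((‖b‖ ^ 2 : ℝ) : ℂ) * ∫ p, a p ∂haarOn (ħ • intVec k)
          - ∫ p, a p ∂haarOn (ħ • intVec k))‖ := by rw [sub_add_sub_cancel]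
    _ ≤ B * η * 5 + 3 * η * B := (norm_add_le _ _).trans (add_le_add (hform.trans h6) h5)
    _ = _ := by ring

/-! ### Position densities -/

theorem integral_norm_sq (f : L2T d) : ∫ x, ‖f x‖ ^ 2 = ‖f‖ ^ 2 := by
  have h1 : ((∫ x, ‖f x‖ ^ 2 : ℝ) : ℂ) = ((‖f‖ ^ 2 : ℝ) : ℂ) := by
    have h2 := inner_self_eq_norm_sq_to_K (𝕜 := ℂ) f
    rw [L2.inner_def] at h2
    rw [← integral_complex_ofReal, Complex.ofReal_pow]
    refine Eq.trans ?_ h2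
    refine integral_congr_ae (Eventually.of_forall fun x => ?_)
    simp only [inner_self_eq_norm_sq_to_K]
    push_cast
    rfl
  exact_mod_cast h1

theorem integrable_norm_sq (f : L2T d) : Integrable fun x => ‖f x‖ ^ 2 := by
  have := (L2.integrable_inner (𝕜 := ℂ) f f).norm
  refine this.congr (Eventually.of_forall fun x => ?_)
  simp only [inner_self_eq_norm_sq_to_K, norm_pow, RCLike.norm_ofReal, abs_norm]

theorem norm_sq_torusBasis_apply (k : Freq d) :
    ∀ᵐ x, ‖torusBasis d k x‖ ^ 2 = ((2 * π) ^ d)⁻¹ := by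
  rw [coe_torusBasis]
  filter_upwards [Lp.coeFn_smul ((((√(2 * π)) ^ d)⁻¹ : ℂ))
    (ContinuousMap.toLp (E := ℂ) 2 volume ℂ (char k)),
    ContinuousMap.coeFn_toLp (E := ℂ) (p := 2) (𝕜 := ℂ) (volume : Measure (Torus d)) (char k)]
    with x h1 h2
  rw [expL2, h1, Pi.smul_apply, h2, norm_smul, norm_char, mul_one, norm_inv, norm_pow,
    Complex.norm_real, Real.norm_of_nonneg (Real.sqrt_nonneg _), inv_pow, ← pow_mul, mul_comm d 2,
    pow_mul, Real.sq_sqrt Real.two_pi_pos.le]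

/-- The position density of a function close to a mode is close to the uniform density. -/
theorem NearMode.abs_density_sub_le {ψ : L2T d} {k : Freq d} {η : ℝ} (h : NearMode ψ k η)
    (hη0 : 0 < η) (hη : η ≤ 1) (b : C(Torus d, ℝ)) :
    |(∫ x, b x * ‖ψ x‖ ^ 2) - ∫ x, b x ∂normalizedLebesgue d| ≤ 9 * ‖b‖ * η := by
  obtain ⟨a, h1, h2, h3⟩ := h
  have hn := (norm_sub_mode_le h2).trans h3
  set φ := torusBasis d k with hφ
  set w := ψ - a • φ with hw
  have hbl := abs_le.1 h1
  have hbi : ∀ f : L2T d, Integrable fun x => b x * ‖f x‖ ^ 2 := fun f =>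
    (integrable_norm_sq f).bdd_mul b.continuous.aestronglyMeasurable
      (Eventually.of_forall b.norm_coe_le_norm)
  have hφb : ∫ x, b x * ‖φ x‖ ^ 2 = ∫ x, b x ∂normalizedLebesgue d := by
    rw [integral_normalizedLebesgue, smul_eq_mul, ← integral_const_mul]
    refine integral_congr_ae ?_
    filter_upwards [norm_sq_torusBasis_apply k] with x hx
    rw [hφ, hx, mul_comm]
  have hpt : ∀ᵐ x, ‖b x * ‖ψ x‖ ^ 2 - b x * ‖φ x‖ ^ 2‖
      ≤ ‖b‖ * ((1 + η⁻¹) * ‖w x‖ ^ 2 + 7 * η * ‖φ x‖ ^ 2) := by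
    filter_upwards [Lp.coeFn_sub ψ (a • φ), Lp.coeFn_smul a φ] with x hx1 hx2
    rw [← mul_sub, norm_mul]
    refine mul_le_mul (b.norm_coe_le_norm x) ?_ (norm_nonneg _) (norm_nonneg _)
    rw [hw, hx1, Pi.sub_apply, hx2, Pi.smul_apply, smul_eq_mul]
    set p := ‖ψ x‖
    set q := ‖φ x‖ with hq
    set r := ‖ψ x - a * φ x‖
    have hq0 : 0 ≤ q := norm_nonneg _
    have hr0 : 0 ≤ r := norm_nonneg _
    have hp0 : 0 ≤ p := norm_nonneg _
    have hpq : |p - ‖a‖ * q| ≤ r := by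
      rw [hq, ← norm_mul]
      exact abs_norm_sub_norm_le _ _
    have hpr := abs_le.1 hpq
    have e1 : |p ^ 2 - (‖a‖ * q) ^ 2| ≤ r * (r + 2 * (‖a‖ * q)) := by
      have : p ^ 2 - (‖a‖ * q) ^ 2 = (p - ‖a‖ * q) * (p + ‖a‖ * q) := by ring
      rw [this, abs_mul, abs_of_nonneg (by positivity : 0 ≤ p + ‖a‖ * q)]
      exact mul_le_mul hpq (by linarith) (by positivity) hr0
    have e2 : |(‖a‖ * q) ^ 2 - q ^ 2| ≤ 3 * η * q ^ 2 := by
      have : (‖a‖ * q) ^ 2 - q ^ 2 = (‖a‖ - 1) * ((‖a‖ + 1) * q ^ 2) := by ring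
      rw [this, abs_mul, abs_of_nonneg (by positivity : 0 ≤ (‖a‖ + 1) * q ^ 2)]
      calc |‖a‖ - 1| * ((‖a‖ + 1) * q ^ 2) ≤ η * (3 * q ^ 2) := by
            refine mul_le_mul h1 ?_ (by positivity) hη0.le
            exact mul_le_mul_of_nonneg_right (by linarith) (by positivity)
        _ = _ := by ring
    have e3 : 2 * r * (‖a‖ * q) ≤ η⁻¹ * r ^ 2 + η * (‖a‖ * q) ^ 2 := by
      have := sq_nonneg (r - η * (‖a‖ * q))
      have h4 : 0 ≤ η⁻¹ * (r - η * (‖a‖ * q)) ^ 2 := by positivity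
      have h5 : η⁻¹ * (r - η * (‖a‖ * q)) ^ 2
          = η⁻¹ * r ^ 2 - 2 * r * (‖a‖ * q) + η * (‖a‖ * q) ^ 2 := by
        field_simp
        ring
      linarith
    have e4 : (‖a‖ * q) ^ 2 ≤ 4 * q ^ 2 := by
      rw [mul_pow]
      refine mul_le_mul_of_nonneg_right ?_ (by positivity)
      nlinarith [norm_nonneg a]
    have e5 : η * (‖a‖ * q) ^ 2 ≤ η * (4 * q ^ 2) := mul_le_mul_of_nonneg_left e4 hη0.le
    rw [Real.norm_eq_abs]
    refine (abs_sub_le _ ((‖a‖ * q) ^ 2) _).trans ((add_le_add e1 e2).trans ?_)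
    nlinarith
  rw [← hφb, ← integral_sub (hbi ψ) (hbi φ), ← Real.norm_eq_abs]
  have hint : Integrable fun x => (1 + η⁻¹) * ‖w x‖ ^ 2 + 7 * η * ‖φ x‖ ^ 2 :=
    ((integrable_norm_sq w).const_mul _).add ((integrable_norm_sq φ).const_mul _)
  refine (norm_integral_le_of_norm_le (hint.const_mul _) hpt).trans ?_
  rw [integral_const_mul, integral_add ((integrable_norm_sq w).const_mul _)
    ((integrable_norm_sq φ).const_mul _), integral_const_mul, integral_const_mul,
    integral_norm_sq, integral_norm_sq, norm_torusBasis, one_pow, mul_one, mul_comm (9 : ℝ),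
    mul_assoc]
  refine mul_le_mul_of_nonneg_left ?_ (norm_nonneg _)
  have h4 : ‖w‖ ^ 2 ≤ η ^ 2 := by gcongr
  calc (1 + η⁻¹) * ‖w‖ ^ 2 + 7 * η ≤ (1 + η⁻¹) * η ^ 2 + 7 * η := by gcongr
    _ = η ^ 2 + η + 7 * η := by
      field_simp
    _ ≤ _ := by nlinarith

end TorusKAM

namespace TorusKAM

variable {d : ℕ}

/-! ### Measures on phase space are determined by test functions -/

/-- Integration against a finite measure on the torus, as a continuous linear functional. -/
def integralTorus (P : Measure (Torus d)) [IsFiniteMeasure P] : C(Torus d, ℂ) →L[ℂ] ℂ :=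
  LinearMap.mkContinuous
    { toFun := fun g => ∫ x, g x ∂P
      map_add' := fun f g => by
        simp only [ContinuousMap.add_apply]
        exact integral_add
          (f.continuous.integrable_of_hasCompactSupport (HasCompactSupport.of_compactSpace _))
          (g.continuous.integrable_of_hasCompactSupport (HasCompactSupport.of_compactSpace _))
      map_smul' := fun c g => by
        simp only [ContinuousMap.smul_apply, RingHom.id_apply]
        exact integral_smul _ _ } (P.real Set.univ) fun g => by
    rw [mul_comm (P.real Set.univ)]
    exact norm_integral_le_of_norm_le_const (Eventually.of_forall g.norm_coe_le_norm)

theorem ext_of_integral_continuous {P P' : Measure (Torus d)} [IsFiniteMeasure P]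
    [IsFiniteMeasure P'] (h : ∀ b : C(Torus d, ℝ), ∫ x, b x ∂P = ∫ x, b x ∂P') : P = P' :=
  ext_of_forall_integral_eq_of_IsFiniteMeasure fun f => h f.toContinuousMap

theorem ext_of_integral_char {P P' : Measure (Torus d)} [IsFiniteMeasure P] [IsFiniteMeasure P']
    (h : ∀ k, ∫ x, char k x ∂P = ∫ x, char k x ∂P') : P = P' := by
  set S : Submodule ℂ C(Torus d, ℂ) := LinearMap.ker (integralTorus P - integralTorus P').toLinearMap
    with hS
  have hclosed : IsClosed (S : Set C(Torus d, ℂ)) :=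
    (integralTorus P - integralTorus P').isClosed_ker
  have htop : S = ⊤ := by
    rw [eq_top_iff, ← span_char_closure d]
    refine Submodule.topologicalClosure_minimal _ (Submodule.span_le.2 ?_) hclosed
    rintro _ ⟨k, rfl⟩
    exact sub_eq_zero.2 (h k)
  refine ext_of_integral_continuous fun b => ?_
  have h1 : (⟨fun x => (b x : ℂ), by fun_prop⟩ : C(Torus d, ℂ)) ∈ S := htop ▸ Submodule.mem_top
  have h2 : ∫ x, (b x : ℂ) ∂P = ∫ x, (b x : ℂ) ∂P' := sub_eq_zero.1 h1
  rw [integral_complex_ofReal, integral_complex_ofReal] at h2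
  exact_mod_cast h2

theorem hasCompactSupport_fiber {F : Type*} [Zero F] {φ : E d → F} (hφ : HasCompactSupport φ) :
    HasCompactSupport fun p : Phase d => φ p.2 := by
  refine HasCompactSupport.intro (K := Set.univ ×ˢ tsupport φ) (isCompact_univ.prod hφ) ?_
  rintro ⟨x, ξ⟩ hp
  exact image_eq_zero_of_notMem_tsupport fun h => hp ⟨trivial, h⟩

theorem smoothSymbol_char_mul (k : Freq d) {φ : E d → ℝ}
    (hφ : ContDiff ℝ ((⊤ : ℕ∞) : WithTop ℕ∞) φ) :
    SmoothSymbol fun p : Phase d => (φ p.2 : ℂ) * char k p.1 := by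
  unfold SmoothSymbol
  simp only [char_coe]
  refine ContDiff.mul (Complex.ofRealCLM.contDiff.comp (hφ.comp contDiff_snd)) ?_
  exact (contDiff_const.mul (Complex.ofRealCLM.contDiff.comp
    (contDiff_const.inner ℝ contDiff_fst))).cexp

section Uniqueness

variable {μ ν : Measure (Phase d)}

/-- The marginal on the torus of `μ` weighted by a function of `ξ`. -/
def marginal (μ : Measure (Phase d)) (φ : E d → ℝ) : Measure (Torus d) :=
  (μ.withDensity fun p => ENNReal.ofReal (φ p.2)).map Prod.fst

theorem integral_marginal {φ : E d → ℝ} (hφ : Continuous φ) (h0 : ∀ ξ, 0 ≤ φ ξ)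
    (g : C(Torus d, ℂ)) : ∫ x, g x ∂marginal μ φ = ∫ p, (φ p.2 : ℂ) * g p.1 ∂μ := by
  have hm : Measurable fun p : Phase d => ENNReal.ofReal (φ p.2) :=
    (hφ.measurable.comp measurable_snd).ennreal_ofReal
  rw [marginal, integral_map measurable_fst.aemeasurable g.continuous.aestronglyMeasurable,
    integral_withDensity_eq_integral_toReal_smul hm
      (Eventually.of_forall fun _ => ENNReal.ofReal_lt_top)]
  simp only [ENNReal.toReal_ofReal (h0 _), Complex.real_smul]

theorem marginal_apply {φ : E d → ℝ} {A : Set (Torus d)} (hA : MeasurableSet A) :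
    marginal μ φ A = ∫⁻ p in Prod.fst ⁻¹' A, ENNReal.ofReal (φ p.2) ∂μ := by
  rw [marginal, Measure.map_apply measurable_fst hA, withDensity_apply _ (measurable_fst hA)]

variable [IsLocallyFiniteMeasure μ] [IsLocallyFiniteMeasure ν]

theorem isFiniteMeasure_marginal {φ : E d → ℝ} (hφ : Continuous φ) (hs : HasCompactSupport φ) :
    IsFiniteMeasure (marginal μ φ) := by
  have h1 : Integrable (fun p : Phase d => φ p.2) μ :=
    (hφ.comp continuous_snd).integrable_of_hasCompactSupport (hasCompactSupport_fiber hs)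
  have := isFiniteMeasure_withDensity_ofReal h1.2
  unfold marginal
  infer_instance

theorem marginal_eq (h : ∀ a : Phase d → ℂ, SmoothSymbol a → HasCompactSupport a →
      ∫ p, a p ∂μ = ∫ p, a p ∂ν) {φ : E d → ℝ}
    (hφ : ContDiff ℝ ((⊤ : ℕ∞) : WithTop ℕ∞) φ) (hs : HasCompactSupport φ) (h0 : ∀ ξ, 0 ≤ φ ξ) :
    marginal μ φ = marginal ν φ := by
  have := isFiniteMeasure_marginal (μ := μ) hφ.continuous hs
  have := isFiniteMeasure_marginal (μ := ν) hφ.continuous hs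
  refine ext_of_integral_char fun k => ?_
  rw [integral_marginal hφ.continuous h0, integral_marginal hφ.continuous h0]
  refine h _ (smoothSymbol_char_mul k hφ) (HasCompactSupport.mul_right ?_)
  exact hasCompactSupport_fiber (hs.comp_left (g := Complex.ofReal) Complex.ofReal_zero)

theorem measure_prod_eq (h : ∀ a : Phase d → ℂ, SmoothSymbol a → HasCompactSupport a →
      ∫ p, a p ∂μ = ∫ p, a p ∂ν) {A : Set (Torus d)} (hA : MeasurableSet A) {U : Set (E d)}
    (hU : IsOpen U) (hb : Bornology.IsBounded U) : μ (A ×ˢ U) = ν (A ×ˢ U) := by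
  obtain ⟨f, hfs, hf, hf01⟩ := hU.exists_contDiff_support_eq (n := ⊤)
  have hf0 : ∀ ξ, 0 ≤ f ξ := fun ξ => (hf01 ⟨ξ, rfl⟩).1
  set φ : ℕ → E d → ℝ := fun n ξ => Real.smoothTransition (n * f ξ) with hφ
  have hφ0 : ∀ n ξ, 0 ≤ φ n ξ := fun n ξ => Real.smoothTransition.nonneg _
  have hφd : ∀ n, ContDiff ℝ ((⊤ : ℕ∞) : WithTop ℕ∞) (φ n) := fun n =>
    Real.smoothTransition.contDiff.comp (contDiff_const.mul hf)
  have hφs : ∀ n, HasCompactSupport (φ n) := by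
    refine fun n => HasCompactSupport.intro hb.isCompact_closure fun ξ hξ => ?_
    have : f ξ = 0 := by
      by_contra hne
      exact hξ (subset_closure (hfs ▸ hne))
    simp only [hφ, this, mul_zero]
    exact Real.smoothTransition.zero_iff_nonpos.2 le_rfl
  have hmono : ∀ ξ, Monotone fun n => φ n ξ := fun ξ m n hmn =>
    Real.smoothTransition.monotone (mul_le_mul_of_nonneg_right (Nat.cast_le.2 hmn) (hf0 ξ))
  have hlim : ∀ ξ, Tendsto (fun n => ENNReal.ofReal (φ n ξ)) atTop
      (𝓝 (U.indicator (fun _ => 1) ξ)) := by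
    intro ξ
    by_cases hξ : ξ ∈ U
    · rw [Set.indicator_of_mem hξ]
      have hpos : 0 < f ξ := lt_of_le_of_ne (hf0 ξ) (Ne.symm (by
        have : ξ ∈ Function.support f := hfs ▸ hξ
        exact this))
      refine tendsto_const_nhds.congr' ?_
      have h1 : Tendsto (fun n : ℕ => (n : ℝ) * f ξ) atTop atTop :=
        tendsto_natCast_atTop_atTop.atTop_mul_const hpos
      filter_upwards [h1.eventually_ge_atTop 1] with n hn
      simp only [hφ, Real.smoothTransition.one_of_one_le hn, ENNReal.ofReal_one]
    · rw [Set.indicator_of_notMem hξ]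
      have : f ξ = 0 := by
        by_contra hne
        exact hξ (hfs ▸ hne)
      have h0 : ∀ n, φ n ξ = 0 := fun n => by
        simp only [hφ, this, mul_zero]
        exact Real.smoothTransition.zero_iff_nonpos.2 le_rfl
      simp only [h0, ENNReal.ofReal_zero]
      exact tendsto_const_nhds
  have key : ∀ μ : Measure (Phase d), Tendsto (fun n => marginal μ (φ n) A) atTop
      (𝓝 (μ (A ×ˢ U))) := by
    intro μ
    have h1 := lintegral_tendsto_of_tendsto_of_monotone (μ := μ.restrict (Prod.fst ⁻¹' A))
      (f := fun n p => ENNReal.ofReal (φ n p.2)) (F := fun p => U.indicator (fun _ => 1) p.2)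
      (fun n => (((hφd n).continuous.measurable.comp measurable_snd).ennreal_ofReal).aemeasurable)
      (Eventually.of_forall fun p m n hmn => ENNReal.ofReal_le_ofReal (hmono p.2 hmn))
      (Eventually.of_forall fun p => hlim p.2)
    simp only [marginal_apply hA]
    convert h1 using 2
    have h2 : (fun p : Phase d => U.indicator (fun _ => (1 : ℝ≥0∞)) p.2)
        = (Prod.snd ⁻¹' U).indicator fun _ => 1 := rfl
    rw [h2, lintegral_indicator_const (measurable_snd hU.measurableSet), one_mul,
      Measure.restrict_apply (measurable_snd hU.measurableSet), Set.prod_eq, Set.inter_comm]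
  refine tendsto_nhds_unique (key μ) ?_
  simp only [marginal_eq h (hφd _) (hφs _) (hφ0 _)]
  exact key ν

/-- Locally finite measures on phase space that agree on `C_c^∞` are equal. -/
theorem ext_of_test (h : ∀ a : Phase d → ℂ, SmoothSymbol a → HasCompactSupport a →
    ∫ p, a p ∂μ = ∫ p, a p ∂ν) : μ = ν := by
  have huniv : ⋃ n : ℕ, (Set.univ : Set (Torus d)) ×ˢ Metric.ball (0 : E d) n = Set.univ := by
    refine Set.eq_univ_of_forall fun p => Set.mem_iUnion.2 ?_
    obtain ⟨n, hn⟩ := exists_nat_gt ‖p.2‖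
    exact ⟨n, trivial, by simpa using hn⟩
  refine (Measure.ext_iff_of_iUnion_eq_univ huniv).2 fun n => ?_
  have hball : MeasurableSet ((Set.univ : Set (Torus d)) ×ˢ Metric.ball (0 : E d) n) :=
    MeasurableSet.univ.prod measurableSet_ball
  have hfin : ∀ (μ : Measure (Phase d)) [IsLocallyFiniteMeasure μ],
      μ (Set.univ ×ˢ Metric.ball (0 : E d) n) < ∞ := by
    intro μ _
    refine (measure_mono (Set.prod_mono_right Metric.ball_subset_closedBall)).trans_lt
      (isCompact_univ.prod (isCompact_closedBall (0 : E d) n)).measure_lt_top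
  have hf1 : IsFiniteMeasure (μ.restrict (Set.univ ×ˢ Metric.ball (0 : E d) n)) :=
    isFiniteMeasure_restrict.2 (hfin μ).ne
  refine Measure.ext_prod fun {A t} hA ht => ?_
  have hsect : (μ.restrict (A ×ˢ Metric.ball (0 : E d) n)).map Prod.snd
      = (ν.restrict (A ×ˢ Metric.ball (0 : E d) n)).map Prod.snd := by
    have hf2 : IsFiniteMeasure (μ.restrict (A ×ˢ Metric.ball (0 : E d) n)) :=
      isFiniteMeasure_restrict.2
        ((measure_mono (Set.prod_mono_left (Set.subset_univ A))).trans_lt (hfin μ)).ne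
    have key : ∀ s : Set (E d), IsOpen s →
        (μ.restrict (A ×ˢ Metric.ball (0 : E d) n)).map Prod.snd s
          = (ν.restrict (A ×ˢ Metric.ball (0 : E d) n)).map Prod.snd s := by
      intro s hs
      have e1 : (Prod.snd ⁻¹' s ∩ A ×ˢ Metric.ball (0 : E d) n : Set (Phase d))
          = A ×ˢ (s ∩ Metric.ball 0 n) := by
        ext p
        simp only [Set.mem_inter_iff, Set.mem_preimage, Set.mem_prod]
        tauto
      rw [Measure.map_apply measurable_snd hs.measurableSet,
        Measure.map_apply measurable_snd hs.measurableSet,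
        Measure.restrict_apply (measurable_snd hs.measurableSet),
        Measure.restrict_apply (measurable_snd hs.measurableSet), e1]
      exact measure_prod_eq h hA (hs.inter Metric.isOpen_ball)
        (Metric.isBounded_ball.subset Set.inter_subset_right)
    exact ext_of_generate_finite _ (BorelSpace.measurable_eq (α := E d)) isPiSystem_isOpen
      (fun s hs => key s hs) (key _ isOpen_univ)
  have e2 : A ×ˢ t ∩ (Set.univ : Set (Torus d)) ×ˢ Metric.ball (0 : E d) n
      = Prod.snd ⁻¹' t ∩ A ×ˢ Metric.ball (0 : E d) n := by
    ext p
    simp only [Set.mem_inter_iff, Set.mem_preimage, Set.mem_prod, Set.mem_univ, true_and]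
    tauto
  have h3 := congrArg (fun m : Measure (E d) => m t) hsect
  rwa [Measure.map_apply measurable_snd ht, Measure.map_apply measurable_snd ht,
    Measure.restrict_apply (measurable_snd ht), Measure.restrict_apply (measurable_snd ht), ← e2,
    ← Measure.restrict_apply (hA.prod ht), ← Measure.restrict_apply (hA.prod ht)] at h3

end Uniqueness

end TorusKAM

namespace TorusKAM

variable {d : ℕ}

/-! ### Semiclassical measures and quantum limits -/

theorem EigenEq.smul {A : L2T d →ₗ.[ℂ] L2T d} {z : ℂ} {ψ : L2T d} (h : EigenEq A z ψ) (c : ℂ) :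
    EigenEq A z (c • ψ) := by
  obtain ⟨hd, he⟩ := h
  refine ⟨A.domain.smul_mem c hd, ?_⟩
  have : A ⟨c • ψ, A.domain.smul_mem c hd⟩ = c • A ⟨ψ, hd⟩ := A.map_smul c ⟨ψ, hd⟩
  rw [this, he, smul_comm]

theorem Diagonalized.exists_unit_eigenvector {A : L2T d →ₗ.[ℂ] L2T d} {D : Freq d → ℝ} {κ : ℝ}
    {U : Freq d → Freq d → ℂ} {μ : Freq d → ℝ} (h : Diagonalized A D κ U μ) (hκ : κ ≤ 1 / 8)
    (k : Freq d) : ∃ ψ : L2T d, ‖ψ‖ = 1 ∧ EigenEq A (D k : ℂ) ψ := by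
  have hk : (D k : ℂ) ∈ pointSpectrum A := by
    rw [h.pointSpectrum_eq hκ]
    exact ⟨k, rfl⟩
  obtain ⟨ψ, hψ0, hψ⟩ := hk
  exact ⟨((‖ψ‖⁻¹ : ℝ) : ℂ) • ψ, by simp [norm_smul, hψ0], hψ.smul _⟩

theorem norm_le_sqrt_mul {x : E d} {c : ℝ} (hc : 0 ≤ c) (h : ∀ i, |x i| ≤ c) : ‖x‖ ≤ √d * c := by
  rw [EuclideanSpace.norm_eq]
  refine Real.sqrt_le_iff.2 ⟨by positivity, ?_⟩
  rw [mul_pow, Real.sq_sqrt (Nat.cast_nonneg d)]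
  calc ∑ i, ‖x i‖ ^ 2 ≤ ∑ _i : Fin d, c ^ 2 := by
        refine Finset.sum_le_sum fun i _ => ?_
        have := h i
        rw [Real.norm_eq_abs]
        gcongr
    _ = _ := by simp

theorem exists_norm_smul_intVec_sub_le {ħ : ℝ} (hħ : 0 < ħ) (ξ : E d) :
    ∃ k : Freq d, ‖ħ • intVec k - ξ‖ ≤ √d * ħ := by
  refine ⟨fun i => ⌊ξ i / ħ⌋, norm_le_sqrt_mul hħ.le fun i => ?_⟩
  have h1 : (ħ • intVec (fun i => ⌊ξ i / ħ⌋) - ξ : E d) i = ħ * (⌊ξ i / ħ⌋ - ξ i / ħ) := by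
    rw [mul_sub, mul_div_cancel₀ _ hħ.ne']
    rfl
  have h2 := Int.floor_le (ξ i / ħ)
  have h3 := Int.lt_floor_add_one (ξ i / ħ)
  rw [h1, abs_mul, abs_of_pos hħ]
  have h4 : |(⌊ξ i / ħ⌋ - ξ i / ħ : ℝ)| ≤ 1 := abs_le.2 ⟨by linarith, by linarith⟩
  nlinarith

section Sequences

variable {A : ℝ → L2T d →ₗ.[ℂ] L2T d} {ω : E d}

/-- The eigenfunctions of an asymptotically diagonalized family concentrate on single modes. -/
theorem EigenSequence.exists_nearMode (hA : AsymptoticallyDiagonalized A ω) {ħ lam : ℕ → ℝ}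
    {ψ : ℕ → L2T d} (h : EigenSequence A ħ lam ψ) :
    ∃ (k : ℕ → Freq d) (η : ℕ → ℝ), Tendsto η atTop (𝓝 0) ∧ ∀ᶠ n in atTop, 0 < η n ∧ η n ≤ 1 ∧
      NearMode (ψ n) (k n) (η n) ∧ lam n = ħ n * inner ℝ ω (intVec (k n)) := by
  obtain ⟨κ, ħ₀, hκ, hħ₀, hdiag⟩ := hA
  have hstep : ∀ n, ∃ k : Freq d, ħ n ≤ ħ₀ → 0 ≤ κ (ħ n) ∧ NearMode (ψ n) k (2 * κ (ħ n)) ∧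
      lam n = ħ n * inner ℝ ω (intVec k) := by
    intro n
    by_cases hn : ħ n ≤ ħ₀
    · obtain ⟨h8, U, μ, hU⟩ := hdiag (ħ n) ⟨(h.mem n).1, hn⟩
      have hψ0 : ψ n ≠ 0 := fun h0 => by
        have := h.norm_eq n
        rw [h0, norm_zero] at this
        exact zero_ne_one this
      obtain ⟨k, a, hk, ha⟩ := hU.unique _ _ hψ0 (h.eigen n)
      exact ⟨k, fun _ => ⟨(tsum_nonneg hU.near_one.nonneg).trans hU.le,
        hU.nearMode h8 (h.norm_eq n) ha, Complex.ofReal_injective hk⟩⟩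
    · exact ⟨0, fun h => absurd h hn⟩
  choose k hk using hstep
  have hħ : Tendsto ħ atTop (𝓝[>] 0) := tendsto_nhdsWithin_iff.2
    ⟨h.tendsto_zero, Eventually.of_forall fun n => (h.mem n).1⟩
  have hη : Tendsto (fun n => 2 * κ (ħ n) + ħ n) atTop (𝓝 0) := by
    simpa using ((hκ.comp hħ).const_mul 2).add h.tendsto_zero
  refine ⟨k, _, hη, ?_⟩
  filter_upwards [h.tendsto_zero.eventually_lt_const hħ₀.1, hη.eventually_lt_const one_pos]
    with n hn hn1
  obtain ⟨h1, h2, h3⟩ := hk n hn.le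
  have h4 := (h.mem n).1
  exact ⟨by positivity, hn1.le, h2.mono (by linarith), h3⟩

theorem tendsto_wigner_sub {ħ : ℕ → ℝ} (hħ : ∀ n, 0 < ħ n) {ψ : ℕ → L2T d} {k : ℕ → Freq d}
    {η : ℕ → ℝ} (hη : Tendsto η atTop (𝓝 0))
    (h : ∀ᶠ n in atTop, η n ≤ 1 ∧ NearMode (ψ n) (k n) (η n)) {a : Phase d → ℂ}
    (ha : Continuous a) (hs : HasCompactSupport a) :
    Tendsto (fun n => wigner (ħ n) (ψ n) a - ∫ p, a p ∂haarOn (ħ n • intVec (k n))) atTop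
      (𝓝 0) := by
  obtain ⟨B, hB⟩ := hs.exists_bound_of_continuous ha
  refine squeeze_zero_norm' (a := fun n => 8 * B * η n) ?_ (by simpa using hη.const_mul (8 * B))
  filter_upwards [h] with n hn
  exact hn.2.norm_wigner_sub_le hn.1 ha hs hB (hħ n)

theorem tendsto_density {ψ : ℕ → L2T d} {k : ℕ → Freq d} {η : ℕ → ℝ}
    (hη : Tendsto η atTop (𝓝 0))
    (h : ∀ᶠ n in atTop, 0 < η n ∧ η n ≤ 1 ∧ NearMode (ψ n) (k n) (η n)) (b : C(Torus d, ℝ)) :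
    Tendsto (fun n => ∫ x, b x * ‖ψ n x‖ ^ 2) atTop
      (𝓝 (∫ x, b x ∂normalizedLebesgue d)) := by
  refine tendsto_iff_norm_sub_tendsto_zero.2 ?_
  refine squeeze_zero' (Eventually.of_forall fun _ => norm_nonneg _)
    (g := fun n => 9 * ‖b‖ * η n) ?_ (by simpa using hη.const_mul (9 * ‖b‖))
  filter_upwards [h] with n hn
  exact hn.2.2.abs_density_sub_le hn.1 hn.2.1 b

/-- Every sequence of momenta on `ω · ξ = 1` is approximated by eigenfunctions. -/
theorem AsymptoticallyDiagonalized.exists_eigenSequence (hA : AsymptoticallyDiagonalized A ω)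
    {ξ : ℕ → E d} (hξ : ∀ n, inner ℝ ω (ξ n) = 1) :
    ∃ (ħ lam : ℕ → ℝ) (ψ : ℕ → L2T d) (k : ℕ → Freq d), EigenSequence A ħ lam ψ ∧
      (∀ n, lam n = ħ n * inner ℝ ω (intVec (k n))) ∧
      Tendsto (fun n => ħ n • intVec (k n) - ξ n) atTop (𝓝 0) := by
  obtain ⟨κ, ħ₀, hκ, hħ₀, hdiag⟩ := hA
  set ħ : ℕ → ℝ := fun n => ħ₀ * (1 / ((n : ℝ) + 1)) with hħ
  have hpos : ∀ n, 0 < ħ n := fun n => mul_pos hħ₀.1 Nat.one_div_pos_of_nat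
  have hle : ∀ n, ħ n ≤ ħ₀ := fun n => by
    refine mul_le_of_le_one_right hħ₀.1.le ?_
    rw [div_le_one (by positivity)]
    linarith [Nat.cast_nonneg (α := ℝ) n]
  have hlim : Tendsto ħ atTop (𝓝 0) := by
    simpa only [mul_zero] using (tendsto_one_div_add_atTop_nhds_zero_nat (𝕜 := ℝ)).const_mul ħ₀
  choose k hk using fun n => exists_norm_smul_intVec_sub_le (hpos n) (ξ n)
  have hψ : ∀ n, ∃ ψ : L2T d, ‖ψ‖ = 1 ∧
      EigenEq (A (ħ n)) ((ħ n * inner ℝ ω (intVec (k n)) : ℝ) : ℂ) ψ := by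
    intro n
    obtain ⟨h8, U, μ, hU⟩ := hdiag (ħ n) ⟨hpos n, hle n⟩
    exact hU.exists_unit_eigenvector h8 (k n)
  choose ψ hψ1 hψ2 using hψ
  have hclose : Tendsto (fun n => ħ n • intVec (k n) - ξ n) atTop (𝓝 0) :=
    squeeze_zero_norm hk (by simpa using hlim.const_mul √d)
  refine ⟨ħ, _, ψ, k, ⟨fun n => ⟨hpos n, (hle n).trans hħ₀.2⟩, hlim, hψ1, hψ2, ?_⟩,
    fun n => rfl, hclose⟩
  have h1 : Tendsto (fun n => inner ℝ ω (ħ n • intVec (k n) - ξ n) + 1) atTop (𝓝 (0 + 1)) := by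
    refine Tendsto.add_const 1 ?_
    have h2 := ((continuous_const (y := ω)).inner (continuous_id (X := E d)) (𝕜 := ℝ)).tendsto 0
    simp only [id, inner_zero_right] at h2
    exact h2.comp hclose
  rw [zero_add] at h1
  refine h1.congr fun n => ?_
  rw [inner_sub_right, hξ, sub_add_cancel, real_inner_smul_right]

theorem tendsto_integral_haarOn {a : Phase d → ℂ} (ha : Continuous a) (hs : HasCompactSupport a)
    {ζ : ℕ → E d} {ξ : E d} (h : Tendsto ζ atTop (𝓝 ξ)) :
    Tendsto (fun n => ∫ p, a p ∂haarOn (ζ n)) atTop (𝓝 (∫ p, a p ∂haarOn ξ)) := by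
  obtain ⟨B, hB⟩ := hs.exists_bound_of_continuous ha
  simp only [integral_haarOn ha]
  refine tendsto_integral_of_dominated_convergence (fun _ => B) (fun n => ?_)
    (integrable_const B) (fun n => Eventually.of_forall fun x => hB _)
    (Eventually.of_forall fun x => ?_)
  · exact (ha.comp (by fun_prop)).aestronglyMeasurable
  · exact (ha.tendsto (x, ξ)).comp (tendsto_const_nhds.prodMk_nhds h)

theorem tendsto_integral_haarOn_zero {a : Phase d → ℂ} (ha : Continuous a)
    (hs : HasCompactSupport a) {ζ : ℕ → E d} (h : Tendsto (fun n => ‖ζ n‖) atTop atTop) :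
    Tendsto (fun n => ∫ p, a p ∂haarOn (ζ n)) atTop (𝓝 0) := by
  obtain ⟨R, hR⟩ := (hs.isCompact.image continuous_snd).isBounded.exists_norm_le
  refine tendsto_const_nhds.congr' ?_
  filter_upwards [h.eventually_gt_atTop R] with n hn
  have h0 : ∀ x, a (x, ζ n) = 0 := fun x => by
    by_contra hne
    exact absurd (hR _ ⟨_, subset_tsupport _ hne, rfl⟩) (not_le.2 hn)
  simp only [integral_haarOn ha, h0, integral_zero]

theorem exists_orthogonal_ne_zero (hd : 2 ≤ d) (ω : E d) : ∃ v : E d, v ≠ 0 ∧ inner ℝ ω v = 0 := by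
  have h1 : LinearMap.ker (innerSL ℝ ω).toLinearMap ≠ ⊥ := by
    refine LinearMap.ker_ne_bot_of_finrank_lt ?_
    rw [finrank_euclideanSpace_fin, Module.finrank_self]
    omega
  obtain ⟨v, hv, hv0⟩ := Submodule.exists_mem_ne_zero_of_ne_bot h1
  exact ⟨v, hv0, hv⟩

theorem exists_inner_eq_one (hd : 2 ≤ d) (hω : Function.Injective (frequency ω)) :
    ∃ ξ : E d, inner ℝ ω ξ = 1 := by
  have hω0 : ω ≠ 0 := by
    intro h0
    have h1 : (Pi.single ⟨0, by omega⟩ 1 : Freq d) = 0 := hω (by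
      rw [map_zero, frequency_apply, h0, inner_zero_left])
    simpa using congrFun h1 ⟨0, by omega⟩
  refine ⟨(‖ω‖ ^ 2)⁻¹ • ω, ?_⟩
  rw [real_inner_smul_right, real_inner_self_eq_norm_sq]
  exact inv_mul_cancel₀ (pow_ne_zero 2 (norm_ne_zero_iff.2 hω0))

theorem AsymptoticallyDiagonalized.semiclassicalMeasures_eq (hd : 2 ≤ d)
    (hω : Function.Injective (frequency ω)) (hA : AsymptoticallyDiagonalized A ω) :
    semiclassicalMeasures A = {μ | ∃ ξ : E d, inner ℝ ω ξ = 1 ∧ μ = haarOn ξ} ∪ {0} := by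
  have hexists : ∀ ξ : ℕ → E d, (∀ n, inner ℝ ω (ξ n) = 1) →
      ∃ (ħ lam : ℕ → ℝ) (ψ : ℕ → L2T d) (ζ : ℕ → E d), EigenSequence A ħ lam ψ ∧
        Tendsto (fun n => ζ n - ξ n) atTop (𝓝 0) ∧
        ∀ a : Phase d → ℂ, Continuous a → HasCompactSupport a →
          Tendsto (fun n => wigner (ħ n) (ψ n) a - ∫ p, a p ∂haarOn (ζ n)) atTop (𝓝 0) := by
    intro ξ hξ
    obtain ⟨ħ, lam, ψ, k, hseq, hlam, hclose⟩ := hA.exists_eigenSequence hξ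
    obtain ⟨k', η, hη, hev⟩ := hseq.exists_nearMode hA
    refine ⟨ħ, lam, ψ, _, hseq, hclose, fun a ha hs => ?_⟩
    refine tendsto_wigner_sub (fun n => (hseq.mem n).1) hη ?_ ha hs
    filter_upwards [hev] with n hn
    have hk : k' n = k n := by
      refine hω (mul_left_cancel₀ (hseq.mem n).1.ne' ?_)
      rw [frequency_apply, frequency_apply, ← hn.2.2.2, hlam]
    exact ⟨hn.2.1, hk ▸ hn.2.2.1⟩
  ext μ
  constructor
  · rintro ⟨hμ, ħ, lam, ψ, hseq, hlim⟩
    obtain ⟨k, η, hη, hev⟩ := hseq.exists_nearMode hA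
    set ζ : ℕ → E d := fun n => ħ n • intVec (k n) with hζ
    have hint : ∀ a : Phase d → ℂ, SmoothSymbol a → HasCompactSupport a →
        Tendsto (fun n => ∫ p, a p ∂haarOn (ζ n)) atTop (𝓝 (∫ p, a p ∂μ)) := by
      intro a ha hs
      have h1 := (hlim a ha hs).sub (tendsto_wigner_sub (fun n => (hseq.mem n).1) hη
        (hev.mono fun n hn => ⟨hn.2.1, hn.2.2.1⟩) ha.continuous hs)
      simpa using h1
    by_cases hinf : Tendsto (fun n => ‖ζ n‖) atTop atTop
    · right
      refine ext_of_test fun a ha hs => ?_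
      rw [integral_zero_measure]
      exact tendsto_nhds_unique (hint a ha hs)
        (tendsto_integral_haarOn_zero ha.continuous hs hinf)
    · left
      rw [tendsto_atTop] at hinf
      push Not at hinf
      obtain ⟨R, hR⟩ := hinf
      obtain ⟨ξ, -, s, hs, hξ⟩ := (isCompact_closedBall (0 : E d) R).tendsto_subseq' (x := ζ)
        (hR.mono fun n hn => by simpa using le_of_lt hn)
      refine ⟨ξ, ?_, ?_⟩
      · have h1 : Tendsto (fun n => lam (s n)) atTop (𝓝 1) :=
          hseq.tendsto_one.comp hs.tendsto_atTop
        have h2 : Tendsto (fun n => inner ℝ ω (ζ (s n))) atTop (𝓝 (inner ℝ ω ξ)) :=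
          tendsto_const_nhds.inner hξ
        refine tendsto_nhds_unique (h2.congr' ?_) h1
        filter_upwards [hs.tendsto_atTop.eventually hev] with n hn
        rw [hn.2.2.2, hζ, real_inner_smul_right]
      · refine ext_of_test fun a ha hsupp => ?_
        exact tendsto_nhds_unique ((hint a ha hsupp).comp hs.tendsto_atTop)
          (tendsto_integral_haarOn ha.continuous hsupp hξ)
  · rintro (⟨ξ, hξ, rfl⟩ | rfl)
    · obtain ⟨ħ, lam, ψ, ζ, hseq, hζ, hw⟩ := hexists (fun _ => ξ) fun _ => hξ
      refine ⟨inferInstance, ħ, lam, ψ, hseq, fun a ha hs => ?_⟩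
      have hζ' : Tendsto ζ atTop (𝓝 ξ) := by simpa using hζ.add_const ξ
      have h1 := (hw a ha.continuous hs).add (tendsto_integral_haarOn ha.continuous hs hζ')
      simpa using h1
    · obtain ⟨ξ, hξ⟩ := exists_inner_eq_one hd hω
      obtain ⟨v, hv0, hv⟩ := exists_orthogonal_ne_zero hd ω
      obtain ⟨ħ, lam, ψ, ζ, hseq, hζ, hw⟩ := hexists (fun n => ξ + (n : ℝ) • v) fun n => by
        rw [inner_add_right, real_inner_smul_right, hv, mul_zero, add_zero, hξ]
      refine ⟨inferInstance, ħ, lam, ψ, hseq, fun a ha hs => ?_⟩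
      have hinf : Tendsto (fun n => ‖ζ n‖) atTop atTop := by
        have h1 : Tendsto (fun n : ℕ => n * ‖v‖ + -(‖ξ‖ + 1)) atTop atTop :=
          tendsto_atTop_add_const_right _ _
            (tendsto_natCast_atTop_atTop.atTop_mul_const (norm_pos_iff.2 hv0))
        refine tendsto_atTop_mono' _ ?_ h1
        filter_upwards [hζ.norm.eventually_lt_const (by simp : ‖(0 : E d)‖ < 1)] with n hn
        have h2 : (n : ℝ) • v = ζ n - (ζ n - (ξ + (n : ℝ) • v)) - ξ := by abel
        have h3 : n * ‖v‖ = ‖(n : ℝ) • v‖ := by simp [norm_smul]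
        have h4 := norm_sub_le (ζ n - (ζ n - (ξ + (n : ℝ) • v))) ξ
        have h5 := norm_sub_le (ζ n) (ζ n - (ξ + (n : ℝ) • v))
        rw [← h2, ← h3] at h4
        linarith
      have h1 := (hw a ha.continuous hs).add (tendsto_integral_haarOn_zero ha.continuous hs hinf)
      simpa using h1

theorem AsymptoticallyDiagonalized.quantumLimits_eq (hd : 2 ≤ d)
    (hω : Function.Injective (frequency ω)) (hA : AsymptoticallyDiagonalized A ω) :
    quantumLimits A = {normalizedLebesgue d} := by
  have hlim : ∀ {ħ lam : ℕ → ℝ} {ψ : ℕ → L2T d}, EigenSequence A ħ lam ψ →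
      ∀ b : C(Torus d, ℝ), Tendsto (fun n => ∫ x, b x * ‖ψ n x‖ ^ 2) atTop
        (𝓝 (∫ x, b x ∂normalizedLebesgue d)) := by
    intro ħ lam ψ hseq b
    obtain ⟨k, η, hη, hev⟩ := hseq.exists_nearMode hA
    exact tendsto_density hη (hev.mono fun n hn => ⟨hn.1, hn.2.1, hn.2.2.1⟩) b
  ext ν
  constructor
  · rintro ⟨hν, ħ, lam, ψ, hseq, h⟩
    exact ext_of_integral_continuous fun b => tendsto_nhds_unique (h b) (hlim hseq b)
  · rintro rfl
    obtain ⟨ξ, hξ⟩ := exists_inner_eq_one hd hω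
    obtain ⟨ħ, lam, ψ, k, hseq, -, -⟩ := hA.exists_eigenSequence (ξ := fun _ => ξ) fun _ => hξ
    exact ⟨inferInstance, ħ, lam, ψ, hseq, hlim hseq⟩

end Sequences

end TorusKAM

end

theorem theorem3 (d : ℕ) (hd : 2 ≤ d)
    (e : Module.Basis (Fin d) ℝ (TorusKAM.E d)) (χ : SchwartzMap (TorusKAM.E d) ℂ)
    (hχ : TorusKAM.IsPartition e χ) :
    ∃ C : ℝ≥0, ∀ (ω : TorusKAM.E d) (γ ς ρ : ℝ), (d : ℝ) < γ → 0 < ς → 0 < ρ →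
      TorusKAM.Diophantine ω γ ς →
      ∀ V : TorusKAM.Phase d → ℝ, TorusKAM.MemAW e χ ρ V →
      ∀ ε : ℝ → ℝ, (∀ ħ ∈ Set.Ioc (0 : ℝ) 1, 0 < ε ħ) →
        Tendsto (fun ħ => ε ħ / ħ) (𝓝[>] 0) (𝓝 0) →
      ∃ R : ℝ → TorusKAM.E d → ℝ,
        (∀ ħ ∈ Set.Ioc (0 : ℝ) 1,
          TorusKAM.MemSW e χ (fun ξ => (R ħ ξ : ℂ)) ∧
          TorusKAM.normW e χ (fun ξ => (R ħ ξ : ℂ)) ≤ C * TorusKAM.normWρ e χ ρ V) ∧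
        (∃ ħ₀ ∈ Set.Ioc (0 : ℝ) 1, ∀ ħ ∈ Set.Ioc (0 : ℝ) ħ₀,
          TorusKAM.pointSpectrum (TorusKAM.opQ ω ε V R ħ)
            = TorusKAM.pointSpectrum (TorusKAM.opL ω ħ)) ∧
        (∀ ħ ∈ Set.Ioc (0 : ℝ) 1,
          TorusKAM.pointSpectrum (TorusKAM.opL ω ħ)
            = {z : ℂ | ∃ k : TorusKAM.Freq d,
                z = ((ħ * inner ℝ ω (TorusKAM.intVec k) : ℝ) : ℂ)}) ∧
        TorusKAM.semiclassicalMeasures (TorusKAM.opQ ω ε V R)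
          = TorusKAM.semiclassicalMeasures (TorusKAM.opL ω) ∧
        TorusKAM.semiclassicalMeasures (TorusKAM.opL ω)
          = {μ | ∃ ξ : TorusKAM.E d, inner ℝ ω ξ = 1 ∧ μ = TorusKAM.haarOn ξ} ∪ {0} ∧
        TorusKAM.quantumLimits (TorusKAM.opQ ω ε V R) = {TorusKAM.normalizedLebesgue d} := by
  obtain ⟨C, hC⟩ := TorusKAM.exists_counterterm_family e χ hχ
  refine ⟨C, fun ω γ ς ρ hγ hς hρ hω V hV ε hε hlim => ?_⟩
  obtain ⟨R, hR, hQ⟩ := hC ω γ ς ρ hγ hς hρ hω V hV ε hε hlim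
  have hinj := hω.injective hς
  have hspec : ∀ ħ ∈ Set.Ioc (0 : ℝ) 1, TorusKAM.pointSpectrum (TorusKAM.opL ω ħ)
      = {z : ℂ | ∃ k : TorusKAM.Freq d,
          z = ((ħ * inner ℝ ω (TorusKAM.intVec k) : ℝ) : ℂ)} := fun ħ hħ =>
    (TorusKAM.diagonalized_opL hinj hħ.1).pointSpectrum_eq (by norm_num)
  have hL := (TorusKAM.asymptoticallyDiagonalized_opL hinj).semiclassicalMeasures_eq hd hinj
  refine ⟨R, hR, ?_, hspec, (hQ.semiclassicalMeasures_eq hd hinj).trans hL.symm, hL,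
    hQ.quantumLimits_eq hd hinj⟩
  obtain ⟨κ, ħ₀, -, hħ₀, hdiag⟩ := hQ
  refine ⟨ħ₀, hħ₀, fun ħ hħ => ?_⟩
  obtain ⟨h8, U, μ, hU⟩ := hdiag ħ hħ
  rw [hspec ħ ⟨hħ.1, hħ.2.trans hħ₀.2⟩, hU.pointSpectrum_eq h8]
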